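/- Let $\mathbb R^{4,2}$ be a 6-dimensional real vector space with a symmetric bilinear form $(\cdot,\cdot)$ of signature $(4,2)$, and identify $\wedge^2\mathbb R^{4,2}$ with $\mathfrak o(4,2)$ by $(a\wedge b)c=(a,c)b-(b,c)a$. Let $\Sigma$ be a connected smooth 2-manifold, and for a subbundle $W$ of the trivial bundle $\Sigma\times\mathbb R^{4,2}$ let $W^{(1)}$ be spanned by the values and first derivatives of sections of $W$. A Legendre map is a smooth rank 2 subbundle $f$ of isotropic planes with $f^{(1)}\le f^\perp$ such that the only tangent vector $X$ with $d_X\sigma\in f$ for all sections $\sigma$ of $f$ is $X=0$. A curvature sphere of $f$ at a point is a line $s\le f$ such that, for some $X\neq 0$, $d_X\sigma\in f$ for all sections $\sigma$ of $f$ with value in $s$ at the point; $f$ is umbilic-free if it has two distinct curvature spheres at each point. They then form line bundles $s_1,s_2$ with curvature directions $T_1,T_2$. An umbilic-free Legendre map $f$ is an $\Omega$-surface if there is a closed 1-form $\eta$ with values in $f\wedge f^\perp$ such that $[\eta\wedge\eta]=0$ and the quadratic differential $q(X,Y)=\operatorname{tr}(\sigma\mapsto\eta(X)d_Y\sigma:f\to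 f)$ is non-degenerate at every point. Its middle potential $\eta^{mid}$ is the form $\eta-d\tau$, $\tau\in\Gamma(\wedge^2f)$, whose component in $S_1\wedge S_2$ takes values in $\wedge^2 f$; here $\mathfrak o(4,2)=(S_1\wedge S_1\oplus S_2\wedge S_2)\oplus S_1\wedge S_2$ with $S_1=\langle\sigma_1,d_Y\sigma_1,d_Yd_Y\sigma_1\rangle$ and $S_2=\langle\sigma_2,d_X\sigma_2,d_Xd_X\sigma_2\rangle$ for non-vanishing local sections $\sigma_i$ of $s_i$, $X$ of $T_1$, $Y$ of $T_2$. If $q$ is indefinite, write locally $q=(d\sigma_1,d\sigma_1)-(d\sigma_2,d\sigma_2)$ with sections $\sigma_1,\sigma_2$ of the two curvature sphere congruences in a suitable order; they are unique up to sign, and the isothermic sphere congruences are $s^\pm=\langle\sigma_1\pm\sigma_2\rangle$. A linear conserved quantity of the middle pencil is $p(t)=p_0+tp_1$ with smooth $p_0,p_1:\Sigma\to\mathbb R^{4,2}$, $p_1\not\equiv0$ and $(d+t\eta^{mid})p(t)=0$ for all $t\in\mathbb R$; then $p(0)=p_0$ is a constant vector. An $\Omega$-surface that has one is a special $\Omega$-surface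 of type 1. For $\mathfrak p\in\mathbb R^{4,2}$ with $(\mathfrak p,\mathfrak p)\ne0$, an isothermic surface in the conformal geometry $\langle\mathfrak p\rangle^\perp$ is an immersion $\Lambda$ of $\Sigma$ into the projective light cone of $\langle\mathfrak p\rangle^\perp$, viewed as a null line bundle, that admits a closed 1-form with values in $\Lambda\wedge\Lambda^{(1)}$ that is not identically zero. A Legendre map $f$ is a Legendre lift of $\Lambda$ if $\Lambda=f\cap\langle\mathfrak p\rangle^\perp$ at every point. **Theorem.** Let $f$ be an umbilic-free Legendre map on $\Sigma$ and $\mathfrak p\in\mathbb R^{4,2}$. The following are equivalent: 1. $f$ is a special $\Omega$-surface of type 1 for which some closed form $\eta$ as above has a middle pencil with a linear conserved quantity $p$ such that $p(0)=\mathfrak p$ and $(p(t),p(t))$ is a non-zero constant (independent of $t$ and of the point of $\Sigma$); 2. $(\mathfrak p,\mathfrak p)\neq0$ and $f$ is a Legendre lift of an isothermic surface in the conformal geometry $\langle\mathfrak p\rangle^\perp$. Moreover, for every such $\eta$ and $p$, the quadratic differential $q$ is indefinite and one of the two isothermic sphere congruences takes values in $\langle p(0)\rangle^\perp$; it is an isothermic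 surface in that conformal geometry, and $f$ is a Legendre lift of it. -/

import Mathlib

open scoped Manifold ContDiff Topology

noncomputable section

namespace LieSphere

/-- The underlying vector space of the pseudo-Euclidean space of signature `(4,2)`. -/
abbrev R42 : Type := Fin 6 → ℝ

/-- The symmetric bilinear form `x₀y₀ + x₁y₁ + x₂y₂ + x₃y₃ - x₄y₄ - x₅y₅`. -/
def form : LinearMap.BilinForm ℝ R42 :=
  Matrix.toBilin' (Matrix.diagonal ![1, 1, 1, 1, -1, -1])

/-- The orthogonal complement of a subspace with respect to `form`. -/
def perp (W : Submodule ℝ R42) : Submodule ℝ R42 := form.orthogonal W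

/-- A bivector `a ∧ b` as a skew endomorphism: `(a ∧ b) c = (a,c) b - (b,c) a`. -/
def wedge (a b : R42) : R42 →L[ℝ] R42 :=
  LinearMap.toContinuousLinearMap ((form a).smulRight b - (form b).smulRight a)

/-- The space `V ∧ W` of bivectors spanned by all `a ∧ b` with `a ∈ V`, `b ∈ W`. -/
def wedgeSpan (V W : Submodule ℝ R42) : Submodule ℝ (R42 →L[ℝ] R42) :=
  Submodule.span ℝ {A | ∃ a ∈ V, ∃ b ∈ W, A = wedge a b}

section Surface

variable {M : Type*} [TopologicalSpace M] [ChartedSpace (EuclideanSpace ℝ (Fin 2)) M]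

/-- The derivative `X ↦ d_X σ` at `x` of a function `σ` with values in a fixed normed space
(the trivial connection). -/
def dAt {F : Type*} [NormedAddCommGroup F] [NormedSpace ℝ F] (σ : M → F) (x : M) :
    TangentSpace (𝓡 2) x →L[ℝ] F :=
  mfderiv (𝓡 2) 𝓘(ℝ, F) σ x

/-! ### Subbundles of the trivial bundle -/

/-- `σ` is a smooth section of `W` over `U`. -/
structure IsSectionOn (W : M → Submodule ℝ R42) (U : Set M) (σ : M → R42) : Prop where
  smooth : ContMDiffOn (𝓡 2) 𝓘(ℝ, R42) ∞ σ U
  mem : ∀ y ∈ U, σ y ∈ W y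

/-- `W` is a smooth rank `k` subbundle of the trivial bundle: it has smooth local frames. -/
def IsSubbundle (k : ℕ) (W : M → Submodule ℝ R42) : Prop :=
  ∀ x : M, ∃ U : Set M, IsOpen U ∧ x ∈ U ∧ ∃ e : Fin k → M → R42,
    (∀ i, IsSectionOn W U (e i)) ∧
    ∀ y ∈ U, LinearIndependent ℝ (fun i => e i y) ∧
      W y = Submodule.span ℝ (Set.range fun i => e i y)

/-- The fibre at `x` of the derived bundle `W⁽¹⁾`: it is spanned by the values and the
first derivatives at `x` of the local sections of `W`. -/
def derived (W : M → Submodule ℝ R42) (x : M) : Submodule ℝ R42 :=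
  Submodule.span ℝ {v | ∃ (U : Set M) (σ : M → R42), IsOpen U ∧ x ∈ U ∧ IsSectionOn W U σ ∧
    (v = σ x ∨ ∃ X : TangentSpace (𝓡 2) x, v = dAt σ x X)}

/-- The solder form `β(X) v = d_X σ mod W` (with `σ` a section of `W`, `σ(x) = v`) vanishes. -/
def SolderVanishes (W : M → Submodule ℝ R42) (x : M) (X : TangentSpace (𝓡 2) x) (v : R42) :
    Prop :=
  ∀ (U : Set M) (σ : M → R42), IsOpen U → x ∈ U → IsSectionOn W U σ → σ x = v →
    dAt σ x X ∈ W x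

/-- The immersion condition: the solder form `X ↦ β(X) ∈ Hom(W, ℝ⁶/W)` is injective. For a
line bundle it says that the corresponding map into projective space is an immersion. -/
def IsImmersive (W : M → Submodule ℝ R42) : Prop :=
  ∀ (x : M) (X : TangentSpace (𝓡 2) x), (∀ v ∈ W x, SolderVanishes W x X v) → X = 0

/-! ### Legendre maps and curvature spheres -/

/-- A Legendre map, viewed as a rank 2 subbundle of isotropic planes. -/
structure IsLegendre (f : M → Submodule ℝ R42) : Prop where
  subbundle : IsSubbundle 2 f
  isotropic : ∀ x, f x ≤ perp (f x)
  contact : ∀ x, derived f x ≤ perp (f x)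
  immersive : IsImmersive f

/-- The line `s` is a curvature sphere of `f` at `x`. -/
def IsCurvatureSphere (f : M → Submodule ℝ R42) (x : M) (s : Submodule ℝ R42) : Prop :=
  s ≤ f x ∧ Module.finrank ℝ s = 1 ∧
    ∃ T : Submodule ℝ (TangentSpace (𝓡 2) x), T ≠ ⊥ ∧
      ∀ X ∈ T, ∀ v ∈ s, SolderVanishes f x X v

/-- A Legendre map is umbilic-free if there are two distinct curvature spheres at each point. -/
def IsUmbilicFree (f : M → Submodule ℝ R42) : Prop :=
  ∀ x, ∃ s₁ s₂ : Submodule ℝ R42,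
    s₁ ≠ s₂ ∧ IsCurvatureSphere f x s₁ ∧ IsCurvatureSphere f x s₂

/-- Over `U`, `σ₁`, `σ₂` are nowhere zero sections of the two curvature sphere congruences
`s₁`, `s₂`, and `X`, `Y` are nowhere zero sections of their curvature subbundles `T₁`, `T₂`. -/
structure IsCurvatureFrame [IsManifold (𝓡 2) ∞ M] (f : M → Submodule ℝ R42) (U : Set M)
    (σ₁ σ₂ : M → R42)
    (X Y : ∀ y : M, TangentSpace (𝓡 2) y) : Prop where
  section₁ : IsSectionOn f U σ₁
  section₂ : IsSectionOn f U σ₂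
  smooth_X : ContMDiffOn (𝓡 2) (𝓡 2).tangent ∞ (fun y => (⟨y, X y⟩ : TangentBundle (𝓡 2) M)) U
  smooth_Y : ContMDiffOn (𝓡 2) (𝓡 2).tangent ∞ (fun y => (⟨y, Y y⟩ : TangentBundle (𝓡 2) M)) U
  indep : ∀ y ∈ U, LinearIndependent ℝ ![σ₁ y, σ₂ y]
  X_ne : ∀ y ∈ U, X y ≠ 0
  Y_ne : ∀ y ∈ U, Y y ≠ 0
  curv₁ : ∀ y ∈ U, SolderVanishes f y (X y) (σ₁ y)
  curv₂ : ∀ y ∈ U, SolderVanishes f y (Y y) (σ₂ y)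

/-- The function `d_Y σ` for a vector field `Y`. -/
def dirDeriv (Y : ∀ y : M, TangentSpace (𝓡 2) y) (σ : M → R42) : M → R42 :=
  fun y => dAt σ y (Y y)

/-- The fibre at `y` of `⟨σ, d_Y σ, d_Y d_Y σ⟩`. With `(σ₁, Y)` and `(σ₂, X)` from a curvature
frame these are the two summands `S₁`, `S₂` of the Lie cyclide splitting. -/
def cyclide (σ : M → R42) (Y : ∀ y : M, TangentSpace (𝓡 2) y) (y : M) : Submodule ℝ R42 :=
  Submodule.span ℝ {σ y, dirDeriv Y σ y, dirDeriv Y (dirDeriv Y σ) y}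

/-! ### One-forms with values in bivectors -/

variable (M) in
/-- One-forms with values in the endomorphisms of `R42` (smoothness is a separate condition). -/
abbrev OneForm : Type _ :=
  ∀ x : M, TangentSpace (𝓡 2) x →L[ℝ] (R42 →L[ℝ] R42)

/-- The expression of the one-form `η` in the chart `φ`, a one-form on `φ.target ⊆ ℝ²`. -/
def inChart (η : OneForm M) (φ : OpenPartialHomeomorph M (EuclideanSpace ℝ (Fin 2)))
    (y : EuclideanSpace ℝ (Fin 2)) :
    EuclideanSpace ℝ (Fin 2) →L[ℝ] (R42 →L[ℝ] R42) :=
  (η (φ.symm y)).comp (mfderiv (𝓡 2) (𝓡 2) φ.symm y)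

/-- `η` is a smooth closed one-form: in every chart its expression `A` is smooth and
`dA(v,w) = (D_v A) w - (D_w A) v` vanishes. -/
def IsClosedForm (η : OneForm M) : Prop :=
  ∀ φ ∈ IsManifold.maximalAtlas (𝓡 2) ∞ M,
    ContDiffOn ℝ ∞ (inChart η φ) φ.target ∧
    ∀ y ∈ φ.target, ∀ v w : EuclideanSpace ℝ (Fin 2),
      fderiv ℝ (inChart η φ) y v w - fderiv ℝ (inChart η φ) y w v = 0

/-- `[A ∧ B](X,Y) = [A(X),B(Y)] - [A(Y),B(X)]`. -/
def bracketWedge (A B : OneForm M) (x : M) (X Y : TangentSpace (𝓡 2) x) : R42 →L[ℝ] R42 :=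
  (A x X * B x Y - B x Y * A x X) - (A x Y * B x X - B x X * A x Y)

/-- `L` is the endomorphism `σ ↦ η(X) d_Y σ` of the fibre `f x`. -/
def IsPotentialEndo (f : M → Submodule ℝ R42) (η : OneForm M) (x : M)
    (X Y : TangentSpace (𝓡 2) x) (L : f x →ₗ[ℝ] f x) : Prop :=
  ∀ (U : Set M) (σ : M → R42), IsOpen U → x ∈ U → IsSectionOn f U σ →
    ∀ v : f x, (v : R42) = σ x → (L v : R42) = η x X (dAt σ x Y)

open Classical in
/-- The quadratic differential `q(X,Y) = tr(σ ↦ η(X) d_Y σ : f → f)`. For a Legendre map `f` and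
`η` with values in `f ∧ f^⊥` the endomorphism exists and is unique, so the default value `0`
is not used. -/
def quadDiff (f : M → Submodule ℝ R42) (η : OneForm M) (x : M)
    (X Y : TangentSpace (𝓡 2) x) : ℝ :=
  if h : ∃ L : f x →ₗ[ℝ] f x, IsPotentialEndo f η x X Y L then
    LinearMap.trace ℝ (f x) h.choose
  else 0

/-- The form `η` makes the Legendre map `f` an `Ω`-surface: it is a closed one-form with values
in `f ∧ f^⊥`, `[η ∧ η] = 0`, and its quadratic differential is non-degenerate. (A quadratic
differential that has constant signature and is non-degenerate on a dense set is
non-degenerate everywhere.) -/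
structure IsOmegaPotential (f : M → Submodule ℝ R42) (η : OneForm M) : Prop where
  closed : IsClosedForm η
  values : ∀ x X, η x X ∈ wedgeSpan (f x) (perp (f x))
  bracket : ∀ x X Y, bracketWedge η η x X Y = 0
  nondegenerate : ∀ x X, (∀ Y, quadDiff f η x X Y = 0) → X = 0

/-- `μ = η - dτ` for a smooth section `τ` of `∧² f`. -/
def GaugeEquivalent (f : M → Submodule ℝ R42) (η μ : OneForm M) : Prop :=
  ∃ τ : M → (R42 →L[ℝ] R42),
    ContMDiff (𝓡 2) 𝓘(ℝ, R42 →L[ℝ] R42) ∞ τ ∧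
    (∀ x, τ x ∈ wedgeSpan (f x) (f x)) ∧
    ∀ x, μ x = η x - dAt τ x

/-- `μ` is the middle potential in the gauge orbit of `η`: with respect to the splitting into
`𝔥 = S₁ ∧ S₁ ⊕ S₂ ∧ S₂` and `𝔪 = S₁ ∧ S₂` its `𝔪`-part takes values in `∧² f`. -/
def IsMiddlePotential [IsManifold (𝓡 2) ∞ M] (f : M → Submodule ℝ R42) (η μ : OneForm M) : Prop :=
  GaugeEquivalent f η μ ∧
  ∀ x : M, ∃ U : Set M, IsOpen U ∧ x ∈ U ∧
    ∃ (σ₁ σ₂ : M → R42) (X Y : ∀ y : M, TangentSpace (𝓡 2) y),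
      IsCurvatureFrame f U σ₁ σ₂ X Y ∧
      ∀ y ∈ U, ∀ Z : TangentSpace (𝓡 2) y,
        ∃ a ∈ wedgeSpan (cyclide σ₁ Y y) (cyclide σ₁ Y y) ⊔
            wedgeSpan (cyclide σ₂ X y) (cyclide σ₂ X y),
          ∃ b ∈ wedgeSpan (cyclide σ₁ Y y) (cyclide σ₂ X y),
            μ y Z = a + b ∧ b ∈ wedgeSpan (f y) (f y)

/-! ### Conserved quantities -/

/-- The value `p(t) = ∑ pₖ tᵏ` at `x` of a polynomial whose coefficients are functions on `M`. -/
def evalPoly {d : ℕ} (p : Fin (d + 1) → M → R42) (t : ℝ) (x : M) : R42 :=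
  ∑ k : Fin (d + 1), t ^ (k : ℕ) • p k x

/-- `p` is a polynomial conserved quantity of degree `d` of the connections `d + tμ`. -/
structure IsConservedQuantity (μ : OneForm M) {d : ℕ} (p : Fin (d + 1) → M → R42) : Prop where
  smooth : ∀ k, ContMDiff (𝓡 2) 𝓘(ℝ, R42) ∞ (p k)
  degree : ∃ x, p (Fin.last d) x ≠ 0
  parallel : ∀ (t : ℝ) (x : M) (X : TangentSpace (𝓡 2) x),
    dAt (evalPoly p t) x X + t • μ x X (evalPoly p t x) = 0

/-- `f` is an `Ω`-surface via `η`, `μ` is the middle potential of `η`, and `p` is a linear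
conserved quantity of the middle pencil `d + tμ` with `p(0) = 𝔭` such that `(p(t),p(t))` is a
non-zero constant. -/
structure IsLinearNormConstant [IsManifold (𝓡 2) ∞ M] (f : M → Submodule ℝ R42) (η μ : OneForm M)
    (p : Fin 2 → M → R42) (𝔭 : R42) : Prop where
  omega : IsOmegaPotential f η
  middle : IsMiddlePotential f η μ
  conserved : IsConservedQuantity (d := 1) μ p
  initial : ∀ x, evalPoly (d := 1) p 0 x = 𝔭
  norm : ∃ c : ℝ, c ≠ 0 ∧ ∀ (t : ℝ) (x : M),
    form (evalPoly (d := 1) p t x) (evalPoly (d := 1) p t x) = c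

/-! ### Isothermic surfaces and isothermic sphere congruences -/

/-- `Λ` is an isothermic surface in the conformal geometry of `⟨𝔭⟩^⊥`: an immersion into the
projective light cone of `⟨𝔭⟩^⊥` with a non-zero closed one-form with values in `Λ ∧ Λ⁽¹⁾`. -/
structure IsIsothermicSurface (𝔭 : R42) (Λ : M → Submodule ℝ R42) : Prop where
  subbundle : IsSubbundle 1 Λ
  null : ∀ x, Λ x ≤ perp (Λ x)
  points : ∀ x, Λ x ≤ perp (Submodule.span ℝ {𝔭})
  immersive : IsImmersive Λ
  form_exists : ∃ η : OneForm M, IsClosedForm η ∧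
    (∀ x X, η x X ∈ wedgeSpan (Λ x) (derived Λ x)) ∧ ∃ x, η x ≠ 0

/-- The Legendre map `f` is a Legendre lift of `Λ`: the point spheres of its contact elements
are the points of `Λ`. -/
def IsLegendreLift (𝔭 : R42) (f Λ : M → Submodule ℝ R42) : Prop :=
  IsLegendre f ∧ ∀ x, Λ x = f x ⊓ perp (Submodule.span ℝ {𝔭})

/-- `s` is one of the two (real) isothermic sphere congruences `s^± = ⟨σ₁ ± σ₂⟩` of the
`Ω`-surface `f` with form `η`, where `σ₁`, `σ₂` are the local sections of the two curvature
sphere congruences with `q = (dσ₁,dσ₁) - (dσ₂,dσ₂)`; they are unique up to sign, and the sign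
is absorbed in `σ₂`. -/
def IsIsothermicSphereCongruence (f : M → Submodule ℝ R42) (η : OneForm M)
    (s : M → Submodule ℝ R42) : Prop :=
  IsSubbundle 1 s ∧
  ∀ x : M, ∃ U : Set M, IsOpen U ∧ x ∈ U ∧ ∃ σ₁ σ₂ : M → R42,
    IsSectionOn f U σ₁ ∧ IsSectionOn f U σ₂ ∧
    ∀ y ∈ U, LinearIndependent ℝ ![σ₁ y, σ₂ y] ∧
      IsCurvatureSphere f y (Submodule.span ℝ {σ₁ y}) ∧
      IsCurvatureSphere f y (Submodule.span ℝ {σ₂ y}) ∧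
      (∀ X Y : TangentSpace (𝓡 2) y, quadDiff f η y X Y =
        form (dAt σ₁ y X) (dAt σ₁ y Y) - form (dAt σ₂ y X) (dAt σ₂ y Y)) ∧
      s y = Submodule.span ℝ {σ₁ y + σ₂ y}

end Surface

end LieSphere

end

noncomputable section

namespace LieSphere

/-! ### Linear algebra of the form of signature `(4,2)` -/

/-! Everything is computed in a curvature frame. With `e₁ = d_Y σ₁` and `e₂ = d_X σ₂`, the fibre of
`f^⊥` is `f ⊕ ⟨e₁, e₂⟩`, where `e₁`, `e₂` are orthogonal of positive length because `f^⊥ / f` is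
positive definite. Closed forms with values in `f ∧ f^⊥` kill `f` and satisfy `η(X) e₁ = 0 = η(Y)
e₂`, so they are governed by `η(Y) e₁` and `η(X) e₂`.

From a conserved quantity `𝔭 + t s` to an isothermic surface: comparing powers of `t` gives `ds =
-μ𝔭`, `μ s = 0`, `(s,𝔭) = 0 = (s,s)`. The middle condition says `μ(Y) e₁ = A₁ σ₁` and `μ(X) e₂ = A₂
σ₂`, where `A₁`, `A₂` are the eigenvalues of `q` and hence non-zero. Skewness of `μ` then makes `s`
orthogonal to `f`, and a null vector of `f^⊥` lies in `f`, so `s = a σ₁ + b σ₂`. Pairing `ds = -μ𝔭`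
with the `eᵢ` gives `a (e₁,e₁) = A₁ (σ₁,𝔭)` and its twin (`IsConservedSection.coefficient`). A
second order argument shows that none of `a`, `b`, `(σᵢ,𝔭)` vanishes
(`IsLinearNormConstant.exists_frame`). Since `a (σ₁,𝔭) = - b (σ₂,𝔭)`, the form `q` is indefinite and
`⟨s⟩ = f ∩ 𝔭^⊥` is an isothermic sphere congruence. Taking `τ ∈ ∧² f` with `τ𝔭 = -s`, the closed
form `μ - dτ` kills `𝔭`, which forces its values into `⟨s⟩ ∧ ⟨s⟩⁽¹⁾` (`IsAdapted.eq_wedge`).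

From an isothermic surface to a conserved quantity: normalise `(σ₁,𝔭) = 1 = -(σ₂,𝔭)` and give the
`eᵢ` unit length. Then `S = σ₁ + σ₂` spans `Λ`, and the given form is `θ(X) = l S ∧ e₂`, `θ(Y) = -l
S ∧ e₁`. Closedness is a linear first order equation for `l`
(`IsNormalizedFrame.potCoeff_relations`), so on a connected surface `θ` has no zeros and `q` is
non-degenerate everywhere. The section `s = l S` does not depend on the frame; with `τ = l σ₁ ∧ σ₂`,
which satisfies `τ𝔭 = s`, the form `θ - dτ` is the middle potential and `𝔭 + t s` is conserved. -/

theorem form_apply (x y : R42) : form x y =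
    x 0 * y 0 + x 1 * y 1 + x 2 * y 2 + x 3 * y 3 - x 4 * y 4 - x 5 * y 5 := by
  simp [form, Matrix.toBilin'_apply', Matrix.mulVec_diagonal, dotProduct, Fin.sum_univ_succ]
  ring

theorem form_comm (x y : R42) : form x y = form y x := by
  rw [form_apply, form_apply]; ring

theorem form_nondegenerate {x : R42} (h : ∀ y, form x y = 0) : x = 0 := by
  ext i
  have := h (Pi.single i 1)
  rw [form_apply] at this
  fin_cases i <;> simpa [Pi.single_apply] using this

theorem form_bilin_nondegenerate : form.Nondegenerate :=
  ⟨fun _ h => form_nondegenerate h, fun x h => form_nondegenerate fun y => by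
    rw [form_comm]; exact h y⟩

theorem form_isRefl : form.IsRefl := fun x y h => by rw [form_comm]; exact h

theorem mem_perp {W : Submodule ℝ R42} {v : R42} : v ∈ perp W ↔ ∀ w ∈ W, form w v = 0 :=
  Iff.rfl

theorem mem_perp_span_singleton {p v : R42} :
    v ∈ perp (Submodule.span ℝ {p}) ↔ form v p = 0 := by
  rw [mem_perp]
  constructor
  · intro h
    rw [form_comm]
    exact h p (Submodule.mem_span_singleton_self p)
  · intro h w hw
    obtain ⟨c, rfl⟩ := Submodule.mem_span_singleton.1 hw
    rw [map_smul, LinearMap.smul_apply, form_comm, h, smul_zero]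

theorem mem_perp_span_pair {a b v : R42} (ha : form a v = 0) (hb : form b v = 0) :
    v ∈ perp (Submodule.span ℝ {a, b}) := by
  intro w hw
  obtain ⟨x, y, rfl⟩ := Submodule.mem_span_pair.1 hw
  change form (x • a + y • b) v = 0
  simp [ha, hb]

theorem finrank_perp_add (W : Submodule ℝ R42) :
    Module.finrank ℝ W + Module.finrank ℝ (perp W) = 6 := by
  have := LinearMap.BilinForm.finrank_add_finrank_orthogonal (B := form) form_isRefl W
  rw [LinearMap.BilinForm.orthogonal_top_eq_bot form_bilin_nondegenerate] at this
  have h6 : Module.finrank ℝ R42 = 6 := by simp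
  rw [inf_bot_eq, finrank_bot, h6] at this
  exact this

/-- On `f^⊥ / f`, for an isotropic plane `f`, the form is positive definite. -/
theorem form_self_nonneg {W : Submodule ℝ R42} (hW : Module.finrank ℝ W = 2)
    (hiso : W ≤ perp W) {v : R42} (hv : v ∈ perp W) :
    0 ≤ form v v ∧ (form v v = 0 → v ∈ W) := by
  -- Projection to the two negative coordinates. It is injective on `W`, since a null vector without
  -- negative part is zero, hence bijective by dimension. Subtracting from `v` the `w ∈ W` with the
  -- same negative part leaves `(v,v)` as a sum of four squares.
  let L : W →ₗ[ℝ] (Fin 2 → ℝ) :=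
    { toFun := fun w => ![w.1 4, w.1 5]
      map_add' := by intro a b; ext i; fin_cases i <;> simp
      map_smul' := by intro a b; ext i; fin_cases i <;> simp }
  have hinj : Function.Injective L := by
    rw [injective_iff_map_eq_zero]
    intro w hw
    have h4 : w.1 4 = 0 := congrFun hw 0
    have h5 : w.1 5 = 0 := congrFun hw 1
    have h0 : form w.1 w.1 = 0 := hiso w.2 w.1 w.2
    rw [form_apply, h4, h5] at h0
    have := mul_self_nonneg (w.1 0)
    have := mul_self_nonneg (w.1 1)
    have := mul_self_nonneg (w.1 2)
    have := mul_self_nonneg (w.1 3)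
    ext i
    fin_cases i <;> first | assumption | (refine mul_self_eq_zero.1 (?_ : _ = (0 : ℝ)); simp; nlinarith)
  have hsurj : Function.Surjective L :=
    (LinearMap.injective_iff_surjective_of_finrank_eq_finrank (by simp [hW])).1 hinj
  obtain ⟨w, hw⟩ := hsurj ![v 4, v 5]
  have h4 : w.1 4 = v 4 := congrFun hw 0
  have h5 : w.1 5 = v 5 := congrFun hw 1
  have hww : form w.1 w.1 = 0 := hiso w.2 w.1 w.2
  have hwv : form w.1 v = 0 := hv w.1 w.2
  have key : form v v = (v 0 - w.1 0) * (v 0 - w.1 0) + (v 1 - w.1 1) * (v 1 - w.1 1) +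
      (v 2 - w.1 2) * (v 2 - w.1 2) + (v 3 - w.1 3) * (v 3 - w.1 3) := by
    rw [form_apply] at hww hwv ⊢
    rw [h4, h5] at hww hwv
    linarith
  have g0 := mul_self_nonneg (v 0 - w.1 0)
  have g1 := mul_self_nonneg (v 1 - w.1 1)
  have g2 := mul_self_nonneg (v 2 - w.1 2)
  have g3 := mul_self_nonneg (v 3 - w.1 3)
  refine ⟨by rw [key]; linarith, fun h => ?_⟩
  rw [key] at h
  have : v = w.1 := by
    ext i
    refine sub_eq_zero.1 ?_
    fin_cases i <;> first
      | exact sub_eq_zero.2 h4.symm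
      | exact sub_eq_zero.2 h5.symm
      | (refine mul_self_eq_zero.1 (?_ : _ = (0 : ℝ)); simp; nlinarith)
  rw [this]; exact w.2

theorem form_self_pos {W : Submodule ℝ R42} (hW : Module.finrank ℝ W = 2)
    (hiso : W ≤ perp W) {v : R42} (hv : v ∈ perp W) (hn : v ∉ W) : 0 < form v v :=
  lt_of_le_of_ne (form_self_nonneg hW hiso hv).1
    fun h => hn ((form_self_nonneg hW hiso hv).2 h.symm)

/-! ### Bivectors -/

theorem wedge_apply (a b c : R42) : wedge a b c = form a c • b - form b c • a := rfl

/-- The form as a continuous bilinear map. -/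
def formL : R42 →L[ℝ] R42 →L[ℝ] ℝ :=
  LinearMap.toContinuousLinearMap
    ((LinearMap.toContinuousLinearMap : (R42 →ₗ[ℝ] ℝ) ≃ₗ[ℝ] _).toLinearMap ∘ₗ form)

theorem formL_apply (a b : R42) : formL a b = form a b := rfl

theorem wedge_add_left (a b c : R42) : wedge (a + b) c = wedge a c + wedge b c := by
  ext1 x; simp only [wedge_apply, add_apply, map_add, LinearMap.add_apply]; module

theorem wedge_smul_left (t : ℝ) (a c : R42) : wedge (t • a) c = t • wedge a c := by
  ext1 x; simp only [wedge_apply, smul_apply, map_smul, LinearMap.smul_apply, smul_eq_mul]; module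

theorem wedge_swap (a b : R42) : wedge a b = - wedge b a := by
  ext1 x; simp only [wedge_apply, neg_apply]; module

theorem wedge_add_right (a b c : R42) : wedge a (b + c) = wedge a b + wedge a c := by
  ext1 x; simp only [wedge_apply, add_apply, map_add, LinearMap.add_apply]; module

theorem wedge_smul_right (t : ℝ) (a c : R42) : wedge a (t • c) = t • wedge a c := by
  ext1 x; simp only [wedge_apply, smul_apply, map_smul, LinearMap.smul_apply, smul_eq_mul]; module

theorem wedge_self (a : R42) : wedge a a = 0 := by
  ext1 x; simp [wedge_apply]

/-- `wedge` as a continuous bilinear map. -/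
def wedgeL : R42 →L[ℝ] R42 →L[ℝ] (R42 →L[ℝ] R42) :=
  LinearMap.toContinuousLinearMap
    { toFun := fun a => LinearMap.toContinuousLinearMap
        { toFun := fun b => wedge a b
          map_add' := wedge_add_right a
          map_smul' := fun t b => wedge_smul_right t a b }
      map_add' := fun a b => by ext1 c; exact wedge_add_left a b c
      map_smul' := fun t a => by ext1 c; exact wedge_smul_left t a c }

theorem wedge_mem_wedgeSpan {V W : Submodule ℝ R42} {a b : R42} (ha : a ∈ V) (hb : b ∈ W) :
    wedge a b ∈ wedgeSpan V W :=
  Submodule.subset_span ⟨a, ha, b, hb, rfl⟩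

theorem wedgeSpan_induction {V W : Submodule ℝ R42} {P : (R42 →L[ℝ] R42) → Prop}
    (h : ∀ a ∈ V, ∀ b ∈ W, P (wedge a b)) (h0 : P 0) (ha : ∀ A B, P A → P B → P (A + B))
    (hs : ∀ (t : ℝ) A, P A → P (t • A)) {A : R42 →L[ℝ] R42} (hA : A ∈ wedgeSpan V W) : P A := by
  refine Submodule.span_induction (p := fun A _ => P A) ?_ h0 (fun A B _ _ => ha A B)
    (fun t A _ => hs t A) hA
  rintro _ ⟨a, haV, b, hbW, rfl⟩
  exact h a haV b hbW

theorem wedgeSpan_skew {V W : Submodule ℝ R42} {A : R42 →L[ℝ] R42} (hA : A ∈ wedgeSpan V W)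
    (x y : R42) : form (A x) y = - form x (A y) := by
  refine wedgeSpan_induction (P := fun A => form (A x) y = - form x (A y)) ?_ ?_ ?_ ?_ hA
  · intro a _ b _
    simp only [wedge_apply, map_sub, map_smul, LinearMap.sub_apply, LinearMap.smul_apply,
      smul_eq_mul, form_comm x]
    ring
  · simp
  · intro A B hA hB
    simp only [add_apply, map_add, LinearMap.add_apply, hA, hB]; ring
  · intro t A hA
    simp only [smul_apply, map_smul, LinearMap.smul_apply, hA, smul_eq_mul]
    ring

/-- The algebraic properties of elements of `f ∧ f^⊥` as endomorphisms. -/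
structure IsAdapted (W : Submodule ℝ R42) (A : R42 →L[ℝ] R42) : Prop where
  skew : ∀ x y, form (A x) y = - form x (A y)
  kills : ∀ v ∈ W, A v = 0
  maps : ∀ v ∈ perp W, A v ∈ W

/-- Membership in `f ∧ f^⊥` is used in the forward direction only through these three properties,
which are stable under the gauge change `η ↦ η - dτ`. -/
theorem isAdapted_of_mem {W : Submodule ℝ R42} (hiso : W ≤ perp W) {A : R42 →L[ℝ] R42}
    (hA : A ∈ wedgeSpan W (perp W)) : IsAdapted W A := by
  refine ⟨wedgeSpan_skew hA, fun v hv => ?_, fun v hv => ?_⟩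
  · refine wedgeSpan_induction (P := fun A => A v = 0) ?_ ?_ ?_ ?_ hA
    · intro a ha b hb
      rw [wedge_apply, form_comm a v, form_comm b v, hiso ha v hv, hb v hv]; simp
    · rfl
    · intro A B hA hB; simp [hA, hB]
    · intro t A hA; simp [hA]
  · refine wedgeSpan_induction (P := fun A => A v ∈ W) ?_ ?_ ?_ ?_ hA
    · intro a ha b hb
      rw [wedge_apply, hv a ha, zero_smul, zero_sub]
      exact W.neg_mem (W.smul_mem _ ha)
    · exact W.zero_mem
    · intro A B hA hB; exact W.add_mem hA hB
    · intro t A hA; exact W.smul_mem t hA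

theorem IsAdapted.sub {W : Submodule ℝ R42} {A B : R42 →L[ℝ] R42} (hA : IsAdapted W A)
    (hB : IsAdapted W B) : IsAdapted W (A - B) where
  skew x y := by
    simp only [sub_apply, map_sub, LinearMap.sub_apply, hA.skew, hB.skew]; ring
  kills v hv := by simp [hA.kills v hv, hB.kills v hv]
  maps v hv := W.sub_mem (hA.maps v hv) (hB.maps v hv)

/-- `W` need not be isotropic: this serves for `W = f` and for the cyclide summand `S₁` in the
splitting. -/
theorem wedgeSpan_self_kills {W : Submodule ℝ R42} {A : R42 →L[ℝ] R42}
    (hA : A ∈ wedgeSpan W W) {v : R42} (hv : v ∈ perp W) : A v = 0 := by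
  refine wedgeSpan_induction (P := fun A => A v = 0) ?_ ?_ ?_ ?_ hA
  · intro a ha b hb
    rw [wedge_apply, hv a ha, hv b hb]; simp
  · rfl
  · intro A B hA hB; simp [hA, hB]
  · intro t A hA; simp [hA]

/-- Every element of `∧² f` is a multiple of `a ∧ b` if `f = ⟨a, b⟩`. -/
theorem wedgeSpan_pair {a b : R42} {A : R42 →L[ℝ] R42}
    (hA : A ∈ wedgeSpan (Submodule.span ℝ {a, b}) (Submodule.span ℝ {a, b})) :
    ∃ g : ℝ, A = g • wedge a b := by
  refine wedgeSpan_induction (P := fun A => ∃ g : ℝ, A = g • wedge a b) ?_ ?_ ?_ ?_ hA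
  · intro x hx y hy
    obtain ⟨c, d, rfl⟩ := Submodule.mem_span_pair.1 hx
    obtain ⟨c', d', rfl⟩ := Submodule.mem_span_pair.1 hy
    refine ⟨c * d' - d * c', ?_⟩
    simp only [wedge_add_left, wedge_add_right, wedge_smul_left, wedge_smul_right, wedge_self,
      wedge_swap b a]
    module
  · exact ⟨0, by simp⟩
  · rintro A B ⟨g, rfl⟩ ⟨g', rfl⟩; exact ⟨g + g', by module⟩
  · rintro t A ⟨g, rfl⟩; exact ⟨t * g, by module⟩

/-- A skew endomorphism that kills the isotropic plane `f` and a vector `p` not orthogonal to it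
and maps `f^⊥` to `f` is of the form `s ∧ ξ`, with `s` spanning `f ∩ p^⊥` and `ξ` in
`f^⊥ ∩ p^⊥`. -/
theorem IsAdapted.eq_wedge {s v p : R42}
    {A : R42 →L[ℝ] R42} (hA : IsAdapted (Submodule.span ℝ {s, v}) A) (hs : s ≠ 0)
    (hsp : form s p = 0) (hvp : form v p = 1) (hAp : A p = 0) :
    ∃ ξ ∈ perp (Submodule.span ℝ {s, v}), form ξ p = 0 ∧ A = wedge s ξ := by
  have hsW : s ∈ Submodule.span ℝ {s, v} := Submodule.subset_span (by simp)
  have hvW : v ∈ Submodule.span ℝ {s, v} := Submodule.subset_span (by simp)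
  -- Pairing with `r` reads off multiples of `s`; the vector `ξ` will be `A r`.
  obtain ⟨r, hr⟩ : ∃ r, form s r = 1 := by
    by_contra hcon
    push Not at hcon
    refine hs (form_nondegenerate fun y => ?_)
    by_contra hy
    exact hcon ((form s y)⁻¹ • y) (by rw [map_smul, smul_eq_mul, inv_mul_cancel₀ hy])
  have hAr : ∀ w, form (A r) w = - form r (A w) := hA.skew r
  -- On `f^⊥` the values of `A` lie in `f`, and they are orthogonal to `p` by skewness and `A p =
  -- 0`; so they are multiples of `s`.
  have hmult : ∀ u ∈ perp (Submodule.span ℝ {s, v}), A u = form r (A u) • s := by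
    intro u hu
    obtain ⟨c, d, hcd⟩ := Submodule.mem_span_pair.1 (hA.maps u hu)
    have h0 : form (A u) p = 0 := by rw [hA.skew, hAp]; simp
    have hd : d = 0 := by
      rw [← hcd] at h0; simpa [hsp, hvp] using h0
    rw [← hcd, hd]
    simp [form_comm r s, hr]
  have hξ : A r ∈ perp (Submodule.span ℝ {s, v}) := by
    refine mem_perp_span_pair ?_ ?_
    · rw [form_comm, hAr, hA.kills s hsW]; simp
    · rw [form_comm, hAr, hA.kills v hvW]; simp
  refine ⟨A r, hξ, by rw [hAr, hAp]; simp, ?_⟩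
  ext1 x
  -- Any `x` is moved into `f^⊥` by subtracting multiples of `r` and `p`, using `(s,r) = 1`, `(s,p)
  -- = 0`, `(v,p) = 1`. The `p` part is invisible to `A`.
  have hx : x - form s x • r - (form v x - form s x * form v r) • p ∈
      perp (Submodule.span ℝ {s, v}) := by
    refine mem_perp_span_pair ?_ ?_
    · simp [hr, hsp]
    · simp [hvp]
  have h1 := hmult _ hx
  have h2 : form r (A x) = - form (A r) x := by rw [hAr]; ring
  have h3 : form r (A r) = 0 := by
    have := hAr r; rw [form_comm] at this; linarith
  simp only [map_sub, map_smul, hAp, smul_zero, sub_zero, h2, h3, smul_eq_mul, mul_zero] at h1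
  rw [wedge_apply]
  rw [sub_eq_iff_eq_add] at h1
  rw [h1]
  module

/-- Both products are `c ↦ -(a,b)(s,c) s`, symmetric in `a` and `b`. This gives `[θ ∧ θ] = 0` for
forms whose values share the factor `s`. -/
theorem wedge_mul_comm {s a b : R42} (hs : form s s = 0) (ha : form s a = 0) (hb : form s b = 0) :
    wedge s a * wedge s b = wedge s b * wedge s a := by
  ext1 x
  simp only [mul_apply_eq_comp, wedge_apply, map_sub, map_smul, hs, hb, ha,
    form_comm a s, form_comm b s, form_comm b a, sub_zero, zero_smul]
  module

end LieSphere

end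

noncomputable section

namespace LieSphere

section Calculus

variable {M : Type*} [TopologicalSpace M] [ChartedSpace (EuclideanSpace ℝ (Fin 2)) M]
variable {F G H : Type*} [NormedAddCommGroup F] [NormedSpace ℝ F] [NormedAddCommGroup G]
  [NormedSpace ℝ G] [NormedAddCommGroup H] [NormedSpace ℝ H]

/-! ### Calculus for functions on the surface -/

/-- Smoothness on `U` of a function with values in a normed space. -/
abbrev SmoothOn (g : M → F) (U : Set M) : Prop := ContMDiffOn (𝓡 2) 𝓘(ℝ, F) ∞ g U

theorem SmoothOn.mdifferentiableAt {g : M → F} {U : Set M} (hg : SmoothOn g U) (hU : IsOpen U)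
    {x : M} (hx : x ∈ U) : MDifferentiableAt (𝓡 2) 𝓘(ℝ, F) g x :=
  (hg.contMDiffAt (hU.mem_nhds hx)).mdifferentiableAt (by simp)

theorem SmoothOn.mono {g : M → F} {U V : Set M} (hg : SmoothOn g U) (h : V ⊆ U) :
    SmoothOn g V := ContMDiffOn.mono hg h

theorem SmoothOn.bilin (B : F →L[ℝ] G →L[ℝ] H) {σ : M → F} {ς : M → G} {U : Set M}
    (hσ : SmoothOn σ U) (hς : SmoothOn ς U) : SmoothOn (fun y => B (σ y) (ς y)) U :=
  ContMDiffOn.clm_apply (B.contMDiff.comp_contMDiffOn hσ) hς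

theorem SmoothOn.form {σ ς : M → R42} {U : Set M} (hσ : SmoothOn σ U) (hς : SmoothOn ς U) :
    SmoothOn (fun y => form (σ y) (ς y)) U := hσ.bilin formL hς

theorem SmoothOn.smul' {g : M → ℝ} {σ : M → F} {U : Set M} (hg : SmoothOn g U)
    (hσ : SmoothOn σ U) : SmoothOn (fun y => g y • σ y) U := hg.smul hσ

theorem SmoothOn.wedge {σ ς : M → R42} {U : Set M} (hσ : SmoothOn σ U) (hς : SmoothOn ς U) :
    SmoothOn (fun y => wedge (σ y) (ς y)) U := hσ.bilin wedgeL hς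

theorem SmoothOn.inv {g : M → ℝ} {U : Set M} (hg : SmoothOn g U) (h0 : ∀ y ∈ U, g y ≠ 0) :
    SmoothOn (fun y => (g y)⁻¹) U := fun y hy =>
  ContMDiffAt.comp_contMDiffWithinAt y
    (contMDiffAt_iff_contDiffAt.2 (contDiffAt_inv ℝ (h0 y hy))) (hg y hy)

theorem SmoothOn.sqrt {g : M → ℝ} {U : Set M} (hg : SmoothOn g U) (h0 : ∀ y ∈ U, g y ≠ 0) :
    SmoothOn (fun y => Real.sqrt (g y)) U := fun y hy =>
  ContMDiffAt.comp_contMDiffWithinAt y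
    (contMDiffAt_iff_contDiffAt.2 (Real.contDiffAt_sqrt (h0 y hy))) (hg y hy)

/-- One product rule for all pairings in use: the form, the wedge, scalar multiplication and
evaluation of endomorphisms. -/
theorem dAt_bilin (B : F →L[ℝ] G →L[ℝ] H) {σ : M → F} {ς : M → G} {x : M}
    (hσ : MDifferentiableAt (𝓡 2) 𝓘(ℝ, F) σ x) (hς : MDifferentiableAt (𝓡 2) 𝓘(ℝ, G) ς x)
    (Z : TangentSpace (𝓡 2) x) :
    dAt (fun y => B (σ y) (ς y)) x Z = B (dAt σ x Z) (ς x) + B (σ x) (dAt ς x Z) := by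
  have h1 : HasFDerivWithinAt (σ ∘ (extChartAt (𝓡 2) x).symm) (dAt σ x) (Set.range (𝓡 2))
    (extChartAt (𝓡 2) x x) := hσ.hasMFDerivAt.2
  have h2 : HasFDerivWithinAt (ς ∘ (extChartAt (𝓡 2) x).symm) (dAt ς x) (Set.range (𝓡 2))
    (extChartAt (𝓡 2) x x) := hς.hasMFDerivAt.2
  have h3 := B.hasFDerivWithinAt_of_bilinear h1 h2
  have h4 : HasMFDerivAt (𝓡 2) 𝓘(ℝ, H) (fun y => B (σ y) (ς y)) x _ :=
    ⟨((B.continuous.continuousAt.comp hσ.continuousAt).clm_apply hς.continuousAt), h3⟩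
  have h5 : dAt (fun y => B (σ y) (ς y)) x = _ := h4.mfderiv
  rw [h5]
  simp only [Function.comp_apply, extChartAt_to_inv]
  exact add_comm _ _

theorem dAt_form {σ ς : M → R42} {x : M}
    (hσ : MDifferentiableAt (𝓡 2) 𝓘(ℝ, R42) σ x) (hς : MDifferentiableAt (𝓡 2) 𝓘(ℝ, R42) ς x)
    (Z : TangentSpace (𝓡 2) x) :
    dAt (fun y => form (σ y) (ς y)) x Z = form (dAt σ x Z) (ς x) + form (σ x) (dAt ς x Z) :=
  dAt_bilin formL hσ hς Z

theorem dAt_wedge {σ ς : M → R42} {x : M}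
    (hσ : MDifferentiableAt (𝓡 2) 𝓘(ℝ, R42) σ x) (hς : MDifferentiableAt (𝓡 2) 𝓘(ℝ, R42) ς x)
    (Z : TangentSpace (𝓡 2) x) :
    dAt (fun y => wedge (σ y) (ς y)) x Z = wedge (dAt σ x Z) (ς x) + wedge (σ x) (dAt ς x Z) :=
  dAt_bilin wedgeL hσ hς Z

theorem dAt_smul {g : M → ℝ} {σ : M → F} {x : M}
    (hg : MDifferentiableAt (𝓡 2) 𝓘(ℝ, ℝ) g x) (hσ : MDifferentiableAt (𝓡 2) 𝓘(ℝ, F) σ x)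
    (Z : TangentSpace (𝓡 2) x) :
    dAt (fun y => g y • σ y) x Z = dAt g x Z • σ x + g x • dAt σ x Z :=
  dAt_bilin (ContinuousLinearMap.lsmul ℝ ℝ) hg hσ Z

theorem dAt_clm_apply {A : M → F →L[ℝ] G} {σ : M → F} {x : M}
    (hA : MDifferentiableAt (𝓡 2) 𝓘(ℝ, F →L[ℝ] G) A x)
    (hσ : MDifferentiableAt (𝓡 2) 𝓘(ℝ, F) σ x) (Z : TangentSpace (𝓡 2) x) :
    dAt (fun y => A y (σ y)) x Z = dAt A x Z (σ x) + A x (dAt σ x Z) :=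
  dAt_bilin (ContinuousLinearMap.id ℝ (F →L[ℝ] G)) hA hσ Z

theorem dAt_add {σ ς : M → F} {x : M}
    (hσ : MDifferentiableAt (𝓡 2) 𝓘(ℝ, F) σ x) (hς : MDifferentiableAt (𝓡 2) 𝓘(ℝ, F) ς x)
    (Z : TangentSpace (𝓡 2) x) :
    dAt (fun y => σ y + ς y) x Z = dAt σ x Z + dAt ς x Z := by
  have h := (hσ.hasMFDerivAt.add hς.hasMFDerivAt).mfderiv
  have h4 : (fun y => σ y + ς y) = σ + ς := rfl
  unfold dAt
  rw [h4, h]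
  rfl

theorem dAt_smul_add_smul {a b : M → ℝ} {σ ς : M → F} {x : M}
    (ha : MDifferentiableAt (𝓡 2) 𝓘(ℝ, ℝ) a x) (hσ : MDifferentiableAt (𝓡 2) 𝓘(ℝ, F) σ x)
    (hb : MDifferentiableAt (𝓡 2) 𝓘(ℝ, ℝ) b x) (hς : MDifferentiableAt (𝓡 2) 𝓘(ℝ, F) ς x)
    (Z : TangentSpace (𝓡 2) x) :
    dAt (fun y => a y • σ y + b y • ς y) x Z =
      (dAt a x Z • σ x + a x • dAt σ x Z) + (dAt b x Z • ς x + b x • dAt ς x Z) := by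
  have h := dAt_add (σ := fun y => a y • σ y) (ς := fun y => b y • ς y) (ha.smul hσ) (hb.smul hς) Z
  rw [h, dAt_smul ha hσ, dAt_smul hb hς]

theorem dAt_const (c : F) (x : M) : dAt (fun _ : M => c) x = 0 := mfderiv_const

theorem dAt_congr {σ ς : M → F} {x : M} (h : σ =ᶠ[𝓝 x] ς) : dAt σ x = dAt ς x := by
  unfold dAt
  exact h.mfderiv_eq

theorem dAt_congr_on {σ ς : M → F} {U : Set M} (hU : IsOpen U) {x : M} (hx : x ∈ U)
    (h : ∀ y ∈ U, σ y = ς y) : dAt σ x = dAt ς x :=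
  dAt_congr (Filter.eventually_of_mem (hU.mem_nhds hx) h)

theorem fderiv_comp_symm {φ : OpenPartialHomeomorph M (EuclideanSpace ℝ (Fin 2))}
    (hφ : φ ∈ IsManifold.maximalAtlas (𝓡 2) ∞ M) {g : M → F} {u : EuclideanSpace ℝ (Fin 2)}
    (hu : u ∈ φ.target) (hg : MDifferentiableAt (𝓡 2) 𝓘(ℝ, F) g (φ.symm u))
    (v : EuclideanSpace ℝ (Fin 2)) :
    fderiv ℝ (g ∘ φ.symm) u v = dAt g (φ.symm u) (mfderiv (𝓡 2) (𝓡 2) φ.symm u v) := by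
  have h1 : MDifferentiableAt (𝓡 2) (𝓡 2) φ.symm u :=
    mdifferentiableAt_symm_of_mem_maximalAtlas (IsManifold.maximalAtlas_subset_of_le (by simp) hφ) hu
  have h2 := DFunLike.congr_fun (mfderiv_comp u hg h1) v
  rw [← mfderiv_eq_fderiv]
  exact h2

/-- The expression in a chart of a smooth function is smooth. -/
theorem contDiffOn_comp_symm {φ : OpenPartialHomeomorph M (EuclideanSpace ℝ (Fin 2))}
    (hφ : φ ∈ IsManifold.maximalAtlas (𝓡 2) ∞ M) {g : M → F} {U : Set M} (hg : SmoothOn g U) :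
    ContDiffOn ℝ ∞ (g ∘ φ.symm) (φ.target ∩ φ.symm ⁻¹' U) := by
  rw [← contMDiffOn_iff_contDiffOn]
  exact hg.comp ((contMDiffOn_symm_of_mem_maximalAtlas hφ).mono Set.inter_subset_left)
    fun _ h => h.2

theorem smoothOn_of_chartwise {g : M → F} {U : Set M}
    (h : ∀ x ∈ U, SmoothOn g (U ∩ (chartAt (EuclideanSpace ℝ (Fin 2)) x).source))
    (hU : IsOpen U) : SmoothOn g U := fun x hx =>
  ((h x hx).contMDiffAt ((hU.inter (chartAt _ x).open_source).mem_nhds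
    ⟨hx, mem_chart_source _ x⟩)).contMDiffWithinAt

/-- Subtracting an exact form from a closed form gives a closed form. -/
theorem IsClosedForm.sub_dAt {η μ : OneForm M} (hη : IsClosedForm η)
    {τ : M → (R42 →L[ℝ] R42)} (hτ : ContMDiff (𝓡 2) 𝓘(ℝ, R42 →L[ℝ] R42) ∞ τ)
    (hμ : ∀ x, μ x = η x - dAt τ x) : IsClosedForm μ := by
  intro φ hφ
  obtain ⟨h1, h2⟩ := hη φ hφ
  have hT : ContDiffOn ℝ ∞ (τ ∘ φ.symm) φ.target := by
    have := contDiffOn_comp_symm hφ (hτ.contMDiffOn (s := Set.univ))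
    simpa using this
  have hT' : ContDiffOn ℝ ∞ (fderiv ℝ (τ ∘ φ.symm)) φ.target :=
    hT.fderiv_of_isOpen φ.open_target (by simp)
  have heq : ∀ u ∈ φ.target, inChart μ φ u = inChart η φ u - fderiv ℝ (τ ∘ φ.symm) u := by
    intro u hu
    ext1 v
    rw [sub_apply, fderiv_comp_symm hφ hu ((hτ _).mdifferentiableAt (by simp))]
    exact DFunLike.congr_fun (hμ (φ.symm u)) _
  refine ⟨(h1.sub hT').congr heq, fun u hu v w => ?_⟩
  have hev : inChart μ φ =ᶠ[𝓝 u] fun u => inChart η φ u - fderiv ℝ (τ ∘ φ.symm) u :=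
    Filter.eventually_of_mem (φ.open_target.mem_nhds hu) heq
  have hη' := (h1.contDiffAt (φ.open_target.mem_nhds hu)).differentiableAt (by simp)
  have hT'' := (hT'.contDiffAt (φ.open_target.mem_nhds hu)).differentiableAt (by simp)
  have hsym := ((hT.contDiffAt (φ.open_target.mem_nhds hu)).isSymmSndFDerivAt (by simp; norm_cast)).eq v w
  rw [hev.fderiv_eq, fderiv_fun_sub hη' hT'']
  have h3 := h2 u hu v w
  change (fderiv ℝ (inChart η φ) u v w - fderiv ℝ (fderiv ℝ (τ ∘ φ.symm)) u v w) -
    (fderiv ℝ (inChart η φ) u w v - fderiv ℝ (fderiv ℝ (τ ∘ φ.symm)) u w v) = 0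
  rw [hsym, ← h3]
  abel

variable [IsManifold (𝓡 2) ∞ M]

/-- Smoothness on `U` of a vector field. -/
abbrev SmoothVF (X : ∀ y : M, TangentSpace (𝓡 2) y) (U : Set M) : Prop :=
  ContMDiffOn (𝓡 2) (𝓡 2).tangent ∞ (fun y => (⟨y, X y⟩ : TangentBundle (𝓡 2) M)) U

/-- The coordinate expression of a vector field in the chart at `x₀`. -/
def coordVF (X : ∀ y : M, TangentSpace (𝓡 2) y) (x₀ : M) : M → EuclideanSpace ℝ (Fin 2) :=
  fun y => (trivializationAt (EuclideanSpace ℝ (Fin 2)) (TangentSpace (𝓡 2)) x₀ ⟨y, X y⟩).2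

theorem smoothOn_coordVF {X : ∀ y : M, TangentSpace (𝓡 2) y} {U : Set M} (hU : IsOpen U)
    (hX : SmoothVF X U) (x₀ : M) :
    SmoothOn (coordVF X x₀) (U ∩ (chartAt (EuclideanSpace ℝ (Fin 2)) x₀).source) := by
  have h := (Bundle.Trivialization.contMDiffOn_section_iff (IB := 𝓡 2) (n := ∞) (s := X)
    (trivializationAt (EuclideanSpace ℝ (Fin 2)) (TangentSpace (𝓡 2)) x₀)
    (hU.inter (chartAt (EuclideanSpace ℝ (Fin 2)) x₀).open_source)
    (Set.inter_subset_right)).1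
  exact h (hX.mono Set.inter_subset_left)

/-- The tangent bundle trivialisation and the derivative of the inverse chart give the same
coordinates; the latter is how `inChart` sees tangent vectors. -/
theorem eq_mfderiv_symm_coordVF (X : ∀ y : M, TangentSpace (𝓡 2) y) {x₀ y : M}
    (hy : y ∈ (chartAt (EuclideanSpace ℝ (Fin 2)) x₀).source) :
    X y = mfderiv (𝓡 2) (𝓡 2) (chartAt (EuclideanSpace ℝ (Fin 2)) x₀).symm
      (chartAt (EuclideanSpace ℝ (Fin 2)) x₀ y) (coordVF X x₀ y) := by
  have h := TangentBundle.symmL_trivializationAt (I := 𝓡 2) hy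
  have h2 := (trivializationAt (EuclideanSpace ℝ (Fin 2)) (TangentSpace (𝓡 2)) x₀).symm_proj_apply
    ⟨y, X y⟩ hy
  have h3 := DFunLike.congr_fun h (coordVF X x₀ y)
  rw [ModelWithCorners.range_eq_univ, mfderivWithin_univ] at h3
  refine Eq.trans ?_ h3
  rw [Bundle.Trivialization.symmL_apply _ hy]
  exact h2.symm

theorem smoothVF_of_coordVF {X : ∀ y : M, TangentSpace (𝓡 2) y} {U : Set M} (hU : IsOpen U)
    {x₀ : M} (hUx : U ⊆ (chartAt (EuclideanSpace ℝ (Fin 2)) x₀).source)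
    (hX : SmoothOn (coordVF X x₀) U) : SmoothVF X U :=
  (Bundle.Trivialization.contMDiffOn_section_iff (IB := 𝓡 2) (n := ∞) (s := X)
    (trivializationAt (EuclideanSpace ℝ (Fin 2)) (TangentSpace (𝓡 2)) x₀) hU hUx).2 hX

theorem chart_mem (x : M) : chartAt (EuclideanSpace ℝ (Fin 2)) x ∈
    IsManifold.maximalAtlas (𝓡 2) ∞ M := IsManifold.chart_mem_maximalAtlas x

theorem dAt_coord {g : M → F} {x₀ y : M}
    (hy : y ∈ (chartAt (EuclideanSpace ℝ (Fin 2)) x₀).source)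
    (hg : MDifferentiableAt (𝓡 2) 𝓘(ℝ, F) g y) (X : ∀ y : M, TangentSpace (𝓡 2) y) :
    dAt g y (X y) = fderiv ℝ (g ∘ (chartAt (EuclideanSpace ℝ (Fin 2)) x₀).symm)
      (chartAt (EuclideanSpace ℝ (Fin 2)) x₀ y) (coordVF X x₀ y) := by
  set φ := chartAt (EuclideanSpace ℝ (Fin 2)) x₀ with hφ
  have h0 : φ.symm (φ y) = y := φ.left_inv hy
  have h1 := eq_mfderiv_symm_coordVF X hy
  have h2 := fderiv_comp_symm (chart_mem x₀) (φ.map_source hy) (g := g)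
    (by rw [h0]; exact hg) (coordVF X x₀ y)
  -- `φ.symm (φ y)` equals `y` only propositionally, so the derivative is transported along that
  -- equality, with tangent vectors read in the common model space.
  have key : ∀ z, z = y → ∀ v : EuclideanSpace ℝ (Fin 2), dAt g z v = dAt g y v := by
    rintro z rfl v; rfl
  exact (congrArg (dAt g y) h1).trans ((key _ h0 _).symm.trans h2.symm)

/-- The value of a one-form on a vector field, in the chart at `x₀`. -/
theorem oneForm_coord (η : OneForm M) {x₀ y : M}
    (hy : y ∈ (chartAt (EuclideanSpace ℝ (Fin 2)) x₀).source)
    (X : ∀ y : M, TangentSpace (𝓡 2) y) :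
    η y (X y) = inChart η (chartAt (EuclideanSpace ℝ (Fin 2)) x₀)
      (chartAt (EuclideanSpace ℝ (Fin 2)) x₀ y) (coordVF X x₀ y) := by
  set φ := chartAt (EuclideanSpace ℝ (Fin 2)) x₀ with hφ
  have h0 : φ.symm (φ y) = y := φ.left_inv hy
  have h1 := eq_mfderiv_symm_coordVF X hy
  have key : ∀ z, z = y → ∀ v : EuclideanSpace ℝ (Fin 2), η z v = η y v := by
    rintro z rfl v; rfl
  exact (congrArg (η y) h1).trans (key _ h0 _).symm

theorem SmoothOn.dirDeriv {g : M → R42} {X : ∀ y : M, TangentSpace (𝓡 2) y} {U : Set M}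
    (hU : IsOpen U) (hg : SmoothOn g U) (hX : SmoothVF X U) : SmoothOn (dirDeriv X g) U := by
  refine smoothOn_of_chartwise (fun x _ => ?_) hU
  set φ := chartAt (EuclideanSpace ℝ (Fin 2)) x with hφ
  have h1 := contDiffOn_comp_symm (chart_mem x) hg
  have h2 : ContDiffOn ℝ ∞ (fderiv ℝ (g ∘ φ.symm)) (φ.target ∩ φ.symm ⁻¹' U) :=
    h1.fderiv_of_isOpen (φ.isOpen_inter_preimage_symm hU) (by simp)
  have h3 : SmoothOn (fun y => fderiv ℝ (g ∘ φ.symm) (φ y)) (U ∩ φ.source) := by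
    refine (contMDiffOn_iff_contDiffOn.2 h2).comp
      ((contMDiffOn_of_mem_maximalAtlas (chart_mem x)).mono Set.inter_subset_right) ?_
    intro y hy
    refine ⟨φ.map_source hy.2, ?_⟩
    change φ.symm (φ y) ∈ U
    rw [φ.left_inv hy.2]; exact hy.1
  refine (ContMDiffOn.clm_apply h3 (smoothOn_coordVF hU hX x)).congr fun y hy => ?_
  exact dAt_coord hy.2 (hg.mdifferentiableAt hU hy.1) X

theorem IsClosedForm.smoothOn_apply {η : OneForm M} (hη : IsClosedForm η)
    {X : ∀ y : M, TangentSpace (𝓡 2) y} {U : Set M} (hU : IsOpen U) (hX : SmoothVF X U) :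
    SmoothOn (fun y => η y (X y)) U := by
  refine smoothOn_of_chartwise (fun x _ => ?_) hU
  set φ := chartAt (EuclideanSpace ℝ (Fin 2)) x with hφ
  have h3 : SmoothOn (fun y => inChart η φ (φ y)) (U ∩ φ.source) := by
    refine (contMDiffOn_iff_contDiffOn.2 (hη φ (chart_mem x)).1).comp
      ((contMDiffOn_of_mem_maximalAtlas (chart_mem x)).mono Set.inter_subset_right) ?_
    exact fun y hy => φ.map_source hy.2
  exact (ContMDiffOn.clm_apply h3 (smoothOn_coordVF hU hX x)).congr fun y hy =>
    oneForm_coord η hy.2 X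

/-- In the product rule the terms differentiating `A` cancel by `hs`. It is applied with `A = dg`,
where `hs` is symmetry of second derivatives, and with `A` a closed form, where `hs` is closedness.
-/
theorem fderiv_pairing_antisymm {E : Type*} [NormedAddCommGroup E] [NormedSpace ℝ E]
    {A : E → E →L[ℝ] F} {a b : E → E} {u : E}
    (hA : DifferentiableAt ℝ A u) (ha : DifferentiableAt ℝ a u) (hb : DifferentiableAt ℝ b u)
    (hs : fderiv ℝ A u (a u) (b u) = fderiv ℝ A u (b u) (a u)) :
    fderiv ℝ (fun w => A w (b w)) u (a u) - fderiv ℝ (fun w => A w (a w)) u (b u) =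
      A u (fderiv ℝ b u (a u) - fderiv ℝ a u (b u)) := by
  rw [fderiv_clm_apply hA hb, fderiv_clm_apply hA ha]
  simp [hs]

/-- For two vector fields there is a tangent vector (their Lie bracket) that computes the
commutator of derivatives and the exterior derivative of one-forms. -/
theorem exists_bracket {X Y : ∀ y : M, TangentSpace (𝓡 2) y} {U : Set M} (hU : IsOpen U)
    (hX : SmoothVF X U) (hY : SmoothVF Y U) {x : M} (hx : x ∈ U) :
    ∃ B : TangentSpace (𝓡 2) x,
      (∀ g : M → R42, SmoothOn g U →
        dAt (dirDeriv Y g) x (X x) - dAt (dirDeriv X g) x (Y x) = dAt g x B) ∧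
      (∀ η : OneForm M, IsClosedForm η →
        dAt (fun y => η y (Y y)) x (X x) - dAt (fun y => η y (X y)) x (Y x) = η x B) := by
  set φ := chartAt (EuclideanSpace ℝ (Fin 2)) x with hφ
  have hxs : x ∈ φ.source := mem_chart_source _ x
  have h0 : φ.symm (φ x) = x := φ.left_inv hxs
  have hO : IsOpen (φ.target ∩ φ.symm ⁻¹' U) := φ.isOpen_inter_preimage_symm hU
  have hxO : φ x ∈ φ.target ∩ φ.symm ⁻¹' U :=
    ⟨φ.map_source hxs, by change φ.symm (φ x) ∈ U; rwa [h0]⟩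
  set a := coordVF X x ∘ φ.symm with ha
  set b := coordVF Y x ∘ φ.symm with hb
  have hsmooth : ∀ Z : ∀ y : M, TangentSpace (𝓡 2) y, SmoothVF Z U →
      DifferentiableAt ℝ (coordVF Z x ∘ φ.symm) (φ x) := by
    intro Z hZ
    have h1 := contDiffOn_comp_symm (chart_mem x) (smoothOn_coordVF hU hZ x)
    refine (h1.contDiffAt (IsOpen.mem_nhds (φ.isOpen_inter_preimage_symm (hU.inter φ.open_source))
      ⟨hxO.1, ?_⟩)).differentiableAt (by simp)
    change φ.symm (φ x) ∈ U ∩ φ.source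
    rw [h0]; exact ⟨hx, hxs⟩
  have hax : a (φ x) = coordVF X x x := by simp [ha, h0]
  have hbx : b (φ x) = coordVF Y x x := by simp [hb, h0]
  -- a tangent vector at `x` with prescribed coordinates
  obtain ⟨B, hB⟩ : ∃ B : ∀ y : M, TangentSpace (𝓡 2) y,
      coordVF B x x = fderiv ℝ b (φ x) (a (φ x)) - fderiv ℝ a (φ x) (b (φ x)) := by
    set e := trivializationAt (EuclideanSpace ℝ (Fin 2)) (TangentSpace (𝓡 2) (M := M)) x
    refine ⟨fun y => e.symm y (fderiv ℝ b (φ x) (a (φ x)) - fderiv ℝ a (φ x) (b (φ x))), ?_⟩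
    have := e.apply_mk_symm (b := x) hxs
      (fderiv ℝ b (φ x) (a (φ x)) - fderiv ℝ a (φ x) (b (φ x)))
    exact congrArg Prod.snd this
  refine ⟨B x, fun g hg => ?_, fun η hη => ?_⟩
  · have hG := contDiffOn_comp_symm (chart_mem x) hg
    have hd : ∀ Z : ∀ y : M, TangentSpace (𝓡 2) y,
        dirDeriv Z g ∘ φ.symm =ᶠ[𝓝 (φ x)]
          fun w => fderiv ℝ (g ∘ φ.symm) w ((coordVF Z x ∘ φ.symm) w) := by
      intro Z
      filter_upwards [hO.mem_nhds hxO] with w hw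
      have hw1 := φ.map_target hw.1
      have := dAt_coord hw1 (hg.mdifferentiableAt hU hw.2) Z
      rw [← hφ, φ.right_inv hw.1] at this
      exact this
    have hGat := hG.contDiffAt (hO.mem_nhds hxO)
    rw [dAt_coord hxs ((hg.dirDeriv hU hY).mdifferentiableAt hU hx) X,
      dAt_coord hxs ((hg.dirDeriv hU hX).mdifferentiableAt hU hx) Y,
      dAt_coord hxs (hg.mdifferentiableAt hU hx) B, hB, ← hφ, (hd Y).fderiv_eq, (hd X).fderiv_eq,
      ← hax, ← hbx]
    refine fderiv_pairing_antisymm ?_ (hsmooth X hX) (hsmooth Y hY) ?_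
    · exact (hGat.fderiv_right (m := 1) (by norm_cast)).differentiableAt (by simp)
    · exact (hGat.isSymmSndFDerivAt (by simp; norm_cast)).eq _ _
  · have hd : ∀ Z : ∀ y : M, TangentSpace (𝓡 2) y,
        (fun y => η y (Z y)) ∘ φ.symm =ᶠ[𝓝 (φ x)]
          fun w => inChart η φ w ((coordVF Z x ∘ φ.symm) w) := by
      intro Z
      filter_upwards [hO.mem_nhds hxO] with w hw
      have hw1 := φ.map_target hw.1
      have := oneForm_coord η hw1 Z
      rw [← hφ, φ.right_inv hw.1] at this
      exact this
    rw [dAt_coord hxs ((hη.smoothOn_apply hU hY).mdifferentiableAt hU hx) X,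
      dAt_coord hxs ((hη.smoothOn_apply hU hX).mdifferentiableAt hU hx) Y,
      oneForm_coord η hxs B, hB, ← hφ, (hd Y).fderiv_eq, (hd X).fderiv_eq,
      ← hax, ← hbx]
    obtain ⟨h1, h2⟩ := hη φ (chart_mem x)
    refine fderiv_pairing_antisymm ?_ (hsmooth X hX) (hsmooth Y hY) ?_
    · exact (h1.contDiffAt (φ.open_target.mem_nhds hxO.1)).differentiableAt (by simp)
    · exact sub_eq_zero.1 (h2 _ hxO.1 _ _)

/-- Coordinate vector fields. -/
theorem exists_coordinate_frame (x : M) : ∃ U : Set M, IsOpen U ∧ x ∈ U ∧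
    ∃ X Y : ∀ y : M, TangentSpace (𝓡 2) y, SmoothVF X U ∧ SmoothVF Y U ∧
      ∀ y ∈ U, LinearIndependent ℝ ![X y, Y y] := by
  set φ := chartAt (EuclideanSpace ℝ (Fin 2)) x with hφ
  set e := trivializationAt (EuclideanSpace ℝ (Fin 2)) (TangentSpace (𝓡 2) (M := M)) x
  have key : ∀ v : EuclideanSpace ℝ (Fin 2), ∀ y ∈ φ.source,
      coordVF (fun y => e.symm y v) x y = v := fun v y hy =>
    congrArg Prod.snd (e.apply_mk_symm (b := y) hy v)
  have hs : ∀ v : EuclideanSpace ℝ (Fin 2), SmoothVF (fun y => e.symm y v) φ.source := fun v =>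
    smoothVF_of_coordVF φ.open_source subset_rfl
      ((contMDiffOn_const (c := v)).congr fun y hy => key v y hy)
  refine ⟨φ.source, φ.open_source, mem_chart_source _ x,
    fun y => e.symm y (EuclideanSpace.single 0 1), fun y => e.symm y (EuclideanSpace.single 1 1),
    hs _, hs _, fun y hy => ?_⟩
  rw [LinearIndependent.pair_iff]
  intro s t hst
  have h1 : e.symm y (s • EuclideanSpace.single 0 1 + t • EuclideanSpace.single 1 1) = 0 := by
    have := (e.symmL ℝ y).map_add (s • EuclideanSpace.single 0 1) (t • EuclideanSpace.single 1 1)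
    rw [map_smul, map_smul] at this
    simp only [Bundle.Trivialization.symmL_apply e (show y ∈ e.baseSet from hy)] at this
    rw [this]; exact hst
  have h2 := e.apply_mk_symm (b := y) hy
    (s • EuclideanSpace.single 0 1 + t • EuclideanSpace.single 1 1)
  have h3 := e.apply_mk_symm (b := y) hy 0
  have h4 : e.symm y 0 = 0 := by
    have := (e.symmL ℝ y).map_zero
    rwa [Bundle.Trivialization.symmL_apply e (show y ∈ e.baseSet from hy)] at this
  rw [h1, ← h4, h3] at h2
  have h5 := congrArg Prod.snd h2
  have h50 := congrArg (fun w : EuclideanSpace ℝ (Fin 2) => w 0) h5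
  have h51 := congrArg (fun w : EuclideanSpace ℝ (Fin 2) => w 1) h5
  simp at h50 h51
  exact ⟨h50.symm, h51.symm⟩

end Calculus
end LieSphere

end

noncomputable section

namespace LieSphere

section Frames

variable {M : Type*} [TopologicalSpace M] [ChartedSpace (EuclideanSpace ℝ (Fin 2)) M]
variable {f : M → Submodule ℝ R42}

/-! ### Sections -/

theorem SmoothOn.isOpen_ne_zero {g : M → ℝ} {U : Set M} (hg : SmoothOn g U) (hU : IsOpen U) :
    IsOpen (U ∩ {y | g y ≠ 0}) :=
  hg.continuousOn.isOpen_inter_preimage hU isOpen_ne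

theorem SmoothOn.isOpen_pos {g : M → ℝ} {U : Set M} (hg : SmoothOn g U) (hU : IsOpen U) :
    IsOpen (U ∩ {y | 0 < g y}) :=
  hg.continuousOn.isOpen_inter_preimage hU isOpen_Ioi

theorem IsSectionOn.mono {W : M → Submodule ℝ R42} {U V : Set M} {σ : M → R42}
    (h : IsSectionOn W U σ) (hV : V ⊆ U) : IsSectionOn W V σ :=
  ⟨h.smooth.mono hV, fun y hy => h.mem y (hV hy)⟩

theorem IsSectionOn.smoothOn {W : M → Submodule ℝ R42} {U : Set M} {σ : M → R42}
    (h : IsSectionOn W U σ) : SmoothOn σ U := h.smooth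

theorem IsSectionOn.add {W : M → Submodule ℝ R42} {U : Set M} {σ ς : M → R42}
    (h : IsSectionOn W U σ) (h' : IsSectionOn W U ς) : IsSectionOn W U (fun y => σ y + ς y) :=
  ⟨h.smooth.add h'.smooth, fun y hy => (W y).add_mem (h.mem y hy) (h'.mem y hy)⟩

theorem IsSectionOn.smul {W : M → Submodule ℝ R42} {U : Set M} {g : M → ℝ} {σ : M → R42}
    (hg : SmoothOn g U) (h : IsSectionOn W U σ) : IsSectionOn W U (fun y => g y • σ y) :=
  ⟨hg.smul' h.smooth, fun y hy => (W y).smul_mem _ (h.mem y hy)⟩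

theorem IsSectionOn.const_smul {W : M → Submodule ℝ R42} {U : Set M} (c : ℝ) {σ : M → R42}
    (h : IsSectionOn W U σ) : IsSectionOn W U (fun y => c • σ y) :=
  IsSectionOn.smul contMDiffOn_const h

/-- Smooth dual functionals of a pair of pointwise independent functions. -/
theorem exists_dual_pair {U : Set M} (hU : IsOpen U) {σ₁ σ₂ : M → R42} (h₁ : SmoothOn σ₁ U)
    (h₂ : SmoothOn σ₂ U) {x : M} (hx : x ∈ U) (hind : LinearIndependent ℝ ![σ₁ x, σ₂ x]) :
    ∃ V ⊆ U, IsOpen V ∧ x ∈ V ∧ ∃ l₁ l₂ : M → R42 →L[ℝ] ℝ, SmoothOn l₁ V ∧ SmoothOn l₂ V ∧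
      ∀ y ∈ V, l₁ y (σ₁ y) = 1 ∧ l₁ y (σ₂ y) = 0 ∧ l₂ y (σ₁ y) = 0 ∧ l₂ y (σ₂ y) = 1 := by
  obtain ⟨L, hL⟩ := LinearMap.exists_leftInverse_of_injective
    (Fintype.linearCombination ℝ ![σ₁ x, σ₂ x])
    (LinearMap.ker_eq_bot.2 (hind.fintypeLinearCombination_injective))
  have hval : ∀ i j, L (![σ₁ x, σ₂ x] i) j = if i = j then 1 else 0 := by
    intro i j
    have := congrFun (LinearMap.congr_fun hL (Pi.single i 1)) j
    rw [LinearMap.comp_apply, Fintype.linearCombination_apply_single, one_smul] at this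
    rw [this]
    simp [Pi.single_apply, eq_comm]
  let a : Fin 2 → R42 →L[ℝ] ℝ := fun j =>
    LinearMap.toContinuousLinearMap ((LinearMap.proj j).comp L)
  have ha : ∀ i v, a i v = L v i := fun _ _ => rfl
  have hs : ∀ i (σ : M → R42), SmoothOn σ U → SmoothOn (fun y => a i (σ y)) U := fun i σ h =>
    (a i).contMDiff.comp_contMDiffOn h
  -- The determinant of `σ₁ y`, `σ₂ y` in functionals dual to `σ₁ x`, `σ₂ x`. It is `1` at `x`, so
  -- it stays non-zero nearby and Cramer's rule gives the dual functionals.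
  let D : M → ℝ := fun y => a 0 (σ₁ y) * a 1 (σ₂ y) - a 0 (σ₂ y) * a 1 (σ₁ y)
  have hD : SmoothOn D U := ((hs 0 _ h₁).mul (hs 1 _ h₂)).sub ((hs 0 _ h₂).mul (hs 1 _ h₁))
  have hDx : D x = 1 := by
    have h00 := hval 0 0
    have h01 := hval 0 1
    have h10 := hval 1 0
    have h11 := hval 1 1
    simp at h00 h01 h10 h11
    simp [D, ha, h00, h01, h10, h11]
  have hV := hD.isOpen_ne_zero hU
  have hDV : SmoothOn (fun y => (D y)⁻¹) (U ∩ {y | D y ≠ 0}) :=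
    (hD.mono Set.inter_subset_left).inv fun y hy => hy.2
  have hs' : ∀ i (σ : M → R42), SmoothOn σ U →
      SmoothOn (fun y => a i (σ y)) (U ∩ {y | D y ≠ 0}) :=
    fun i σ h => (hs i σ h).mono Set.inter_subset_left
  refine ⟨_, Set.inter_subset_left, hV, ⟨hx, by simp [hDx]⟩,
    fun y => (D y)⁻¹ • (a 1 (σ₂ y) • a 0 - a 0 (σ₂ y) • a 1),
    fun y => (D y)⁻¹ • (a 0 (σ₁ y) • a 1 - a 1 (σ₁ y) • a 0), ?_, ?_, ?_⟩
  · exact hDV.smul (((hs' 1 _ h₂).smul contMDiffOn_const).sub ((hs' 0 _ h₂).smul contMDiffOn_const))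
  · exact hDV.smul (((hs' 0 _ h₁).smul contMDiffOn_const).sub ((hs' 1 _ h₁).smul contMDiffOn_const))
  · intro y hy
    have hy2 : D y ≠ 0 := hy.2
    simp only [smul_apply, sub_apply, smul_eq_mul]
    have e1 : D y = a 0 (σ₁ y) * a 1 (σ₂ y) - a 0 (σ₂ y) * a 1 (σ₁ y) := rfl
    refine ⟨?_, ?_, ?_, ?_⟩
    · rw [inv_mul_eq_one₀ hy2, e1]; ring
    · rw [mul_eq_zero]; right; ring
    · rw [mul_eq_zero]; right; ring
    · rw [inv_mul_eq_one₀ hy2, e1]; ring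

/-- The coefficients of a section with respect to a local frame are smooth. -/
theorem exists_coefficients {U : Set M} (hU : IsOpen U) {σ₁ σ₂ ς : M → R42}
    (h₁ : SmoothOn σ₁ U) (h₂ : SmoothOn σ₂ U) (hς : SmoothOn ς U) {x : M} (hx : x ∈ U)
    (hind : LinearIndependent ℝ ![σ₁ x, σ₂ x])
    (hmem : ∀ y ∈ U, ς y ∈ Submodule.span ℝ {σ₁ y, σ₂ y}) :
    ∃ V ⊆ U, IsOpen V ∧ x ∈ V ∧ ∃ a b : M → ℝ, SmoothOn a V ∧ SmoothOn b V ∧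
      ∀ y ∈ V, ς y = a y • σ₁ y + b y • σ₂ y := by
  obtain ⟨V, hVU, hV, hxV, l₁, l₂, hl₁, hl₂, hl⟩ := exists_dual_pair hU h₁ h₂ hx hind
  refine ⟨V, hVU, hV, hxV, fun y => l₁ y (ς y), fun y => l₂ y (ς y),
    ContMDiffOn.clm_apply hl₁ (hς.mono hVU), ContMDiffOn.clm_apply hl₂ (hς.mono hVU),
    fun y hy => ?_⟩
  obtain ⟨c, d, hcd⟩ := Submodule.mem_span_pair.1 (hmem y (hVU hy))
  obtain ⟨e1, e2, e3, e4⟩ := hl y hy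
  simp only [← hcd, map_add, map_smul, e1, e2, e3, e4, smul_eq_mul]
  simp

/-- A subbundle of rank two has local frames. -/
theorem IsSubbundle.exists_frame (hf : IsSubbundle 2 f) (x : M) :
    ∃ U : Set M, IsOpen U ∧ x ∈ U ∧ ∃ e₁ e₂ : M → R42, IsSectionOn f U e₁ ∧ IsSectionOn f U e₂ ∧
      ∀ y ∈ U, LinearIndependent ℝ ![e₁ y, e₂ y] ∧ f y = Submodule.span ℝ {e₁ y, e₂ y} := by
  obtain ⟨U, hU, hx, e, he, h⟩ := hf x
  refine ⟨U, hU, hx, e 0, e 1, he 0, he 1, fun y hy => ?_⟩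
  obtain ⟨h1, h2⟩ := h y hy
  constructor
  · convert h1 using 1
    ext i; fin_cases i <;> rfl
  · rw [h2]
    congr 1
    ext v
    simp [Fin.exists_fin_two, eq_comm]

theorem IsSubbundle.finrank_eq (hf : IsSubbundle 2 f) (x : M) : Module.finrank ℝ (f x) = 2 := by
  obtain ⟨U, hU, hx, e, he, h⟩ := hf x
  obtain ⟨h1, h2⟩ := h x hx
  rw [h2, finrank_span_eq_card h1]; simp

/-- In a local frame the coefficients vanish at `x`, so the Leibniz rule leaves only derivatives of
coefficients times frame vectors. -/
theorem dAt_mem_of_eq_zero (hf : IsSubbundle 2 f) {U : Set M} (hU : IsOpen U) {x : M} (hx : x ∈ U)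
    {δ : M → R42} (hδ : IsSectionOn f U δ) (h0 : δ x = 0) (Z : TangentSpace (𝓡 2) x) :
    dAt δ x Z ∈ f x := by
  obtain ⟨U', hU', hx', e₁, e₂, he₁, he₂, he⟩ := hf.exists_frame x
  have hO := hU.inter hU'
  have hxO : x ∈ U ∩ U' := ⟨hx, hx'⟩
  obtain ⟨V, hVU, hV, hxV, a, b, ha, hb, hab⟩ := exists_coefficients hO
    (he₁.smoothOn.mono Set.inter_subset_right) (he₂.smoothOn.mono Set.inter_subset_right)
    (hδ.smoothOn.mono Set.inter_subset_left) hxO (he x hx').1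
    (fun y hy => by rw [← (he y hy.2).2]; exact hδ.mem y hy.1)
  have hd1 := ((he₁.smoothOn.mono Set.inter_subset_right).mono hVU).mdifferentiableAt hV hxV
  have hd2 := ((he₂.smoothOn.mono Set.inter_subset_right).mono hVU).mdifferentiableAt hV hxV
  have hda := ha.mdifferentiableAt hV hxV
  have hdb := hb.mdifferentiableAt hV hxV
  have hab0 : a x = 0 ∧ b x = 0 := by
    have := (hab x hxV).symm
    rw [h0] at this
    exact LinearIndependent.pair_iff.1 (he x hx').1 _ _ this
  rw [dAt_congr_on hV hxV hab, dAt_smul_add_smul hda hd1 hdb hd2, hab0.1, hab0.2, zero_smul, zero_smul, add_zero, add_zero]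
  exact (f x).add_mem ((f x).smul_mem _ (he₁.mem x hx')) ((f x).smul_mem _ (he₂.mem x hx'))

theorem dAt_sub_mem (hf : IsSubbundle 2 f) {U V : Set M} (hU : IsOpen U) (hV : IsOpen V) {x : M}
    (hxU : x ∈ U) (hxV : x ∈ V) {σ ς : M → R42} (hσ : IsSectionOn f U σ)
    (hς : IsSectionOn f V ς) (h : σ x = ς x) (Z : TangentSpace (𝓡 2) x) :
    dAt σ x Z - dAt ς x Z ∈ f x := by
  have hs := hσ.mono (Set.inter_subset_left (t := V))
  have ht := hς.mono (Set.inter_subset_right (s := U))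
  have hO := hU.inter hV
  have hxO : x ∈ U ∩ V := ⟨hxU, hxV⟩
  have h1 := dAt_mem_of_eq_zero hf hO hxO (hs.add (ht.const_smul (-1))) (by simp [h]) Z
  rw [dAt_add (hs.smoothOn.mdifferentiableAt hO hxO)
    ((ht.const_smul (-1)).smoothOn.mdifferentiableAt hO hxO)] at h1
  have hc : MDifferentiableAt (𝓡 2) 𝓘(ℝ, ℝ) (fun _ : M => (-1 : ℝ)) x := mdifferentiableAt_const
  rw [dAt_smul hc (ht.smoothOn.mdifferentiableAt hO hxO), dAt_const] at h1
  simpa [sub_eq_add_neg] using h1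

/-- The derivative modulo `f` of a section depends only on its value. -/
theorem dAt_linear_mod (hf : IsSubbundle 2 f) {U V : Set M} (hU : IsOpen U) (hV : IsOpen V) {x : M}
    (hxU : x ∈ U) (hxV : x ∈ V) {σ₁ σ₂ ς : M → R42} (h₁ : IsSectionOn f U σ₁)
    (h₂ : IsSectionOn f U σ₂) (hς : IsSectionOn f V ς) {a b : ℝ}
    (h : ς x = a • σ₁ x + b • σ₂ x) (Z : TangentSpace (𝓡 2) x) :
    dAt ς x Z - (a • dAt σ₁ x Z + b • dAt σ₂ x Z) ∈ f x := by
  have h1 := dAt_sub_mem hf hV hU hxV hxU hς ((h₁.const_smul a).add (h₂.const_smul b)) h Z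
  have hc : ∀ c : ℝ, MDifferentiableAt (𝓡 2) 𝓘(ℝ, ℝ) (fun _ : M => c) x :=
    fun c => mdifferentiableAt_const
  rw [dAt_add ((h₁.const_smul a).smoothOn.mdifferentiableAt hU hxU)
    ((h₂.const_smul b).smoothOn.mdifferentiableAt hU hxU),
    dAt_smul (hc a) (h₁.smoothOn.mdifferentiableAt hU hxU),
    dAt_smul (hc b) (h₂.smoothOn.mdifferentiableAt hU hxU), dAt_const, dAt_const] at h1
  simpa using h1

/-- The derivative modulo `f` depends only on the value of a section, so one section is enough to
test the solder form. -/
theorem solderVanishes_of_mem (hf : IsSubbundle 2 f) {U : Set M} (hU : IsOpen U) {x : M}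
    (hx : x ∈ U) {σ : M → R42} (hσ : IsSectionOn f U σ) {Z : TangentSpace (𝓡 2) x}
    (h : dAt σ x Z ∈ f x) : SolderVanishes f x Z (σ x) := by
  intro V ς hV hxV hς hςx
  have := (f x).add_mem (dAt_sub_mem hf hV hU hxV hx hς hσ hςx Z) h
  simpa using this

/-! ### Legendre maps -/

theorem IsLegendre.dAt_mem_perp (hf : IsLegendre f) {U : Set M} (hU : IsOpen U) {x : M}
    (hx : x ∈ U) {σ : M → R42} (hσ : IsSectionOn f U σ) (Z : TangentSpace (𝓡 2) x) :
    dAt σ x Z ∈ perp (f x) :=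
  hf.contact x (Submodule.subset_span ⟨U, σ, hU, hx, hσ, Or.inr ⟨Z, rfl⟩⟩)

theorem IsLegendre.form_eq_zero (hf : IsLegendre f) {x : M} {v w : R42} (hv : v ∈ f x)
    (hw : w ∈ f x) : form v w = 0 := hf.isotropic x hw v hv

theorem tangent_span {x : M} {X Y : TangentSpace (𝓡 2) x} (h : LinearIndependent ℝ ![X, Y])
    (Z : TangentSpace (𝓡 2) x) : ∃ z w : ℝ, Z = z • X + w • Y := by
  have hfin : Module.finrank ℝ (TangentSpace (𝓡 2) x) = 2 := by
    change Module.finrank ℝ (EuclideanSpace ℝ (Fin 2)) = 2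
    simp
  have : FiniteDimensional ℝ (TangentSpace (𝓡 2) x) := Module.finite_of_finrank_eq_succ hfin
  have h1 := h.span_eq_top_of_card_eq_finrank (by simp [hfin])
  have h2 : Z ∈ Submodule.span ℝ (Set.range ![X, Y]) := by rw [h1]; trivial
  rw [Matrix.range_cons, Matrix.range_cons, Matrix.range_empty, Set.union_empty,
    Set.singleton_union] at h2
  obtain ⟨z, w, hzw⟩ := Submodule.mem_span_pair.1 h2
  exact ⟨z, w, hzw.symm⟩

theorem IsLegendre.span_eq (hf : IsLegendre f) {x : M} {a b : R42} (ha : a ∈ f x) (hb : b ∈ f x)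
    (h : LinearIndependent ℝ ![a, b]) : f x = Submodule.span ℝ {a, b} := by
  have h1 : Submodule.span ℝ {a, b} ≤ f x := by
    rw [Submodule.span_le]
    rintro v (rfl | rfl) <;> assumption
  have h2 := finrank_span_eq_card h
  rw [Matrix.range_cons, Matrix.range_cons, Matrix.range_empty, Set.union_empty,
    Set.singleton_union] at h2
  exact (Submodule.eq_of_le_of_finrank_eq h1
    (by rw [h2, hf.subbundle.finrank_eq]; simp)).symm

/-- If `X` solders two independent vectors into `f`, it vanishes. -/
theorem IsLegendre.eq_zero_of_solder (hf : IsLegendre f) {U : Set M} (hU : IsOpen U) {x : M}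
    (hx : x ∈ U) {σ₁ σ₂ : M → R42} (h₁ : IsSectionOn f U σ₁) (h₂ : IsSectionOn f U σ₂)
    (hind : LinearIndependent ℝ ![σ₁ x, σ₂ x]) {Z : TangentSpace (𝓡 2) x}
    (hZ₁ : dAt σ₁ x Z ∈ f x) (hZ₂ : dAt σ₂ x Z ∈ f x) : Z = 0 := by
  refine hf.immersive x Z fun v hv V ς hV hxV hς hςx => ?_
  rw [hf.span_eq (h₁.mem x hx) (h₂.mem x hx) hind] at hv
  obtain ⟨a, b, hab⟩ := Submodule.mem_span_pair.1 hv
  have h := dAt_linear_mod hf.subbundle hU hV hx hxV h₁ h₂ hς (hςx.trans hab.symm) Z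
  have := (f x).add_mem h ((f x).add_mem ((f x).smul_mem a hZ₁) ((f x).smul_mem b hZ₂))
  simpa using this

/-- The quadratic differential in terms of a frame of `f`. -/
theorem quadDiff_eq (hf : IsLegendre f) {η : OneForm M} {U : Set M} (hU : IsOpen U) {x : M}
    (hx : x ∈ U) {σ₁ σ₂ : M → R42} (h₁ : IsSectionOn f U σ₁) (h₂ : IsSectionOn f U σ₂)
    (hind : LinearIndependent ℝ ![σ₁ x, σ₂ x]) {Z W : TangentSpace (𝓡 2) x}
    (hk : ∀ v ∈ f x, η x Z v = 0) {a b c d : ℝ}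
    (e₁ : η x Z (dAt σ₁ x W) = a • σ₁ x + b • σ₂ x)
    (e₂ : η x Z (dAt σ₂ x W) = c • σ₁ x + d • σ₂ x) :
    quadDiff f η x Z W = a + d := by
  let v₁ : f x := ⟨σ₁ x, h₁.mem x hx⟩
  let v₂ : f x := ⟨σ₂ x, h₂.mem x hx⟩
  have hv : LinearIndependent ℝ ![v₁, v₂] := by
    rw [LinearIndependent.pair_iff] at hind ⊢
    intro s t hst
    exact hind s t (congrArg Subtype.val hst)
  let 𝓑 : Module.Basis (Fin 2) ℝ (f x) := basisOfLinearIndependentOfCardEqFinrank hv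
    (by rw [hf.subbundle.finrank_eq]; simp)
  have hB0 : 𝓑 0 = v₁ := by simp [𝓑]
  have hB1 : 𝓑 1 = v₂ := by simp [𝓑]
  have hev : ∀ L : f x →ₗ[ℝ] f x, L v₁ = a • v₁ + b • v₂ → L v₂ = c • v₁ + d • v₂ →
      LinearMap.trace ℝ (f x) L = a + d := by
    intro L hL1 hL2
    rw [LinearMap.trace_eq_matrix_trace ℝ 𝓑, Matrix.trace_fin_two,
      LinearMap.toMatrix_apply, LinearMap.toMatrix_apply, hB0, hB1, hL1, hL2, ← hB0, ← hB1]
    simp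
  -- Because `η(Z)` kills `f`, the vector `η(Z) d_W σ` depends only on `σ x`, linearly; it therefore
  -- defines an endomorphism.
  have hex : ∃ L : f x →ₗ[ℝ] f x, IsPotentialEndo f η x Z W L := by
    let L : f x →ₗ[ℝ] f x := 𝓑.constr ℝ ![a • 𝓑 0 + b • 𝓑 1, c • 𝓑 0 + d • 𝓑 1]
    have hL1 : L v₁ = a • v₁ + b • v₂ := by
      rw [← hB0, ← hB1]; exact 𝓑.constr_basis ℝ _ 0
    have hL2 : L v₂ = c • v₁ + d • v₂ := by
      rw [← hB0, ← hB1]; exact 𝓑.constr_basis ℝ _ 1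
    refine ⟨L, fun V ς hV hxV hς v hvς => ?_⟩
    have hmem := (hf.span_eq (h₁.mem x hx) (h₂.mem x hx) hind).le v.2
    obtain ⟨s, t, hst⟩ := Submodule.mem_span_pair.1 hmem
    have hvv : v = s • v₁ + t • v₂ := Subtype.ext hst.symm
    have h := hk _ (dAt_linear_mod hf.subbundle hU hV hx hxV h₁ h₂ hς (hvς.symm.trans hst.symm) W)
    rw [map_sub, sub_eq_zero] at h
    rw [h, hvv, map_add, map_smul, map_smul, hL1, hL2, map_add, map_smul, map_smul, e₁, e₂]
    rfl
  have hspec : IsPotentialEndo f η x Z W hex.choose := hex.choose_spec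
  rw [quadDiff, dif_pos hex]
  refine hev _ ?_ ?_
  · exact Subtype.ext ((hspec U σ₁ hU hx h₁ v₁ rfl).trans e₁)
  · exact Subtype.ext ((hspec U σ₂ hU hx h₂ v₂ rfl).trans e₂)

variable [IsManifold (𝓡 2) ∞ M]

/-! ### Orthogonality relations in a curvature frame -/

section CurvatureFrame

variable {U : Set M} {σ₁ σ₂ : M → R42} {X Y : ∀ y : M, TangentSpace (𝓡 2) y}

theorem IsCurvatureFrame.swap (hF : IsCurvatureFrame f U σ₁ σ₂ X Y) :
    IsCurvatureFrame f U σ₂ σ₁ Y X :=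
  ⟨hF.section₂, hF.section₁, hF.smooth_Y, hF.smooth_X,
    fun y hy => LinearIndependent.pair_symm_iff.1 (hF.indep y hy),
    hF.Y_ne, hF.X_ne, hF.curv₂, hF.curv₁⟩

theorem IsCurvatureFrame.mono (hF : IsCurvatureFrame f U σ₁ σ₂ X Y) {V : Set M} (hV : V ⊆ U) :
    IsCurvatureFrame f V σ₁ σ₂ X Y :=
  ⟨hF.section₁.mono hV, hF.section₂.mono hV, hF.smooth_X.mono hV, hF.smooth_Y.mono hV,
    fun y hy => hF.indep y (hV hy), fun y hy => hF.X_ne y (hV hy), fun y hy => hF.Y_ne y (hV hy),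
    fun y hy => hF.curv₁ y (hV hy), fun y hy => hF.curv₂ y (hV hy)⟩

variable {y : M}

theorem IsCurvatureFrame.span_eq (hF : IsCurvatureFrame f U σ₁ σ₂ X Y) (hf : IsLegendre f)
    (hy : y ∈ U) : f y = Submodule.span ℝ {σ₁ y, σ₂ y} :=
  hf.span_eq (hF.section₁.mem y hy) (hF.section₂.mem y hy) (hF.indep y hy)

theorem IsCurvatureFrame.dAt_X_mem (hF : IsCurvatureFrame f U σ₁ σ₂ X Y) (hU : IsOpen U)
    (hy : y ∈ U) : dAt σ₁ y (X y) ∈ f y :=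
  hF.curv₁ y hy U σ₁ hU hy hF.section₁ rfl

/-- Otherwise `Y` would solder both `σ₁` and `σ₂` into `f`, against the immersion condition. -/
theorem IsCurvatureFrame.e_notMem (hF : IsCurvatureFrame f U σ₁ σ₂ X Y) (hf : IsLegendre f)
    (hU : IsOpen U) (hy : y ∈ U) : dAt σ₁ y (Y y) ∉ f y := fun h =>
  hF.Y_ne y hy (hf.eq_zero_of_solder hU hy hF.section₁ hF.section₂ (hF.indep y hy) h
    (hF.swap.dAt_X_mem hU hy))

theorem IsCurvatureFrame.e_pos (hF : IsCurvatureFrame f U σ₁ σ₂ X Y) (hf : IsLegendre f)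
    (hU : IsOpen U) (hy : y ∈ U) : 0 < form (dAt σ₁ y (Y y)) (dAt σ₁ y (Y y)) :=
  form_self_pos (hf.subbundle.finrank_eq y) (hf.isotropic y)
    (hf.dAt_mem_perp hU hy hF.section₁ _) (hF.e_notMem hf hU hy)

theorem IsCurvatureFrame.tangent_indep (hF : IsCurvatureFrame f U σ₁ σ₂ X Y) (hf : IsLegendre f)
    (hU : IsOpen U) (hy : y ∈ U) : LinearIndependent ℝ ![X y, Y y] := by
  rw [LinearIndependent.pair_iff' (hF.X_ne y hy)]
  intro a ha
  refine hF.e_notMem hf hU hy ?_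
  rw [← ha, map_smul]
  exact (f y).smul_mem _ (hF.dAt_X_mem hU hy)

/-- `(σ, d_Z d_W ς) = -(d_Z σ, d_W ς)` for sections `σ`, `ς` of a Legendre map. -/
theorem IsLegendre.form_dAt_dirDeriv (hf : IsLegendre f) (hU : IsOpen U) (hy : y ∈ U)
    {σ ς : M → R42} (hσ : IsSectionOn f U σ) (hς : IsSectionOn f U ς) (hX : SmoothVF X U)
    (Z : TangentSpace (𝓡 2) y) :
    form (σ y) (dAt (dirDeriv X ς) y Z) = - form (dAt σ y Z) (dAt ς y (X y)) := by
  have h1 : ∀ z ∈ U, form (σ z) (dirDeriv X ς z) = 0 := fun z hz =>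
    hf.dAt_mem_perp hU hz hς _ _ (hσ.mem z hz)
  have h2 := dAt_form (hσ.smoothOn.mdifferentiableAt hU hy)
    ((hς.smoothOn.dirDeriv hU hX).mdifferentiableAt hU hy) Z
  rw [dAt_congr_on hU hy h1, dAt_const] at h2
  change (0 : ℝ) = form (dAt σ y Z) (dAt ς y (X y)) + _ at h2
  linarith

/-- Symmetry of the second fundamental form: both sides are minus second derivatives of `ς` paired
with `σ`, and these differ by `(σ, d_B ς)` with `B` the bracket, which the contact condition kills.
-/
theorem IsLegendre.form_dAt_comm (hf : IsLegendre f) (hU : IsOpen U) (hy : y ∈ U)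
    {σ ς : M → R42} (hσ : IsSectionOn f U σ) (hς : IsSectionOn f U ς) (hX : SmoothVF X U)
    (hY : SmoothVF Y U) :
    form (dAt σ y (Y y)) (dAt ς y (X y)) = form (dAt σ y (X y)) (dAt ς y (Y y)) := by
  obtain ⟨B, hB, -⟩ := exists_bracket hU hX hY hy
  have h1 := hf.form_dAt_dirDeriv hU hy hσ hς hX (Y y)
  have h2 := hf.form_dAt_dirDeriv hU hy hσ hς hY (X y)
  have h3 : form (σ y) (dAt ς y B) = 0 := hf.dAt_mem_perp hU hy hς _ _ (hσ.mem y hy)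
  rw [← hB ς hς.smoothOn, map_sub] at h3
  linarith

/-- After exchanging `X` and `Y` the pairing is between `d_X σ₁` and `d_Y σ₂`, both in the isotropic
plane `f`. -/
theorem IsCurvatureFrame.e_orth (hF : IsCurvatureFrame f U σ₁ σ₂ X Y) (hf : IsLegendre f)
    (hU : IsOpen U) (hy : y ∈ U) : form (dAt σ₁ y (Y y)) (dAt σ₂ y (X y)) = 0 := by
  rw [hf.form_dAt_comm hU hy hF.section₁ hF.section₂ hF.smooth_X hF.smooth_Y]
  exact hf.form_eq_zero (hF.dAt_X_mem hU hy) (hF.swap.dAt_X_mem hU hy)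

/-- The orthogonal vectors `e₁`, `e₂` of positive length span a plane transversal to `f`, and `f^⊥`
has dimension `6 - 2 = 4`. -/
theorem IsCurvatureFrame.mem_perp_decomp (hF : IsCurvatureFrame f U σ₁ σ₂ X Y)
    (hf : IsLegendre f) (hU : IsOpen U) (hy : y ∈ U) {v : R42} (hv : v ∈ perp (f y)) :
    ∃ w ∈ f y, ∃ c d : ℝ, v = w + c • dAt σ₁ y (Y y) + d • dAt σ₂ y (X y) := by
  set e₁ := dAt σ₁ y (Y y) with he₁
  set e₂ := dAt σ₂ y (X y) with he₂
  have p1 : e₁ ∈ perp (f y) := hf.dAt_mem_perp hU hy hF.section₁ _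
  have p2 : e₂ ∈ perp (f y) := hf.dAt_mem_perp hU hy hF.section₂ _
  have n1 := hF.e_pos hf hU hy
  have n2 := hF.swap.e_pos hf hU hy
  have o := hF.e_orth hf hU hy
  rw [← he₁] at n1 o
  rw [← he₂] at n2 o
  have hdis : Disjoint (f y) (Submodule.span ℝ {e₁, e₂}) := by
    rw [Submodule.disjoint_def]
    intro w hw hw'
    obtain ⟨c, d, rfl⟩ := Submodule.mem_span_pair.1 hw'
    have q1 := p1 _ hw
    have q2 := p2 _ hw
    change form (c • e₁ + d • e₂) e₁ = 0 at q1
    change form (c • e₁ + d • e₂) e₂ = 0 at q2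
    simp [form_comm e₂ e₁, o, n1.ne'] at q1
    simp [o, n2.ne'] at q2
    simp [q1, q2]
  have hind : LinearIndependent ℝ ![e₁, e₂] := by
    rw [LinearIndependent.pair_iff]
    intro c d hcd
    have q1 := congrArg (fun w => form w e₁) hcd
    have q2 := congrArg (fun w => form w e₂) hcd
    simp [form_comm e₂ e₁, o, n1.ne'] at q1
    simp [o, n2.ne'] at q2
    exact ⟨q1, q2⟩
  have hr := finrank_span_eq_card hind
  rw [Matrix.range_cons, Matrix.range_cons, Matrix.range_empty, Set.union_empty,
    Set.singleton_union] at hr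
  have hle : f y ⊔ Submodule.span ℝ {e₁, e₂} ≤ perp (f y) := by
    refine sup_le (hf.isotropic y) ?_
    rw [Submodule.span_le]
    rintro w (rfl | rfl) <;> assumption
  have hsum := Submodule.finrank_sup_add_finrank_inf_eq (f y) (Submodule.span ℝ {e₁, e₂})
  rw [disjoint_iff.1 hdis, finrank_bot, hr, hf.subbundle.finrank_eq] at hsum
  have hp := finrank_perp_add (f y)
  rw [hf.subbundle.finrank_eq] at hp
  have heq := Submodule.eq_of_le_of_finrank_eq hle (by simp at hsum; omega)
  rw [← heq] at hv
  obtain ⟨w, hw, u, hu, rfl⟩ := Submodule.mem_sup.1 hv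
  obtain ⟨c, d, rfl⟩ := Submodule.mem_span_pair.1 hu
  exact ⟨w, hw, c, d, by abel⟩

theorem IsCurvatureFrame.isCurvatureSphere (hF : IsCurvatureFrame f U σ₁ σ₂ X Y)
    (hf : IsLegendre f) (hU : IsOpen U) (hy : y ∈ U) {c : ℝ} (hc : c ≠ 0) :
    IsCurvatureSphere f y (Submodule.span ℝ {c • σ₁ y}) := by
  have h0 : σ₁ y ≠ 0 := (hF.indep y hy).ne_zero 0
  rw [Submodule.span_singleton_smul_eq (IsUnit.mk0 c hc)]
  refine ⟨?_, finrank_span_singleton h0, Submodule.span ℝ {X y}, ?_, ?_⟩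
  · rw [Submodule.span_le, Set.singleton_subset_iff]; exact hF.section₁.mem y hy
  · rw [Ne, Submodule.span_singleton_eq_bot]; exact hF.X_ne y hy
  · intro Z hZ v hv
    obtain ⟨z, rfl⟩ := Submodule.mem_span_singleton.1 hZ
    obtain ⟨a, rfl⟩ := Submodule.mem_span_singleton.1 hv
    refine solderVanishes_of_mem hf.subbundle hU hy (hF.section₁.const_smul a) ?_
    have hc : MDifferentiableAt (𝓡 2) 𝓘(ℝ, ℝ) (fun _ : M => a) y := mdifferentiableAt_const
    rw [dAt_smul hc (hF.section₁.smoothOn.mdifferentiableAt hU hy), dAt_const, map_smul]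
    simpa using (f y).smul_mem _ ((f y).smul_mem _ (hF.dAt_X_mem hU hy))

end CurvatureFrame

/-- A closed form that kills `f` satisfies `η(X) d_Y σ = η(Y) d_X σ` for sections `σ` of `f`. -/
theorem IsClosedForm.apply_dAt_comm {η : OneForm M} (hη : IsClosedForm η)
    (hk : ∀ x Z, ∀ v ∈ f x, η x Z v = 0) {U : Set M} (hU : IsOpen U)
    {X Y : ∀ y : M, TangentSpace (𝓡 2) y} (hX : SmoothVF X U) (hY : SmoothVF Y U) {y : M}
    (hy : y ∈ U) {σ : M → R42} (hσ : IsSectionOn f U σ) :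
    η y (X y) (dAt σ y (Y y)) = η y (Y y) (dAt σ y (X y)) := by
  obtain ⟨B, -, hB⟩ := exists_bracket hU hX hY hy
  -- Differentiate the identity `η(Z) σ = 0`; the exterior derivative evaluated on `σ` then contains
  -- only the two terms to be compared.
  have key : ∀ Z : ∀ y : M, TangentSpace (𝓡 2) y, SmoothVF Z U → ∀ W : TangentSpace (𝓡 2) y,
      dAt (fun z => η z (Z z)) y W (σ y) = - η y (Z y) (dAt σ y W) := by
    intro Z hZ W
    have h1 : ∀ z ∈ U, η z (Z z) (σ z) = 0 := fun z hz => hk z _ _ (hσ.mem z hz)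
    have h2 := dAt_clm_apply ((hη.smoothOn_apply hU hZ).mdifferentiableAt hU hy)
      (hσ.smoothOn.mdifferentiableAt hU hy) W
    rw [dAt_congr_on hU hy h1, dAt_const] at h2
    exact eq_neg_of_add_eq_zero_left h2.symm
  have h3 := DFunLike.congr_fun (hB η hη) (σ y)
  rw [sub_apply, key Y hY, key X hX, hk y B _ (hσ.mem y hy)] at h3
  rw [neg_sub_neg, sub_eq_zero] at h3
  exact h3

end Frames

end LieSphere

end

noncomputable section

namespace LieSphere

section Middle

variable {M : Type*} [TopologicalSpace M] [ChartedSpace (EuclideanSpace ℝ (Fin 2)) M]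
variable {f : M → Submodule ℝ R42}

/-! ### Exact forms with primitive in `∧² f` -/

/-- The point is smoothness of the coefficient: for a fixed `r` with `(e₁,r) ≠ 0`, the `e₂`
component of `τ r` is `g (e₁,r)`, a smooth function divided out on a smaller neighbourhood. -/
theorem exists_wedge_coefficient (hf : IsLegendre f) {τ : M → (R42 →L[ℝ] R42)}
    (hτ : ContMDiff (𝓡 2) 𝓘(ℝ, R42 →L[ℝ] R42) ∞ τ) (hmem : ∀ x, τ x ∈ wedgeSpan (f x) (f x))
    (x : M) : ∃ V : Set M, IsOpen V ∧ x ∈ V ∧ ∃ (e₁ e₂ : M → R42) (g : M → ℝ),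
      IsSectionOn f V e₁ ∧ IsSectionOn f V e₂ ∧ SmoothOn g V ∧
      ∀ y ∈ V, τ y = g y • wedge (e₁ y) (e₂ y) := by
  obtain ⟨U, hU, hx, e₁, e₂, he₁, he₂, he⟩ := hf.subbundle.exists_frame x
  obtain ⟨V, hVU, hV, hxV, l₁, l₂, hl₁, hl₂, hl⟩ :=
    exists_dual_pair hU he₁.smoothOn he₂.smoothOn hx (he x hx).1
  have hne : e₁ x ≠ 0 := (he x hx).1.ne_zero 0
  obtain ⟨r, hr⟩ : ∃ r, form (e₁ x) r ≠ 0 := by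
    by_contra hcon
    push Not at hcon
    exact hne (form_nondegenerate hcon)
  have hs : SmoothOn (fun y => form (e₁ y) r) V :=
    (he₁.smoothOn.mono hVU).form contMDiffOn_const
  have hτr : SmoothOn (fun y => l₂ y (τ y r)) V :=
    ContMDiffOn.clm_apply hl₂ (ContMDiffOn.clm_apply hτ.contMDiffOn contMDiffOn_const)
  have hO := hs.isOpen_ne_zero hV
  have hsub : V ∩ {y | form (e₁ y) r ≠ 0} ⊆ V := Set.inter_subset_left
  refine ⟨_, hO, ⟨hxV, hr⟩, e₁, e₂, fun y => (form (e₁ y) r)⁻¹ * l₂ y (τ y r),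
    he₁.mono (hsub.trans hVU), he₂.mono (hsub.trans hVU),
    ((hs.mono hsub).inv fun y hy => hy.2).mul (hτr.mono hsub), fun y hy => ?_⟩
  have hm := hmem y
  rw [(he y (hVU hy.1)).2] at hm
  obtain ⟨g, hg⟩ := wedgeSpan_pair hm
  obtain ⟨-, -, h3, h4⟩ := hl y hy.1
  have hy2 : form (e₁ y) r ≠ 0 := hy.2
  have hval : l₂ y (τ y r) = g * form (e₁ y) r := by
    rw [hg, smul_apply, wedge_apply, map_smul, map_sub, map_smul, map_smul, h3, h4]
    simp
  beta_reduce
  rw [hval, mul_comm g, inv_mul_cancel_left₀ hy2, hg]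

/-- In the derivative of `g e₁ ∧ e₂` each term keeps a factor in `f`, and the other lies in `f^⊥` by
the contact condition. So gauge transformations preserve `f ∧ f^⊥`. -/
theorem dAt_mem_wedgeSpan (hf : IsLegendre f) {τ : M → (R42 →L[ℝ] R42)}
    (hτ : ContMDiff (𝓡 2) 𝓘(ℝ, R42 →L[ℝ] R42) ∞ τ) (hmem : ∀ x, τ x ∈ wedgeSpan (f x) (f x))
    (x : M) (Z : TangentSpace (𝓡 2) x) : dAt τ x Z ∈ wedgeSpan (f x) (perp (f x)) := by
  obtain ⟨V, hV, hx, e₁, e₂, g, he₁, he₂, hg, h⟩ := exists_wedge_coefficient hf hτ hmem x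
  have d1 := he₁.smoothOn.mdifferentiableAt hV hx
  have d2 := he₂.smoothOn.mdifferentiableAt hV hx
  rw [dAt_congr_on hV hx h, dAt_smul (hg.mdifferentiableAt hV hx)
    ((he₁.smoothOn.wedge he₂.smoothOn).mdifferentiableAt hV hx), dAt_wedge d1 d2,
    wedge_swap (dAt e₁ x Z)]
  have m1 := he₁.mem x hx
  have m2 := he₂.mem x hx
  exact Submodule.add_mem _ (Submodule.smul_mem _ _ (wedge_mem_wedgeSpan m1 (hf.isotropic x m2)))
    (Submodule.smul_mem _ _ (Submodule.add_mem _
      (Submodule.neg_mem _ (wedge_mem_wedgeSpan m2 (hf.dAt_mem_perp hV hx he₁ Z)))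
      (wedge_mem_wedgeSpan m1 (hf.dAt_mem_perp hV hx he₂ Z))))

theorem isAdapted_dAt (hf : IsLegendre f) {τ : M → (R42 →L[ℝ] R42)}
    (hτ : ContMDiff (𝓡 2) 𝓘(ℝ, R42 →L[ℝ] R42) ∞ τ) (hmem : ∀ x, τ x ∈ wedgeSpan (f x) (f x))
    (x : M) (Z : TangentSpace (𝓡 2) x) : IsAdapted (f x) (dAt τ x Z) :=
  isAdapted_of_mem (hf.isotropic x) (dAt_mem_wedgeSpan hf hτ hmem x Z)

/-- If `a h + b k` vanishes near a common zero, so does the quadratic part of its expansion. -/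
theorem dAt_mul_add_mul_eq_zero {a b h k : M → ℝ} {x : M}
    (ha : MDifferentiableAt (𝓡 2) 𝓘(ℝ, ℝ) a x) (hb : MDifferentiableAt (𝓡 2) 𝓘(ℝ, ℝ) b x)
    (hh : MDifferentiableAt (𝓡 2) 𝓘(ℝ, ℝ) h x) (hk : MDifferentiableAt (𝓡 2) 𝓘(ℝ, ℝ) k x)
    (a0 : a x = 0) (b0 : b x = 0) (h0 : h x = 0) (k0 : k x = 0)
    (hz : ∀ᶠ y in 𝓝 x, a y * h y + b y * k y = 0) (Z : TangentSpace (𝓡 2) x) :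
    dAt a x Z * dAt h x Z + dAt b x Z * dAt k x Z = 0 := by
  set ψ := (extChartAt (𝓡 2) x).symm with hψ
  set u := extChartAt (𝓡 2) x x with hu
  have hψu : ψ u = x := extChartAt_to_inv x
  let Z' : EuclideanSpace ℝ (Fin 2) := Z
  let γ : ℝ → EuclideanSpace ℝ (Fin 2) := fun t => u + t • Z'
  have hγ : HasDerivAt γ Z' 0 := by
    have h1 := ((hasDerivAt_id (0 : ℝ)).smul_const Z').const_add u
    rw [one_smul] at h1
    exact h1
  have hγ0 : γ 0 = u := by simp [γ]
  -- Along a straight line in the chart each factor divided by `t` tends to its derivative, so the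
  -- identity is divided by `t²`.
  have key : ∀ g : M → ℝ, MDifferentiableAt (𝓡 2) 𝓘(ℝ, ℝ) g x → g x = 0 →
      Filter.Tendsto (fun t => t⁻¹ * g (ψ (γ t))) (𝓝[≠] 0) (𝓝 (dAt g x Z)) := by
    intro g hg g0
    have h1 : HasFDerivAt (g ∘ ψ) (dAt g x) (γ 0) := by
      rw [hγ0]
      have := hg.hasMFDerivAt.2
      rw [ModelWithCorners.range_eq_univ] at this
      exact this.hasFDerivAt Filter.univ_mem
    have h2 : HasDerivAt ((g ∘ ψ) ∘ γ) (dAt g x Z) 0 := h1.comp_hasDerivAt 0 hγ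
    have h3 := hasDerivAt_iff_tendsto_slope_zero.1 h2
    simpa [hγ0, hψu, g0] using h3
  have hlim := ((key a ha a0).mul (key h hh h0)).add ((key b hb b0).mul (key k hk k0))
  refine tendsto_nhds_unique hlim ?_
  refine tendsto_const_nhds.congr' ?_
  have hcont : Filter.Tendsto (fun t => ψ (γ t)) (𝓝 0) (𝓝 x) := by
    have h1 : ContinuousAt ψ (γ 0) := by rw [hγ0]; exact continuousAt_extChartAt_symm x
    have h2 := (h1.comp hγ.continuousAt : ContinuousAt (ψ ∘ γ) 0)
    have h3 : (ψ ∘ γ) 0 = x := by rw [Function.comp_apply, hγ0, hψu]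
    rw [ContinuousAt, h3] at h2
    exact h2
  filter_upwards [(hcont.eventually hz).filter_mono nhdsWithin_le_nhds] with t ht
  have : t⁻¹ * t⁻¹ * (a (ψ (γ t)) * h (ψ (γ t)) + b (ψ (γ t)) * k (ψ (γ t))) = 0 := by
    rw [ht, mul_zero]
  linarith

variable [IsManifold (𝓡 2) ∞ M]

section

variable {U : Set M} {σ₁ σ₂ : M → R42} {X Y : ∀ y : M, TangentSpace (𝓡 2) y} {y : M}

/-- For `τ ∈ ∧² f`, `dτ(X) d_X σ₂` is a multiple of `σ₁`. -/
theorem IsCurvatureFrame.dAt_apply_e (hF : IsCurvatureFrame f U σ₁ σ₂ X Y) (hf : IsLegendre f)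
    (hU : IsOpen U) (hy : y ∈ U) {τ : M → (R42 →L[ℝ] R42)}
    (hτ : ContMDiff (𝓡 2) 𝓘(ℝ, R42 →L[ℝ] R42) ∞ τ) (hmem : ∀ x, τ x ∈ wedgeSpan (f x) (f x)) :
    ∃ k : ℝ, dAt τ y (X y) (dAt σ₂ y (X y)) = k • σ₁ y := by
  have h1 : ∀ z ∈ U, τ z (dirDeriv X σ₂ z) = 0 := fun z hz =>
    wedgeSpan_self_kills (hmem z) (hf.dAt_mem_perp hU hz hF.section₂ _)
  have h2 := dAt_clm_apply ((hτ y).mdifferentiableAt (by simp))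
    ((hF.section₂.smoothOn.dirDeriv hU hF.smooth_X).mdifferentiableAt hU hy) (X y)
  rw [dAt_congr_on hU hy h1, dAt_const] at h2
  have h3 : dAt τ y (X y) (dAt σ₂ y (X y)) = - τ y (dAt (dirDeriv X σ₂) y (X y)) :=
    eq_neg_of_add_eq_zero_left h2.symm
  have hm := hmem y
  rw [hF.span_eq hf hy] at hm
  obtain ⟨g, hg⟩ := wedgeSpan_pair hm
  -- `(σ₁, d_X d_X σ₂) = -(d_X σ₁, d_X σ₂)`, and `d_X σ₁ ∈ f`. Hence `σ₁ ∧ σ₂` maps `d_X d_X σ₂` to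
  -- a multiple of `σ₁`.
  have h4 : form (σ₁ y) (dAt (dirDeriv X σ₂) y (X y)) = 0 := by
    rw [hf.form_dAt_dirDeriv hU hy hF.section₁ hF.section₂ hF.smooth_X,
      hf.dAt_mem_perp hU hy hF.section₂ _ _ (hF.dAt_X_mem hU hy), neg_zero]
  rw [h3, hg, smul_apply, wedge_apply, h4]
  exact ⟨g * form (σ₂ y) (dAt (dirDeriv X σ₂) y (X y)), by module⟩

/-- The middle condition: `μ(X) d_X σ₂` is a multiple of `σ₂`. -/
theorem IsCurvatureFrame.middle_apply_e (hF : IsCurvatureFrame f U σ₁ σ₂ X Y) (hf : IsLegendre f)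
    (hU : IsOpen U) (hy : y ∈ U) {A : R42 →L[ℝ] R42} (hA : IsAdapted (f y) A)
    (hmid : ∃ a ∈ wedgeSpan (cyclide σ₁ Y y) (cyclide σ₁ Y y) ⊔
      wedgeSpan (cyclide σ₂ X y) (cyclide σ₂ X y), ∃ b ∈ wedgeSpan (f y) (f y), A = a + b) :
    ∃ k : ℝ, A (dAt σ₂ y (X y)) = k • σ₂ y := by
  obtain ⟨a, ha, b, hb, hab⟩ := hmid
  set e₁ := dAt σ₁ y (Y y) with he₁
  set e₂ := dAt σ₂ y (X y) with he₂
  set r₁ := dAt (dirDeriv Y σ₁) y (Y y) with hr₁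
  set r₂ := dAt (dirDeriv X σ₂) y (X y) with hr₂
  have n1 := hF.e_pos hf hU hy
  have n2 := hF.swap.e_pos hf hU hy
  have o := hF.e_orth hf hU hy
  rw [← he₁] at n1 o
  rw [← he₂] at n2 o
  have p1 : e₁ ∈ perp (f y) := hf.dAt_mem_perp hU hy hF.section₁ _
  have p2 : e₂ ∈ perp (f y) := hf.dAt_mem_perp hU hy hF.section₂ _
  have m1 := hF.section₁.mem y hy
  have m2 := hF.section₂.mem y hy
  have s11 : form (σ₁ y) r₁ = - form e₁ e₁ :=
    hf.form_dAt_dirDeriv hU hy hF.section₁ hF.section₁ hF.smooth_Y _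
  have s22 : form (σ₂ y) r₂ = - form e₂ e₂ :=
    hf.form_dAt_dirDeriv hU hy hF.section₂ hF.section₂ hF.smooth_X _
  -- correct `e₂` by a multiple of `σ₁` to make it orthogonal to the first cyclide
  set u := e₂ + (form e₂ r₁ / form e₁ e₁) • σ₁ y with hu
  have hu1 : ∀ v ∈ cyclide σ₁ Y y, form v u = 0 := by
    intro v hv
    refine Submodule.span_induction (p := fun v _ => form v u = 0) ?_ (by simp) ?_ ?_ hv
    · rintro v (rfl | rfl | rfl)
      · rw [hu, map_add, map_smul, p2 _ m1, hf.form_eq_zero m1 m1]; simp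
      · change form e₁ u = 0
        rw [hu, map_add, map_smul, o, form_comm e₁ (σ₁ y), p1 _ m1]; simp
      · change form r₁ u = 0
        rw [hu, map_add, map_smul, form_comm r₁ (σ₁ y), s11, form_comm r₁ e₂, smul_eq_mul]
        field_simp
        ring
    · intro v w _ _ hv hw; simp [hv, hw]
    · intro t v _ hv; simp [hv]
  have hAu : A u = A e₂ := by
    rw [hu, map_add, map_smul, hA.kills _ m1]; simp
  have hbu : b u = 0 := wedgeSpan_self_kills hb
    ((perp (f y)).add_mem p2 ((perp (f y)).smul_mem _ (hf.isotropic y m1)))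
  -- The `S₁ ∧ S₁` part kills `u`, so only the `S₂ ∧ S₂` part acts.
  have hau : a u ∈ cyclide σ₂ X y := by
    obtain ⟨a₁, ha₁, a₂, ha₂, rfl⟩ := Submodule.mem_sup.1 ha
    have z1 : a₁ u = 0 := wedgeSpan_self_kills ha₁ fun v hv => hu1 v hv
    have z2 : a₂ u ∈ cyclide σ₂ X y := by
      refine wedgeSpan_induction (P := fun A => A u ∈ cyclide σ₂ X y) ?_ ?_ ?_ ?_ ha₂
      · intro v hv w hw
        rw [wedge_apply]
        exact Submodule.sub_mem _ (Submodule.smul_mem _ _ hw) (Submodule.smul_mem _ _ hv)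
      · exact Submodule.zero_mem _
      · intro A B hA hB; exact Submodule.add_mem _ hA hB
      · intro t A hA; exact Submodule.smul_mem _ t hA
    rw [add_apply, z1, zero_add]; exact z2
  have hmem : A e₂ ∈ cyclide σ₂ X y := by
    rw [← hAu, hab, add_apply, hbu, add_zero]; exact hau
  obtain ⟨k, w, hw, hkw⟩ := Submodule.mem_span_insert.1 hmem
  obtain ⟨l, m, rfl⟩ := Submodule.mem_span_pair.1 hw
  change A e₂ = k • σ₂ y + (l • e₂ + m • r₂) at hkw
  have hf2 : A e₂ ∈ f y := hA.maps _ p2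
  -- The vector `A e₂` lies in `f ∩ S₂`. Pairing with `σ₂` and then with `e₂` removes the `d_X d_X
  -- σ₂` and `e₂` components, leaving `⟨σ₂⟩`.
  have hm : m = 0 := by
    have h0 := hf.form_eq_zero m2 hf2
    rw [hkw, map_add, map_add, map_smul, map_smul, map_smul, hf.form_eq_zero m2 m2, p2 _ m2,
      s22] at h0
    simpa [n2.ne'] using h0
  have hl : l = 0 := by
    have h0 := p2 _ hf2
    rw [hkw, hm] at h0
    change form _ _ = 0 at h0
    simp only [map_add, map_smul, LinearMap.add_apply, LinearMap.smul_apply] at h0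
    rw [show form (σ₂ y) e₂ = 0 from p2 _ m2] at h0
    simpa [n2.ne'] using h0
  exact ⟨k, by rw [hkw, hm, hl]; simp⟩

/-- The quadratic differential in a curvature frame. -/
theorem IsCurvatureFrame.quadDiff_eq (hF : IsCurvatureFrame f U σ₁ σ₂ X Y) (hf : IsLegendre f)
    (hU : IsOpen U) (hy : y ∈ U) {η : OneForm M} (hk : ∀ Z, ∀ v ∈ f y, η y Z v = 0)
    {A₁ A₂ k₁ k₂ : ℝ} (h11 : η y (X y) (dAt σ₁ y (Y y)) = 0) (h22 : η y (Y y) (dAt σ₂ y (X y)) = 0)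
    (h1 : η y (Y y) (dAt σ₁ y (Y y)) = A₁ • σ₁ y + k₁ • σ₂ y)
    (h2 : η y (X y) (dAt σ₂ y (X y)) = k₂ • σ₁ y + A₂ • σ₂ y) (z₁ z₂ w₁ w₂ : ℝ) :
    quadDiff f η y (z₁ • X y + z₂ • Y y) (w₁ • X y + w₂ • Y y) =
      z₁ * w₁ * A₂ + z₂ * w₂ * A₁ := by
  have d1 : ∀ Z, η y Z (dAt σ₁ y (X y)) = 0 := fun Z => hk Z _ (hF.dAt_X_mem hU hy)
  have d2 : ∀ Z, η y Z (dAt σ₂ y (Y y)) = 0 := fun Z => hk Z _ (hF.swap.dAt_X_mem hU hy)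
  rw [LieSphere.quadDiff_eq hf hU hy hF.section₁ hF.section₂ (hF.indep y hy)
    (hk (z₁ • X y + z₂ • Y y)) (a := z₂ * w₂ * A₁) (b := z₂ * w₂ * k₁) (c := z₁ * w₁ * k₂)
    (d := z₁ * w₁ * A₂)]
  · ring
  · simp only [map_add, map_smul, add_apply, smul_apply, d1, h11, h1, smul_zero, zero_add]
    module
  · simp only [map_add, map_smul, add_apply, smul_apply, d2, h22, h2, smul_zero, add_zero]
    module

/-- Since `d_X σ₁ ∈ f` is orthogonal to `f^⊥`, the induced metric of `σ₁` sees only `Y` components.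
-/
theorem IsCurvatureFrame.form_dAt (hF : IsCurvatureFrame f U σ₁ σ₂ X Y) (hf : IsLegendre f)
    (hU : IsOpen U) (hy : y ∈ U) (z₁ z₂ w₁ w₂ : ℝ) :
    form (dAt σ₁ y (z₁ • X y + z₂ • Y y)) (dAt σ₁ y (w₁ • X y + w₂ • Y y)) =
      z₂ * w₂ * form (dAt σ₁ y (Y y)) (dAt σ₁ y (Y y)) := by
  have m := hF.dAt_X_mem hU hy
  have p : form (dAt σ₁ y (X y)) (dAt σ₁ y (Y y)) = 0 :=
    hf.dAt_mem_perp hU hy hF.section₁ _ _ m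
  simp only [map_add, map_smul, LinearMap.add_apply, LinearMap.smul_apply,
    hf.form_eq_zero m m, p, form_comm _ (dAt σ₁ y (X y)), smul_eq_mul]
  ring

end

end Middle

end LieSphere

end

noncomputable section

namespace LieSphere

section Forward

variable {M : Type*} [TopologicalSpace M] [ChartedSpace (EuclideanSpace ℝ (Fin 2)) M]
variable {f : M → Submodule ℝ R42}

/-! ### From a conserved quantity to an isothermic surface -/

/-- The equations satisfied by the top coefficient `s` of a linear conserved quantity
`𝔭 + t s` of constant non-zero norm of the pencil `d + tμ`. -/
structure IsConservedSection (f : M → Submodule ℝ R42) (μ : OneForm M) (𝔭 : R42)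
    (s : M → R42) : Prop where
  closed : IsClosedForm μ
  adapted : ∀ x Z, IsAdapted (f x) (μ x Z)
  smooth : ContMDiff (𝓡 2) 𝓘(ℝ, R42) ∞ s
  dAt_eq : ∀ x Z, dAt s x Z = - μ x Z 𝔭
  kills : ∀ x Z, μ x Z (s x) = 0
  norm_ne : form 𝔭 𝔭 ≠ 0
  orth : ∀ x, form (s x) 𝔭 = 0
  null : ∀ x, form (s x) (s x) = 0

variable [IsManifold (𝓡 2) ∞ M]

/-- Evaluation at `t = 1` and `t = -1` separates the coefficients of `t` and `t²`, both in the
parallel equation and in the norm. -/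
theorem IsLinearNormConstant.isConservedSection (hf : IsLegendre f) {η μ : OneForm M}
    {p : Fin 2 → M → R42} {𝔭 : R42} (h : IsLinearNormConstant f η μ p 𝔭) :
    IsConservedSection f μ 𝔭 (p 1) := by
  obtain ⟨τ, hτ, hτf, hμ⟩ := h.middle.1
  have hp0 : ∀ x, p 0 x = 𝔭 := fun x => by
    simpa [evalPoly, Fin.sum_univ_two] using h.initial x
  have hev : ∀ t x, evalPoly (d := 1) p t x = 𝔭 + t • p 1 x := fun t x => by
    simp [evalPoly, Fin.sum_univ_two, hp0]
  have hp1 : ContMDiff (𝓡 2) 𝓘(ℝ, R42) ∞ (p 1) := h.conserved.smooth 1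
  have hd : ∀ t x Z, dAt (evalPoly (d := 1) p t) x Z = t • dAt (p 1) x Z := by
    intro t x Z
    have h1 : evalPoly (d := 1) p t = fun y => 𝔭 + t • p 1 y := funext (hev t)
    have hc : MDifferentiableAt (𝓡 2) 𝓘(ℝ, ℝ) (fun _ : M => t) x := mdifferentiableAt_const
    have hc' : MDifferentiableAt (𝓡 2) 𝓘(ℝ, R42) (fun _ : M => 𝔭) x := mdifferentiableAt_const
    have hd1 : MDifferentiableAt (𝓡 2) 𝓘(ℝ, R42) (p 1) x := (hp1 x).mdifferentiableAt (by simp)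
    have h2 := dAt_add (ς := fun y => t • p 1 y) hc' (hc.smul hd1) Z
    rw [h1, h2, dAt_const, dAt_smul hc hd1, dAt_const]
    simp
  have hpar := h.conserved.parallel
  have e1 : ∀ x Z, dAt (p 1) x Z + (μ x Z 𝔭 + μ x Z (p 1 x)) = 0 := fun x Z => by
    simpa [hd, hev] using hpar 1 x Z
  have e2 : ∀ x Z, - dAt (p 1) x Z + (- μ x Z 𝔭 + μ x Z (p 1 x)) = 0 := fun x Z => by
    simpa [hd, hev] using hpar (-1) x Z
  have hk : ∀ x Z, μ x Z (p 1 x) = 0 := fun x Z => by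
    have h3 : (2 : ℝ) • μ x Z (p 1 x) =
      (dAt (p 1) x Z + (μ x Z 𝔭 + μ x Z (p 1 x))) +
        (- dAt (p 1) x Z + (- μ x Z 𝔭 + μ x Z (p 1 x))) := by module
    rw [e1, e2, add_zero] at h3
    exact (smul_eq_zero.1 h3).resolve_left two_ne_zero
  obtain ⟨c, hc, hn⟩ := h.norm
  have n0 : ∀ x : M, form 𝔭 𝔭 = c := fun x => by simpa [hev] using hn 0 x
  have n1 : ∀ x, form 𝔭 𝔭 + 2 * form (p 1 x) 𝔭 + form (p 1 x) (p 1 x) = c := fun x => by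
    rw [← hn 1 x, hev]
    simp [form_comm 𝔭 (p 1 x)]; ring
  have n2 : ∀ x, form 𝔭 𝔭 - 2 * form (p 1 x) 𝔭 + form (p 1 x) (p 1 x) = c := fun x => by
    rw [← hn (-1) x, hev]
    simp [form_comm 𝔭 (p 1 x)]; ring
  obtain ⟨x₀, -⟩ := h.conserved.degree
  refine ⟨h.omega.closed.sub_dAt hτ hμ, fun x Z => ?_, hp1, fun x Z => ?_, hk, ?_, ?_, ?_⟩
  · rw [hμ]
    exact (isAdapted_of_mem (hf.isotropic x) (h.omega.values x Z)).sub (isAdapted_dAt hf hτ hτf x Z)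
  · have := e1 x Z
    rw [hk, add_zero] at this
    exact eq_neg_of_add_eq_zero_left this
  · rw [n0 x₀]; exact hc
  · intro x; linarith [n1 x, n2 x]
  · intro x; linarith [n1 x, n2 x, n0 x]

section

variable {U : Set M} {σ₁ σ₂ : M → R42} {X Y : ∀ y : M, TangentSpace (𝓡 2) y} {y : M}
  {μ : OneForm M} {𝔭 : R42} {s : M → R42}

theorem IsConservedSection.apply_e (hs : IsConservedSection f μ 𝔭 s)
    (hF : IsCurvatureFrame f U σ₁ σ₂ X Y) (hU : IsOpen U) (hy : y ∈ U) :
    μ y (X y) (dAt σ₁ y (Y y)) = 0 := by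
  rw [hs.closed.apply_dAt_comm (fun x Z => (hs.adapted x Z).kills) hU hF.smooth_X hF.smooth_Y hy
    hF.section₁]
  exact (hs.adapted y _).kills _ (hF.dAt_X_mem hU hy)

/-- As `μ s = 0`, skewness gives `0 = (μ(Y) s, e₁) = -A₁ (s,σ₁)`, and likewise for `σ₂`. So `s` is a
null vector of `f^⊥`, and `f^⊥ / f` is definite. -/
theorem IsConservedSection.mem (hs : IsConservedSection f μ 𝔭 s) (hf : IsLegendre f)
    (hF : IsCurvatureFrame f U σ₁ σ₂ X Y) (hy : y ∈ U) {A₁ A₂ : ℝ}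
    (h1 : μ y (Y y) (dAt σ₁ y (Y y)) = A₁ • σ₁ y) (h2 : μ y (X y) (dAt σ₂ y (X y)) = A₂ • σ₂ y)
    (hA₁ : A₁ ≠ 0) (hA₂ : A₂ ≠ 0) : s y ∈ f y := by
  have o1 : form (σ₁ y) (s y) = 0 := by
    have := (hs.adapted y (Y y)).skew (s y) (dAt σ₁ y (Y y))
    rw [hs.kills, h1] at this
    simpa [hA₁, form_comm] using this
  have o2 : form (σ₂ y) (s y) = 0 := by
    have := (hs.adapted y (X y)).skew (s y) (dAt σ₂ y (X y))
    rw [hs.kills, h2] at this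
    simpa [hA₂, form_comm] using this
  refine (form_self_nonneg (hf.subbundle.finrank_eq y) (hf.isotropic y) ?_).2 (hs.null y)
  rw [hF.span_eq hf hy]
  exact mem_perp_span_pair o1 o2

/-- The coefficients of the conserved section are proportional to the inner products of the
curvature spheres with `𝔭`. -/
theorem IsConservedSection.coefficient (hs : IsConservedSection f μ 𝔭 s) (hf : IsLegendre f)
    (hF : IsCurvatureFrame f U σ₁ σ₂ X Y) (hU : IsOpen U) (hsf : ∀ z ∈ U, s z ∈ f z) (hy : y ∈ U)
    {A₁ : ℝ} (h1 : μ y (Y y) (dAt σ₁ y (Y y)) = A₁ • σ₁ y) {a b : ℝ}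
    (hab : s y = a • σ₁ y + b • σ₂ y) :
    a * form (dAt σ₁ y (Y y)) (dAt σ₁ y (Y y)) = A₁ * form (σ₁ y) 𝔭 := by
  have hsec : IsSectionOn f U s := ⟨hs.smooth.contMDiffOn, hsf⟩
  have h2 := dAt_linear_mod hf.subbundle hU hU hy hy hF.section₁ hF.section₂ hsec hab (Y y)
  have p1 := hf.dAt_mem_perp hU hy hF.section₁ (Y y)
  have h3 := p1 _ h2
  change form _ _ = 0 at h3
  have h4 := p1 _ (hF.swap.dAt_X_mem hU hy)
  change form _ _ = 0 at h4
  -- Pair `d_Y s = -μ(Y) 𝔭` with `e₁`: modulo `f` the left side is `a e₁ + b d_Y σ₂` with `d_Y σ₂ ∈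
  -- f`, and skewness evaluates the right side.
  have h5 : form (μ y (Y y) 𝔭) (dAt σ₁ y (Y y)) = - (A₁ * form (σ₁ y) 𝔭) := by
    rw [(hs.adapted y (Y y)).skew, h1, map_smul, smul_eq_mul, form_comm]
  rw [hs.dAt_eq] at h3
  simp only [map_sub, map_add, map_neg, map_smul, LinearMap.sub_apply, LinearMap.add_apply,
    LinearMap.neg_apply, LinearMap.smul_apply, smul_eq_mul, h4, h5] at h3
  linarith

/-- At a point where both curvature spheres are orthogonal to `𝔭`, so is `d_Y σ₁`. -/
theorem IsConservedSection.form_e_eq_zero (hs : IsConservedSection f μ 𝔭 s) (hf : IsLegendre f)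
    (hF : IsCurvatureFrame f U σ₁ σ₂ X Y) (hU : IsOpen U) (hsf : ∀ z ∈ U, s z ∈ f z)
    {x : M} (hx : x ∈ U) {A₁ A₂ : ℝ} (hA₁ : A₁ ≠ 0)
    (h1 : μ x (Y x) (dAt σ₁ x (Y x)) = A₁ • σ₁ x) (h2 : μ x (X x) (dAt σ₂ x (X x)) = A₂ • σ₂ x)
    (z1 : form (σ₁ x) 𝔭 = 0) (z2 : form (σ₂ x) 𝔭 = 0) : form (dAt σ₁ x (Y x)) 𝔭 = 0 := by
  obtain ⟨V, hVU, hV, hxV, a, b, ha, hb, hab⟩ := exists_coefficients hU hF.section₁.smoothOn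
    hF.section₂.smoothOn (hs.smooth.contMDiffOn (s := U)) hx (hF.indep x hx)
    (fun y hy => by rw [← hF.span_eq hf hy]; exact hsf y hy)
  have hFV := hF.mono hVU
  have hsV : ∀ z ∈ V, s z ∈ f z := fun z hz => hsf z (hVU hz)
  have n1 := hFV.e_pos hf hV hxV
  have n2 := hFV.swap.e_pos hf hV hxV
  have a0 : a x = 0 := by
    have := hs.coefficient hf hFV hV hsV hxV h1 (hab x hxV)
    rw [z1, mul_zero] at this
    exact (mul_eq_zero.1 this).resolve_right n1.ne'
  have b0 : b x = 0 := by
    have := hs.coefficient hf hFV.swap hV hsV hxV h2 ((hab x hxV).trans (add_comm _ _))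
    rw [z2, mul_zero] at this
    exact (mul_eq_zero.1 this).resolve_right n2.ne'
  have d1 := hFV.section₁.smoothOn.mdifferentiableAt hV hxV
  have d2 := hFV.section₂.smoothOn.mdifferentiableAt hV hxV
  have da := ha.mdifferentiableAt hV hxV
  have db := hb.mdifferentiableAt hV hxV
  have hc : MDifferentiableAt (𝓡 2) 𝓘(ℝ, R42) (fun _ : M => 𝔭) x := mdifferentiableAt_const
  have hp : ∀ σ : M → R42, MDifferentiableAt (𝓡 2) 𝓘(ℝ, R42) σ x → ∀ Z,
      dAt (fun y => form (σ y) 𝔭) x Z = form (dAt σ x Z) 𝔭 := by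
    intro σ hσ Z
    rw [dAt_form hσ hc, dAt_const]; simp
  -- All four factors of `a (σ₁,𝔭) + b (σ₂,𝔭) = 0` vanish at `x`, so its first order information is
  -- empty; the second order term in the direction `Y` gives `(d_Y a)(e₁,𝔭) = 0`.
  have hquad := dAt_mul_add_mul_eq_zero (h := fun y => form (σ₁ y) 𝔭)
    (k := fun y => form (σ₂ y) 𝔭) da db
    ((hFV.section₁.smoothOn.form contMDiffOn_const).mdifferentiableAt hV hxV)
    ((hFV.section₂.smoothOn.form contMDiffOn_const).mdifferentiableAt hV hxV) a0 b0 z1 z2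
    (by
      filter_upwards [hV.mem_nhds hxV] with y hy
      have := hs.orth y
      rw [hab y hy] at this
      simpa using this) (Y x)
  rw [hp _ d1, hp _ d2] at hquad
  have hpf : 𝔭 ∈ perp (f x) := by
    rw [hF.span_eq hf hx]; exact mem_perp_span_pair z1 z2
  have z3 : form (dAt σ₂ x (Y x)) 𝔭 = 0 := hpf _ (hF.swap.dAt_X_mem hU hx)
  rw [z3, mul_zero, add_zero] at hquad
  obtain ⟨w, hw, c, d, hwcd⟩ := hF.mem_perp_decomp hf hU hx hpf
  have o := hF.e_orth hf hU hx
  have p1 := hf.dAt_mem_perp hU hx hF.section₁ (Y x)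
  have hc1 : form (dAt σ₁ x (Y x)) 𝔭 = c * form (dAt σ₁ x (Y x)) (dAt σ₁ x (Y x)) := by
    conv_lhs => rw [hwcd]
    rw [map_add, map_add, map_smul, map_smul, o, form_comm _ w, p1 w hw]
    simp
  -- If `d_Y a = 0`, then `d_Y s` is a multiple of `σ₂`, while `-μ(Y) 𝔭 = -c A₁ σ₁` with `c` the
  -- `e₁` component of `𝔭`; independence forces `c = 0`.
  rcases mul_eq_zero.1 hquad with hda | h
  · have h3 := hs.dAt_eq x (Y x)
    have hμ : μ x (Y x) 𝔭 = (c * A₁) • σ₁ x := by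
      conv_lhs => rw [hwcd]
      rw [map_add, map_add, map_smul, map_smul, (hs.adapted x _).kills w hw, h1,
        hs.apply_e hF.swap hU hx]
      module
    rw [dAt_congr_on hV hxV hab, dAt_smul_add_smul da d1 db d2, a0, b0, hda, hμ] at h3
    have h4 : (c * A₁) • σ₁ x + dAt b x (Y x) • σ₂ x = 0 := by
      simp only [zero_smul, zero_add, add_zero] at h3
      rw [h3]; abel
    have h5 := (LinearIndependent.pair_iff.1 (hF.indep x hx) _ _ h4).1
    rw [hc1, (mul_eq_zero.1 h5).resolve_right hA₁, zero_mul]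
  · exact h

end

section

variable {U : Set M} {σ₁ σ₂ : M → R42} {X Y : ∀ y : M, TangentSpace (𝓡 2) y} {y : M}
  {η μ : OneForm M} {𝔭 : R42} {p : Fin 2 → M → R42}

/-- The potential and the middle potential in a frame of the middle condition. -/
theorem IsLinearNormConstant.exists_values (h : IsLinearNormConstant f η μ p 𝔭)
    (hf : IsLegendre f) (hF : IsCurvatureFrame f U σ₁ σ₂ X Y) (hU : IsOpen U) (hy : y ∈ U)
    (hmid : ∀ Z, ∃ a ∈ wedgeSpan (cyclide σ₁ Y y) (cyclide σ₁ Y y) ⊔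
      wedgeSpan (cyclide σ₂ X y) (cyclide σ₂ X y), ∃ b ∈ wedgeSpan (f y) (f y), μ y Z = a + b) :
    ∃ A₁ A₂ : ℝ, A₁ ≠ 0 ∧ A₂ ≠ 0 ∧ μ y (Y y) (dAt σ₁ y (Y y)) = A₁ • σ₁ y ∧
      μ y (X y) (dAt σ₂ y (X y)) = A₂ • σ₂ y ∧
      ∀ z₁ z₂ w₁ w₂ : ℝ, quadDiff f η y (z₁ • X y + z₂ • Y y) (w₁ • X y + w₂ • Y y) =
        z₁ * w₁ * A₂ + z₂ * w₂ * A₁ := by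
  have hs := h.isConservedSection hf
  obtain ⟨τ, hτ, hτf, hμ⟩ := h.middle.1
  have hη : ∀ Z v, η y Z v = μ y Z v + dAt τ y Z v := fun Z v => by
    rw [hμ]; simp
  obtain ⟨A₂, hA₂⟩ := hF.middle_apply_e hf hU hy (hs.adapted y (X y)) (hmid (X y))
  obtain ⟨A₁, hA₁⟩ := hF.swap.middle_apply_e hf hU hy (hs.adapted y (Y y))
    (by rw [sup_comm]; exact hmid (Y y))
  obtain ⟨k₂, hk₂⟩ := hF.dAt_apply_e hf hU hy hτ hτf
  obtain ⟨k₁, hk₁⟩ := hF.swap.dAt_apply_e hf hU hy hτ hτf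
  have had : ∀ x Z, IsAdapted (f x) (η x Z) := fun x Z =>
    isAdapted_of_mem (hf.isotropic x) (h.omega.values x Z)
  have hker : ∀ x Z, ∀ v ∈ f x, η x Z v = 0 := fun x Z => (had x Z).kills
  have h11 : η y (X y) (dAt σ₁ y (Y y)) = 0 := by
    rw [h.omega.closed.apply_dAt_comm hker hU hF.smooth_X hF.smooth_Y hy hF.section₁]
    exact hker y _ _ (hF.dAt_X_mem hU hy)
  have h22 : η y (Y y) (dAt σ₂ y (X y)) = 0 := by
    rw [h.omega.closed.apply_dAt_comm hker hU hF.smooth_Y hF.smooth_X hy hF.section₂]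
    exact hker y _ _ (hF.swap.dAt_X_mem hU hy)
  -- The gauge term `dτ` contributes only the off-diagonal multiples `k₁`, `k₂`, which the trace
  -- ignores; so `q` of `η` is read off from `μ`.
  have hq := hF.quadDiff_eq hf hU hy (hker y) h11 h22 (A₁ := A₁) (A₂ := A₂) (k₁ := k₁) (k₂ := k₂)
    (by rw [hη, hA₁, hk₁]) (by rw [hη, hA₂, hk₂, add_comm])
  refine ⟨A₁, A₂, fun h0 => ?_, fun h0 => ?_, hA₁, hA₂, hq⟩
  · refine hF.Y_ne y hy (h.omega.nondegenerate y (Y y) fun W => ?_)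
    obtain ⟨w₁, w₂, rfl⟩ := tangent_span (hF.tangent_indep hf hU hy) W
    simpa [h0] using hq 0 1 w₁ w₂
  · refine hF.X_ne y hy (h.omega.nondegenerate y (X y) fun W => ?_)
    obtain ⟨w₁, w₂, rfl⟩ := tangent_span (hF.tangent_indep hf hU hy) W
    simpa [h0] using hq 1 0 w₁ w₂

end

/-- The conserved section `s` in a curvature frame: `s = a σ₁ + b σ₂`, and the quadratic
differential is diagonal with eigenvalues given by `a`, `b` and the `(σᵢ, 𝔭)`. -/
structure IsConservedFrame (f : M → Submodule ℝ R42) (η μ : OneForm M) (𝔭 : R42) (s : M → R42)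
    (U : Set M) (σ₁ σ₂ : M → R42) (X Y : ∀ y : M, TangentSpace (𝓡 2) y) (a b : M → ℝ) :
    Prop where
  frame : IsCurvatureFrame f U σ₁ σ₂ X Y
  smooth₁ : SmoothOn a U
  smooth₂ : SmoothOn b U
  eq : ∀ y ∈ U, s y = a y • σ₁ y + b y • σ₂ y
  ne₁ : ∀ y ∈ U, form (σ₁ y) 𝔭 ≠ 0
  ne₂ : ∀ y ∈ U, form (σ₂ y) 𝔭 ≠ 0
  coeff₁ : ∀ y ∈ U, a y ≠ 0
  coeff₂ : ∀ y ∈ U, b y ≠ 0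
  orth : ∀ y ∈ U, a y * form (σ₁ y) 𝔭 + b y * form (σ₂ y) 𝔭 = 0
  quad : ∀ y ∈ U, ∀ Z W : TangentSpace (𝓡 2) y, quadDiff f η y Z W =
    a y / form (σ₁ y) 𝔭 * form (dAt σ₁ y Z) (dAt σ₁ y W) +
      b y / form (σ₂ y) 𝔭 * form (dAt σ₂ y Z) (dAt σ₂ y W)
  mid₁ : ∀ y ∈ U, ∃ A : ℝ, A ≠ 0 ∧ μ y (Y y) (dAt σ₁ y (Y y)) = A • σ₁ y
  mid₂ : ∀ y ∈ U, ∃ A : ℝ, A ≠ 0 ∧ μ y (X y) (dAt σ₂ y (X y)) = A • σ₂ y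

theorem IsConservedFrame.swap {η μ : OneForm M} {𝔭 : R42} {s : M → R42}
    {U : Set M} {σ₁ σ₂ : M → R42} {X Y : ∀ y : M, TangentSpace (𝓡 2) y} {a b : M → ℝ}
    (h : IsConservedFrame f η μ 𝔭 s U σ₁ σ₂ X Y a b) :
    IsConservedFrame f η μ 𝔭 s U σ₂ σ₁ Y X b a :=
  ⟨h.frame.swap, h.smooth₂, h.smooth₁, fun y hy => (h.eq y hy).trans (add_comm _ _), h.ne₂, h.ne₁,
    h.coeff₂, h.coeff₁, fun y hy => (add_comm _ _).trans (h.orth y hy),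
    fun y hy Z W => (h.quad y hy Z W).trans (add_comm _ _), h.mid₂, h.mid₁⟩

theorem IsConservedFrame.mono {η μ : OneForm M} {𝔭 : R42} {s : M → R42}
    {U V : Set M} {σ₁ σ₂ : M → R42} {X Y : ∀ y : M, TangentSpace (𝓡 2) y} {a b : M → ℝ}
    (h : IsConservedFrame f η μ 𝔭 s U σ₁ σ₂ X Y a b) (hV : V ⊆ U) :
    IsConservedFrame f η μ 𝔭 s V σ₁ σ₂ X Y a b :=
  ⟨h.frame.mono hV, h.smooth₁.mono hV, h.smooth₂.mono hV, fun y hy => h.eq y (hV hy),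
    fun y hy => h.ne₁ y (hV hy), fun y hy => h.ne₂ y (hV hy), fun y hy => h.coeff₁ y (hV hy),
    fun y hy => h.coeff₂ y (hV hy), fun y hy => h.orth y (hV hy), fun y hy => h.quad y (hV hy),
    fun y hy => h.mid₁ y (hV hy), fun y hy => h.mid₂ y (hV hy)⟩

/-- The content is the non-vanishing. As `A₁, A₂ ≠ 0`, the coefficient of `σᵢ` vanishes exactly
where `(σᵢ,𝔭)` does. By `(s,𝔭) = 0` one of these zeros forces the other, and both together would
make `𝔭` null. -/
theorem IsLinearNormConstant.exists_frame {η μ : OneForm M} {𝔭 : R42} {p : Fin 2 → M → R42}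
    (h : IsLinearNormConstant f η μ p 𝔭) (hf : IsLegendre f) (x : M) :
    ∃ U : Set M, IsOpen U ∧ x ∈ U ∧
      ∃ (σ₁ σ₂ : M → R42) (X Y : ∀ y : M, TangentSpace (𝓡 2) y) (a b : M → ℝ),
        IsConservedFrame f η μ 𝔭 (p 1) U σ₁ σ₂ X Y a b := by
  have hs := h.isConservedSection hf
  obtain ⟨U, hU, hx, σ₁, σ₂, X, Y, hF, hmid⟩ := h.middle.2 x
  have hval : ∀ y ∈ U, ∃ A₁ A₂ : ℝ, A₁ ≠ 0 ∧ A₂ ≠ 0 ∧ μ y (Y y) (dAt σ₁ y (Y y)) = A₁ • σ₁ y ∧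
      μ y (X y) (dAt σ₂ y (X y)) = A₂ • σ₂ y ∧
      ∀ z₁ z₂ w₁ w₂ : ℝ, quadDiff f η y (z₁ • X y + z₂ • Y y) (w₁ • X y + w₂ • Y y) =
        z₁ * w₁ * A₂ + z₂ * w₂ * A₁ := fun y hy =>
    h.exists_values hf hF hU hy fun Z => by
      obtain ⟨a, ha, b, -, hab, hb⟩ := hmid y hy Z
      exact ⟨a, ha, b, hb, hab⟩
  have hsf : ∀ y ∈ U, p 1 y ∈ f y := fun y hy => by
    obtain ⟨A₁, A₂, n1, n2, h1, h2, -⟩ := hval y hy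
    exact hs.mem hf hF hy h1 h2 n1 n2
  obtain ⟨V, hVU, hV, hxV, a, b, ha, hb, hab⟩ := exists_coefficients hU hF.section₁.smoothOn
    hF.section₂.smoothOn (hs.smooth.contMDiffOn (s := U)) hx (hF.indep x hx)
    (fun y hy => by rw [← hF.span_eq hf hy]; exact hsf y hy)
  refine ⟨V, hV, hxV, σ₁, σ₂, X, Y, a, b, ?_⟩
  have key : ∀ y ∈ V, form (σ₁ y) 𝔭 ≠ 0 ∧ form (σ₂ y) 𝔭 ≠ 0 ∧ a y ≠ 0 ∧ b y ≠ 0 ∧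
      a y * form (σ₁ y) 𝔭 + b y * form (σ₂ y) 𝔭 = 0 ∧
      ∀ Z W : TangentSpace (𝓡 2) y, quadDiff f η y Z W =
        a y / form (σ₁ y) 𝔭 * form (dAt σ₁ y Z) (dAt σ₁ y W) +
          b y / form (σ₂ y) 𝔭 * form (dAt σ₂ y Z) (dAt σ₂ y W) := by
    intro y hyV
    have hy := hVU hyV
    obtain ⟨A₁, A₂, n1, n2, h1, h2, hq⟩ := hval y hy
    have c1 := hs.coefficient hf hF hU hsf hy h1 (hab y hyV)
    have c2 := hs.coefficient hf hF.swap hU hsf hy h2 ((hab y hyV).trans (add_comm _ _))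
    have e1 := hF.e_pos hf hU hy
    have e2 := hF.swap.e_pos hf hU hy
    have ho : a y * form (σ₁ y) 𝔭 + b y * form (σ₂ y) 𝔭 = 0 := by
      have := hs.orth y
      rw [hab y hyV] at this
      simpa using this
    have hor : form (σ₁ y) 𝔭 ≠ 0 ∨ form (σ₂ y) 𝔭 ≠ 0 := by
      by_contra hcon
      push Not at hcon
      obtain ⟨z1, z2⟩ := hcon
      have g1 := hs.form_e_eq_zero hf hF hU hsf hy n1 h1 h2 z1 z2
      have g2 := hs.form_e_eq_zero hf hF.swap hU hsf hy n2 h2 h1 z2 z1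
      have hpf : 𝔭 ∈ perp (f y) := by
        rw [hF.span_eq hf hy]; exact mem_perp_span_pair z1 z2
      -- Now `𝔭` lies in `f^⊥` and is orthogonal to `e₁` and `e₂`, so `(𝔭,𝔭) = 0`, a contradiction.
      obtain ⟨w, hw, c, d, hwcd⟩ := hF.mem_perp_decomp hf hU hy hpf
      refine hs.norm_ne ?_
      have hw0 : form w 𝔭 = 0 := hpf w hw
      conv_lhs => lhs; rw [hwcd]
      simp [hw0, g1, g2]
    have hequiv1 : form (σ₁ y) 𝔭 = 0 ↔ a y = 0 := by
      constructor
      · intro h0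
        rw [h0, mul_zero] at c1
        exact (mul_eq_zero.1 c1).resolve_right e1.ne'
      · intro h0
        rw [h0, zero_mul] at c1
        exact (mul_eq_zero.1 c1.symm).resolve_left n1
    have hequiv2 : form (σ₂ y) 𝔭 = 0 ↔ b y = 0 := by
      constructor
      · intro h0
        rw [h0, mul_zero] at c2
        exact (mul_eq_zero.1 c2).resolve_right e2.ne'
      · intro h0
        rw [h0, zero_mul] at c2
        exact (mul_eq_zero.1 c2.symm).resolve_left n2
    have hne1 : form (σ₁ y) 𝔭 ≠ 0 := by
      intro h0
      rw [h0, mul_zero, zero_add] at ho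
      have : form (σ₂ y) 𝔭 = 0 := by
        rcases mul_eq_zero.1 ho with h | h
        · exact hequiv2.2 h
        · exact h
      exact hor.elim (fun h => h h0) (fun h => h this)
    have hne2 : form (σ₂ y) 𝔭 ≠ 0 := by
      intro h0
      rw [h0, mul_zero, add_zero] at ho
      rcases mul_eq_zero.1 ho with h | h
      · exact hne1 (hequiv1.2 h)
      · exact hne1 h
    refine ⟨hne1, hne2, fun h => hne1 (hequiv1.2 h), fun h => hne2 (hequiv2.2 h), ho, ?_⟩
    intro Z W
    obtain ⟨z₁, z₂, rfl⟩ := tangent_span (hF.tangent_indep hf hU hy) Z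
    obtain ⟨w₁, w₂, rfl⟩ := tangent_span (hF.tangent_indep hf hU hy) W
    rw [hq, hF.form_dAt hf hU hy, add_comm (z₁ • X y), add_comm (w₁ • X y),
      hF.swap.form_dAt hf hU hy]
    rw [← div_eq_iff hne1] at c1
    rw [← div_eq_iff hne2] at c2
    rw [← c1, ← c2]
    ring
  exact ⟨hF.mono hVU, ha, hb, hab, fun y hy => (key y hy).1, fun y hy => (key y hy).2.1,
    fun y hy => (key y hy).2.2.1, fun y hy => (key y hy).2.2.2.1,
    fun y hy => (key y hy).2.2.2.2.1, fun y hy => (key y hy).2.2.2.2.2,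
    fun y hy => (hval y (hVU hy)).imp fun A₁ ⟨A₂, n1, _, h1, _, _⟩ => ⟨n1, h1⟩,
    fun y hy => by
      obtain ⟨-, A₂, -, n2, -, h2, -⟩ := hval y (hVU hy)
      exact ⟨A₂, n2, h2⟩⟩

end Forward

end LieSphere

end

/-! ### The isothermic sphere congruence of a conserved quantity -/

noncomputable section

namespace LieSphere

section Conclusion

variable {M : Type*} [TopologicalSpace M] [ChartedSpace (EuclideanSpace ℝ (Fin 2)) M]
variable {f : M → Submodule ℝ R42}

theorem exists_section_form_eq_one (hf : IsSubbundle 2 f) {𝔭 : R42} {x : M} {v : R42}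
    (hv : v ∈ f x) (hvp : form v 𝔭 ≠ 0) :
    ∃ U : Set M, IsOpen U ∧ x ∈ U ∧ ∃ ς : M → R42, IsSectionOn f U ς ∧
      ∀ y ∈ U, form (ς y) 𝔭 = 1 := by
  obtain ⟨U, hU, hx, e₁, e₂, he₁, he₂, he⟩ := hf.exists_frame x
  rw [(he x hx).2] at hv
  obtain ⟨a, b, hab⟩ := Submodule.mem_span_pair.1 hv
  have hsec := (he₁.const_smul a).add (he₂.const_smul b)
  have hs : SmoothOn (fun y => form (a • e₁ y + b • e₂ y) 𝔭) U :=
    hsec.smoothOn.form contMDiffOn_const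
  refine ⟨_, hs.isOpen_ne_zero hU, ⟨hx, by rwa [← hab] at hvp⟩,
    fun y => (form (a • e₁ y + b • e₂ y) 𝔭)⁻¹ • (a • e₁ y + b • e₂ y),
    IsSectionOn.smul ((hs.mono Set.inter_subset_left).inv fun y hy => hy.2)
      (hsec.mono Set.inter_subset_left), fun y hy => ?_⟩
  have hy2 : form (a • e₁ y + b • e₂ y) 𝔭 ≠ 0 := hy.2
  rw [map_smul, LinearMap.smul_apply, smul_eq_mul, inv_mul_cancel₀ hy2]

/-- A smooth section `s` of `f ∩ 𝔭^⊥` is `τ 𝔭` for a smooth section `τ` of `∧² f`. -/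
theorem exists_bivector (hf : IsSubbundle 2 f) {𝔭 : R42} {s : M → R42}
    (hs : ContMDiff (𝓡 2) 𝓘(ℝ, R42) ∞ s) (hsf : ∀ x, s x ∈ f x)
    (hne : ∀ x, ∃ v ∈ f x, form v 𝔭 ≠ 0)
    (hspan : ∀ x, ∀ v ∈ f x, form v 𝔭 = 0 → v ∈ Submodule.span ℝ {s x}) :
    ∃ τ : M → (R42 →L[ℝ] R42), ContMDiff (𝓡 2) 𝓘(ℝ, R42 →L[ℝ] R42) ∞ τ ∧
      (∀ x, τ x ∈ wedgeSpan (f x) (f x)) ∧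
      ∀ x, ∀ v ∈ f x, form v 𝔭 = 1 → τ x = wedge v (s x) := by
  have hone : ∀ x, ∃ v ∈ f x, form v 𝔭 = 1 := fun x => by
    obtain ⟨v, hv, hn⟩ := hne x
    exact ⟨(form v 𝔭)⁻¹ • v, (f x).smul_mem _ hv, by simp [hn]⟩
  -- The choice of `v` is only pointwise. Two choices differ by a multiple of `s`, so `v ∧ s` does
  -- not depend on it and is smooth, being locally built from a smooth choice.
  choose v hv hv1 using hone
  have huniq : ∀ x, ∀ w ∈ f x, form w 𝔭 = 1 → wedge (v x) (s x) = wedge w (s x) := by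
    intro x w hw hw1
    obtain ⟨c, hc⟩ := Submodule.mem_span_singleton.1
      (hspan x (v x - w) ((f x).sub_mem (hv x) hw) (by simp [hv1, hw1]))
    have : v x = w + c • s x := by rw [hc]; abel
    rw [this, wedge_add_left, wedge_smul_left, wedge_self]; simp
  refine ⟨fun x => wedge (v x) (s x), fun x => ?_,
    fun x => wedge_mem_wedgeSpan (hv x) (hsf x), huniq⟩
  obtain ⟨w, hw, hn⟩ := hne x
  obtain ⟨U, hU, hx, ς, hς, hς1⟩ := exists_section_form_eq_one hf hw hn
  have h1 : SmoothOn (fun y => wedge (ς y) (s y)) U := hς.smoothOn.wedge hs.contMDiffOn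
  refine (h1.contMDiffAt (hU.mem_nhds hx)).congr_of_eventuallyEq ?_
  filter_upwards [hU.mem_nhds hx] with y hy
  exact huniq y (ς y) (hς.mem y hy) (hς1 y hy)

/-- A nowhere vanishing function spans a line bundle. -/
theorem isSubbundle_span_singleton {s : M → R42} (hs : ContMDiff (𝓡 2) 𝓘(ℝ, R42) ∞ s)
    (h0 : ∀ x, s x ≠ 0) : IsSubbundle 1 fun x => Submodule.span ℝ {s x} := by
  intro x
  refine ⟨Set.univ, isOpen_univ, Set.mem_univ x, fun _ => s, fun _ => ⟨hs.contMDiffOn,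
    fun y _ => Submodule.mem_span_singleton_self _⟩, fun y _ => ⟨?_, ?_⟩⟩
  · rw [linearIndependent_unique_iff]; exact h0 y
  · rw [Set.range_const]

theorem dAt_mem_derived {W : M → Submodule ℝ R42} {U : Set M} (hU : IsOpen U) {x : M} (hx : x ∈ U)
    {σ : M → R42} (hσ : IsSectionOn W U σ) (Z : TangentSpace (𝓡 2) x) :
    dAt σ x Z ∈ derived W x :=
  Submodule.subset_span ⟨U, σ, hU, hx, hσ, Or.inr ⟨Z, rfl⟩⟩

theorem mem_derived {W : M → Submodule ℝ R42} {U : Set M} (hU : IsOpen U) {x : M} (hx : x ∈ U)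
    {σ : M → R42} (hσ : IsSectionOn W U σ) : σ x ∈ derived W x :=
  Submodule.subset_span ⟨U, σ, hU, hx, hσ, Or.inl rfl⟩

variable [IsManifold (𝓡 2) ∞ M]

section

variable {U : Set M} {σ₁ σ₂ : M → R42} {X Y : ∀ y : M, TangentSpace (𝓡 2) y} {y : M}

/-- The derivative modulo `f` of a section in a curvature frame. -/
theorem IsCurvatureFrame.dAt_section_mod (hF : IsCurvatureFrame f U σ₁ σ₂ X Y) (hf : IsLegendre f)
    (hU : IsOpen U) (hy : y ∈ U) {V : Set M} (hV : IsOpen V) (hyV : y ∈ V) {ς : M → R42}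
    (hς : IsSectionOn f V ς) {a b : ℝ} (hab : ς y = a • σ₁ y + b • σ₂ y) (z w : ℝ) :
    dAt ς y (z • X y + w • Y y) - ((w * a) • dAt σ₁ y (Y y) + (z * b) • dAt σ₂ y (X y)) ∈ f y := by
  have h1 := dAt_linear_mod hf.subbundle hU hV hy hyV hF.section₁ hF.section₂ hς hab
    (z • X y + w • Y y)
  have h2 := (f y).add_mem h1 ((f y).add_mem ((f y).smul_mem (z * a) (hF.dAt_X_mem hU hy))
    ((f y).smul_mem (w * b) (hF.swap.dAt_X_mem hU hy)))
  convert h2 using 1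
  simp only [map_add, map_smul]
  module

theorem IsCurvatureFrame.eq_zero_of_mem (hF : IsCurvatureFrame f U σ₁ σ₂ X Y) (hf : IsLegendre f)
    (hU : IsOpen U) (hy : y ∈ U) {c d : ℝ}
    (h : c • dAt σ₁ y (Y y) + d • dAt σ₂ y (X y) ∈ f y) : c = 0 ∧ d = 0 := by
  have o := hF.e_orth hf hU hy
  have q1 := hf.dAt_mem_perp hU hy hF.section₁ (Y y) _ h
  have q2 := hf.dAt_mem_perp hU hy hF.section₂ (X y) _ h
  change form _ _ = 0 at q1
  change form _ _ = 0 at q2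
  simp [form_comm (dAt σ₂ y (X y)) (dAt σ₁ y (Y y)), o, (hF.e_pos hf hU hy).ne'] at q1
  simp [o, (hF.swap.e_pos hf hU hy).ne'] at q2
  exact ⟨q1, q2⟩

/-- A section of `f ∩ 𝔭^⊥` that is nowhere a curvature sphere is immersed. -/
theorem IsCurvatureFrame.immersive_section (hF : IsCurvatureFrame f U σ₁ σ₂ X Y)
    (hf : IsLegendre f) (hU : IsOpen U) (hy : y ∈ U) {V : Set M} (hV : IsOpen V) (hyV : y ∈ V)
    {ς : M → R42} (hς : IsSectionOn f V ς) {a b : ℝ} (hab : ς y = a • σ₁ y + b • σ₂ y)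
    (ha : a ≠ 0) (hb : b ≠ 0) {Z : TangentSpace (𝓡 2) y} (hZ : dAt ς y Z ∈ f y) : Z = 0 := by
  obtain ⟨z, w, rfl⟩ := tangent_span (hF.tangent_indep hf hU hy) Z
  have h1 := hF.dAt_section_mod hf hU hy hV hyV hς hab z w
  have h2 := (f y).sub_mem hZ h1
  rw [sub_sub_cancel] at h2
  obtain ⟨h3, h4⟩ := hF.eq_zero_of_mem hf hU hy h2
  rw [(mul_eq_zero.1 h3).resolve_right ha, (mul_eq_zero.1 h4).resolve_right hb]
  simp

/-- `f^⊥ ∩ 𝔭^⊥` is contained in the derived bundle of `f ∩ 𝔭^⊥`. -/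
theorem IsCurvatureFrame.mem_derived (hF : IsCurvatureFrame f U σ₁ σ₂ X Y) (hf : IsLegendre f)
    (hU : IsOpen U) (hy : y ∈ U) {V : Set M} (hV : IsOpen V) (hyV : y ∈ V)
    {W : M → Submodule ℝ R42} {𝔭 : R42} (hW : ∀ x ∈ V, W x = f x ⊓ perp (Submodule.span ℝ {𝔭}))
    {ς : M → R42} (hς : IsSectionOn W V ς) {a b : ℝ} (hab : ς y = a • σ₁ y + b • σ₂ y)
    (ha : a ≠ 0) (hb : b ≠ 0) (hspan : W y ≤ Submodule.span ℝ {ς y}) {ξ : R42}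
    (hξ : ξ ∈ perp (f y)) (hξp : form ξ 𝔭 = 0) : ξ ∈ derived W y := by
  have hςf : IsSectionOn f V ς := ⟨hς.smooth, fun z hz => by
    have := hς.mem z hz; rw [hW z hz] at this; exact this.1⟩
  have hςp : ∀ z ∈ V, form (ς z) 𝔭 = 0 := fun z hz => by
    have := hς.mem z hz; rw [hW z hz] at this; exact mem_perp_span_singleton.1 this.2
  have hdp : ∀ Z, form (dAt ς y Z) 𝔭 = 0 := by
    intro Z
    have hc : MDifferentiableAt (𝓡 2) 𝓘(ℝ, R42) (fun _ : M => 𝔭) y := mdifferentiableAt_const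
    have h1 := dAt_form (hς.smoothOn.mdifferentiableAt hV hyV) hc Z
    rw [dAt_congr_on hV hyV hςp, dAt_const, dAt_const] at h1
    simpa using h1.symm
  obtain ⟨w, hw, c, d, hwcd⟩ := hF.mem_perp_decomp hf hU hy hξ
  -- The tangent vector is chosen so that the derivative of `ς` has the same `e₁`, `e₂` components
  -- as `ξ`; this needs `a, b ≠ 0`.
  have h1 := hF.dAt_section_mod hf hU hy hV hyV hςf hab (d / b) (c / a)
  rw [div_mul_cancel₀ _ ha, div_mul_cancel₀ _ hb] at h1
  set u := dAt ς y ((d / b) • X y + (c / a) • Y y) with hu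
  have h2 : ξ - u ∈ W y := by
    rw [hW y hyV]
    refine ⟨?_, mem_perp_span_singleton.2 (by rw [map_sub, LinearMap.sub_apply, hξp, hdp, sub_zero])⟩
    have e := (f y).sub_mem hw h1
    have e' : ξ - u = w - (u - (c • dAt σ₁ y (Y y) + d • dAt σ₂ y (X y))) := by rw [hwcd]; abel
    change ξ - u ∈ f y
    rw [e']; exact e
  obtain ⟨k, hk⟩ := Submodule.mem_span_singleton.1 (hspan h2)
  have h3 : ξ = k • ς y + u := by rw [hk]; abel
  rw [h3]
  exact Submodule.add_mem _ (Submodule.smul_mem _ _ (LieSphere.mem_derived hV hyV hς))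
    (dAt_mem_derived hV hyV hς _)

end

section

variable {η μ : OneForm M} {𝔭 : R42} {s : M → R42} {U : Set M} {σ₁ σ₂ : M → R42}
  {X Y : ∀ y : M, TangentSpace (𝓡 2) y} {a b : M → ℝ}

theorem IsConservedFrame.ne_zero (h : IsConservedFrame f η μ 𝔭 s U σ₁ σ₂ X Y a b) {y : M}
    (hy : y ∈ U) : s y ≠ 0 := by
  intro h0
  rw [h.eq y hy] at h0
  exact h.coeff₁ y hy (LinearIndependent.pair_iff.1 (h.frame.indep y hy) _ _ h0).1

theorem IsConservedFrame.mem (h : IsConservedFrame f η μ 𝔭 s U σ₁ σ₂ X Y a b) {y : M}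
    (hy : y ∈ U) : s y ∈ f y := by
  rw [h.eq y hy]
  exact (f y).add_mem ((f y).smul_mem _ (h.frame.section₁.mem y hy))
    ((f y).smul_mem _ (h.frame.section₂.mem y hy))

theorem IsConservedFrame.mem_span (h : IsConservedFrame f η μ 𝔭 s U σ₁ σ₂ X Y a b)
    (hf : IsLegendre f) {y : M} (hy : y ∈ U) {v : R42} (hv : v ∈ f y) (hvp : form v 𝔭 = 0) :
    v ∈ Submodule.span ℝ {s y} := by
  rw [h.frame.span_eq hf hy] at hv
  obtain ⟨c, d, rfl⟩ := Submodule.mem_span_pair.1 hv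
  have h1 : c * form (σ₁ y) 𝔭 + d * form (σ₂ y) 𝔭 = 0 := by simpa using hvp
  have h2 := h.orth y hy
  have ha := h.coeff₁ y hy
  have hn := h.ne₂ y hy
  refine Submodule.mem_span_singleton.2 ⟨c / a y, ?_⟩
  rw [h.eq y hy, smul_add, smul_smul, smul_smul, div_mul_cancel₀ _ ha]
  congr 2
  rw [div_mul_eq_mul_div, div_eq_iff ha]
  refine mul_right_cancel₀ hn ?_
  linear_combination c * h2 - a y * h1

/-- The local sections of the curvature spheres that diagonalise the quadratic differential. -/
theorem IsConservedFrame.exists_isothermic (h : IsConservedFrame f η μ 𝔭 s U σ₁ σ₂ X Y a b)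
    (hf : IsLegendre f) (hU : IsOpen U) {x : M} (hx : x ∈ U)
    (hpos : 0 < a x * form (σ₁ x) 𝔭) :
    ∃ U : Set M, IsOpen U ∧ x ∈ U ∧ ∃ σ₁ σ₂ : M → R42,
      IsSectionOn f U σ₁ ∧ IsSectionOn f U σ₂ ∧
      ∀ y ∈ U, LinearIndependent ℝ ![σ₁ y, σ₂ y] ∧
        IsCurvatureSphere f y (Submodule.span ℝ {σ₁ y}) ∧
        IsCurvatureSphere f y (Submodule.span ℝ {σ₂ y}) ∧
        (∀ X Y : TangentSpace (𝓡 2) y, quadDiff f η y X Y =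
          form (dAt σ₁ y X) (dAt σ₁ y Y) - form (dAt σ₂ y X) (dAt σ₂ y Y)) ∧
        Submodule.span ℝ {s y} = Submodule.span ℝ {σ₁ y + σ₂ y} := by
  have hg : SmoothOn (fun y => a y * form (σ₁ y) 𝔭) U :=
    h.smooth₁.mul (h.frame.section₁.smoothOn.form contMDiffOn_const)
  have hV := hg.isOpen_pos hU
  set V := U ∩ {y | 0 < a y * form (σ₁ y) 𝔭} with hVdef
  have hVU : V ⊆ U := Set.inter_subset_left
  replace h := h.mono hVU
  have hF := h.frame
  -- Normalised by `ρ² a (σ₁,𝔭) = 1`, hence `ρ² b (σ₂,𝔭) = -1`. Then `a / (σ₁,𝔭) = (ρa)²` and `b /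
  -- (σ₂,𝔭) = -(ρb)²`, and the rescaled sections `ρa σ₁`, `ρb σ₂` add up to `ρ s`.
  set ρ : M → ℝ := fun y => (Real.sqrt (a y * form (σ₁ y) 𝔭))⁻¹ with hρ
  have hpos' : ∀ y ∈ V, 0 < a y * form (σ₁ y) 𝔭 := fun y hy => hy.2
  have hρs : SmoothOn ρ V := ((hg.mono hVU).sqrt fun y hy => (hpos' y hy).ne').inv
    fun y hy => (Real.sqrt_pos.2 (hpos' y hy)).ne'
  have hρ0 : ∀ y ∈ V, ρ y ≠ 0 := fun y hy => inv_ne_zero (Real.sqrt_pos.2 (hpos' y hy)).ne'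
  have hρ2 : ∀ y ∈ V, ρ y * ρ y * (a y * form (σ₁ y) 𝔭) = 1 := fun y hy => by
    have h1 := Real.mul_self_sqrt (hpos' y hy).le
    have h2 := (Real.sqrt_pos.2 (hpos' y hy)).ne'
    simp only [hρ]
    conv_lhs => rw [← h1]
    field_simp
    rw [Real.sqrt_sq (Real.sqrt_nonneg _)]
  -- A null section orthogonal to its derivatives has a conformally covariant metric: the terms with
  -- `dg` drop out.
  have hdd : ∀ (g : M → ℝ) (σ : M → R42), SmoothOn g V → IsSectionOn f V σ → ∀ y ∈ V,
      ∀ Z W : TangentSpace (𝓡 2) y, form (dAt (fun y => g y • σ y) y Z)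
        (dAt (fun y => g y • σ y) y W) = g y * g y * form (dAt σ y Z) (dAt σ y W) := by
    intro g σ hg hσ y hy Z W
    have e1 : ∀ Z, form (σ y) (dAt σ y Z) = 0 := fun Z =>
      hf.dAt_mem_perp hV hy hσ Z _ (hσ.mem y hy)
    rw [dAt_smul (hg.mdifferentiableAt hV hy) (hσ.smoothOn.mdifferentiableAt hV hy),
      dAt_smul (hg.mdifferentiableAt hV hy) (hσ.smoothOn.mdifferentiableAt hV hy)]
    simp only [map_add, map_smul, LinearMap.add_apply, LinearMap.smul_apply, e1,
      form_comm (dAt σ y Z) (σ y), hf.form_eq_zero (hσ.mem y hy) (hσ.mem y hy), smul_eq_mul]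
    ring
  refine ⟨V, hV, ⟨hx, hpos⟩, fun y => (ρ y * a y) • σ₁ y, fun y => (ρ y * b y) • σ₂ y,
    IsSectionOn.smul (hρs.mul h.smooth₁) hF.section₁,
    IsSectionOn.smul (hρs.mul h.smooth₂) hF.section₂, fun y hy => ⟨?_, ?_, ?_, ?_, ?_⟩⟩
  · rw [LinearIndependent.pair_iff]
    intro c d hcd
    rw [smul_smul, smul_smul] at hcd
    obtain ⟨h1, h2⟩ := LinearIndependent.pair_iff.1 (hF.indep y hy) _ _ hcd
    exact ⟨(mul_eq_zero.1 h1).resolve_right (mul_ne_zero (hρ0 y hy) (h.coeff₁ y hy)),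
      (mul_eq_zero.1 h2).resolve_right (mul_ne_zero (hρ0 y hy) (h.coeff₂ y hy))⟩
  · exact hF.isCurvatureSphere hf hV hy (mul_ne_zero (hρ0 y hy) (h.coeff₁ y hy))
  · exact hF.swap.isCurvatureSphere hf hV hy (mul_ne_zero (hρ0 y hy) (h.coeff₂ y hy))
  · intro Z W
    have n1 := h.ne₁ y hy
    have n2 := h.ne₂ y hy
    have q := hρ2 y hy
    have o := h.orth y hy
    rw [h.quad y hy, hdd (fun y => ρ y * a y) σ₁ (hρs.mul h.smooth₁) hF.section₁ y hy,
      hdd (fun y => ρ y * b y) σ₂ (hρs.mul h.smooth₂) hF.section₂ y hy]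
    have c1 : a y / form (σ₁ y) 𝔭 = ρ y * a y * (ρ y * a y) := by
      rw [div_eq_iff n1]
      linear_combination (- a y) * q
    have c2 : b y / form (σ₂ y) 𝔭 = - (ρ y * b y * (ρ y * b y)) := by
      rw [div_eq_iff n2]
      linear_combination (- b y) * q + (b y * ρ y * ρ y) * o
    rw [c1, c2]
    ring
  · have : (ρ y * a y) • σ₁ y + (ρ y * b y) • σ₂ y = ρ y • s y := by
      rw [h.eq y hy]; module
    rw [this, Submodule.span_singleton_smul_eq (IsUnit.mk0 _ (hρ0 y hy))]

end

/-- The surface is spanned by the top coefficient of `p`. Its closed form is `μ - dτ` with `τ𝔭 =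
-p₁`, chosen so that `𝔭` is killed as well as `f`. -/
theorem IsLinearNormConstant.conclusion {η μ : OneForm M} {𝔭 : R42} {p : Fin 2 → M → R42}
    (h : IsLinearNormConstant f η μ p 𝔭) (hf : IsLegendre f) :
    ∃ s : M → Submodule ℝ R42, IsIsothermicSphereCongruence f η s ∧
      (∀ x, s x ≤ perp (Submodule.span ℝ {𝔭})) ∧
      IsIsothermicSurface 𝔭 s ∧ IsLegendreLift 𝔭 f s := by
  have hs := h.isConservedSection hf
  have hne : ∀ x, p 1 x ≠ 0 := fun x => by
    obtain ⟨U, hU, hx, σ₁, σ₂, X, Y, a, b, hF⟩ := h.exists_frame hf x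
    exact hF.ne_zero hx
  have hmem : ∀ x, p 1 x ∈ f x := fun x => by
    obtain ⟨U, hU, hx, σ₁, σ₂, X, Y, a, b, hF⟩ := h.exists_frame hf x
    exact hF.mem hx
  have hspan : ∀ x, ∀ v ∈ f x, form v 𝔭 = 0 → v ∈ Submodule.span ℝ {p 1 x} := fun x => by
    obtain ⟨U, hU, hx, σ₁, σ₂, X, Y, a, b, hF⟩ := h.exists_frame hf x
    exact fun v => hF.mem_span hf hx
  have hnp : ∀ x, ∃ v ∈ f x, form v 𝔭 ≠ 0 := fun x => by
    obtain ⟨U, hU, hx, σ₁, σ₂, X, Y, a, b, hF⟩ := h.exists_frame hf x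
    exact ⟨σ₁ x, hF.frame.section₁.mem x hx, hF.ne₁ x hx⟩
  have hperp : ∀ x, Submodule.span ℝ {p 1 x} ≤ perp (Submodule.span ℝ {𝔭}) := fun x => by
    rw [Submodule.span_le, Set.singleton_subset_iff]
    exact mem_perp_span_singleton.2 (hs.orth x)
  have hle : ∀ x, Submodule.span ℝ {p 1 x} ≤ f x := fun x => by
    rw [Submodule.span_le, Set.singleton_subset_iff]; exact hmem x
  have hlift : ∀ x, Submodule.span ℝ {p 1 x} = f x ⊓ perp (Submodule.span ℝ {𝔭}) := fun x =>
    le_antisymm (le_inf (hle x) (hperp x))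
      fun v hv => hspan x v hv.1 (mem_perp_span_singleton.1 hv.2)
  have hsub := isSubbundle_span_singleton hs.smooth hne
  have hsec : IsSectionOn (fun x => Submodule.span ℝ {p 1 x}) Set.univ (p 1) :=
    ⟨hs.smooth.contMDiffOn, fun y _ => Submodule.mem_span_singleton_self _⟩
  have hsecf : IsSectionOn f Set.univ (p 1) := ⟨hs.smooth.contMDiffOn, fun y _ => hmem y⟩
  refine ⟨fun x => Submodule.span ℝ {p 1 x}, ⟨hsub, fun x => ?_⟩, hperp, ⟨hsub, ?_, hperp, ?_, ?_⟩,
    hf, hlift⟩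
  · obtain ⟨U, hU, hx, σ₁, σ₂, X, Y, a, b, hF⟩ := h.exists_frame hf x
    -- The numbers `a (σ₁,𝔭)` and `b (σ₂,𝔭)` are opposite and non-zero; the order of the curvature
    -- spheres is chosen to make the first positive.
    rcases lt_or_gt_of_ne (mul_ne_zero (hF.coeff₁ x hx) (hF.ne₁ x hx)) with hlt | hgt
    · exact hF.swap.exists_isothermic hf hU hx (by linarith [hF.orth x hx])
    · exact hF.exists_isothermic hf hU hx hgt
  · intro x
    exact (hle x).trans ((hf.isotropic x).trans fun v hv w hw => hv w (hle x hw))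
  · intro x Z hZ
    obtain ⟨U, hU, hx, σ₁, σ₂, X, Y, a, b, hF⟩ := h.exists_frame hf x
    have h1 := hZ (p 1 x) (Submodule.mem_span_singleton_self _) Set.univ (p 1) isOpen_univ
      (Set.mem_univ x) hsec rfl
    exact hF.frame.immersive_section hf hU hx isOpen_univ (Set.mem_univ x) hsecf (hF.eq x hx)
      (hF.coeff₁ x hx) (hF.coeff₂ x hx) (hle x h1)
  · obtain ⟨τ, hτ, hτf, hτv⟩ := exists_bivector hf.subbundle (s := fun x => - p 1 x) hs.smooth.neg
      (fun x => (f x).neg_mem (hmem x)) hnp (fun x v hv hvp => by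
        obtain ⟨c, hc⟩ := Submodule.mem_span_singleton.1 (hspan x v hv hvp)
        exact Submodule.mem_span_singleton.2 ⟨-c, by simp [hc]⟩)
    have hτp : ∀ x, τ x 𝔭 = - p 1 x := fun x => by
      obtain ⟨v, hv, hn⟩ := hnp x
      rw [hτv x ((form v 𝔭)⁻¹ • v) ((f x).smul_mem _ hv) (by simp [hn]), wedge_apply]
      simp [hn, hs.orth x]
    have hdτp : ∀ x Z, dAt τ x Z 𝔭 = μ x Z 𝔭 := fun x Z => by
      have hc : MDifferentiableAt (𝓡 2) 𝓘(ℝ, R42) (fun _ : M => 𝔭) x := mdifferentiableAt_const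
      have h1 := dAt_clm_apply ((hτ x).mdifferentiableAt (by simp)) hc Z
      rw [dAt_const] at h1
      have h2 : (fun y => τ y 𝔭) = fun y => (-1 : ℝ) • p 1 y := funext fun y => by simp [hτp]
      have hc' : MDifferentiableAt (𝓡 2) 𝓘(ℝ, ℝ) (fun _ : M => (-1 : ℝ)) x :=
        mdifferentiableAt_const
      rw [h2, dAt_smul hc' ((hs.smooth x).mdifferentiableAt (by simp)), dAt_const,
        hs.dAt_eq] at h1
      simpa using h1.symm
    have hval : ∀ x Z, ∃ ξ ∈ derived (fun x => Submodule.span ℝ {p 1 x}) x,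
        μ x Z - dAt τ x Z = wedge (p 1 x) ξ := by
      intro x Z
      obtain ⟨U, hU, hx, σ₁, σ₂, X, Y, a, b, hF⟩ := h.exists_frame hf x
      obtain ⟨v, hv, hn⟩ := hnp x
      have hv1 : form ((form v 𝔭)⁻¹ • v) 𝔭 = 1 := by simp [hn]
      have hvf := (f x).smul_mem (form v 𝔭)⁻¹ hv
      set v' := (form v 𝔭)⁻¹ • v
      have hind : LinearIndependent ℝ ![p 1 x, v'] := by
        rw [LinearIndependent.pair_iff' (hne x)]
        intro c hc
        rw [← hc] at hv1
        simp [hs.orth x] at hv1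
      have hfs := hf.span_eq (hmem x) hvf hind
      have had : IsAdapted (f x) (μ x Z - dAt τ x Z) :=
        (hs.adapted x Z).sub (isAdapted_dAt hf hτ hτf x Z)
      rw [hfs] at had
      obtain ⟨ξ, hξ, hξp, heq⟩ := had.eq_wedge (hne x) (hs.orth x) hv1
        (by rw [sub_apply, hdτp, sub_self])
      rw [← hfs] at hξ
      exact ⟨ξ, hF.frame.mem_derived hf hU hx isOpen_univ (Set.mem_univ x) (fun x _ => hlift x) hsec
        (hF.eq x hx) (hF.coeff₁ x hx) (hF.coeff₂ x hx) le_rfl hξ hξp, heq⟩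
    refine ⟨fun x => μ x - dAt τ x, hs.closed.sub_dAt hτ fun x => rfl, fun x Z => ?_, ?_⟩
    · obtain ⟨ξ, hξ, heq⟩ := hval x Z
      change μ x Z - dAt τ x Z ∈ _
      rw [heq]
      exact wedge_mem_wedgeSpan (Submodule.mem_span_singleton_self _) hξ
    · obtain ⟨x, -⟩ := h.conserved.degree
      refine ⟨x, fun h0 => ?_⟩
      obtain ⟨U, hU, hx, σ₁, σ₂, X, Y, a, b, hF⟩ := h.exists_frame hf x
      obtain ⟨A, hA, hA2⟩ := hF.mid₂ x hx
      -- On `e₂` the middle potential gives a non-zero multiple of `σ₂` and `dτ` a multiple of `σ₁`;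
      -- they cannot cancel.
      obtain ⟨k, hk⟩ := hF.frame.dAt_apply_e hf hU hx hτ hτf
      have h1 : μ x (X x) (dAt σ₂ x (X x)) - dAt τ x (X x) (dAt σ₂ x (X x)) = 0 :=
        DFunLike.congr_fun (DFunLike.congr_fun h0 (X x)) (dAt σ₂ x (X x))
      rw [hA2, hk] at h1
      have h2 : (-k) • σ₁ x + A • σ₂ x = 0 := by rw [← h1]; module
      exact hA (LinearIndependent.pair_iff.1 (hF.frame.indep x hx) _ _ h2).2

end Conclusion

end LieSphere

end

/-! ### Smooth normalised curvature frames of a Legendre lift -/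

noncomputable section

namespace LieSphere

/-- A non-zero Gram determinant makes `⟨e₁, e₂⟩` a complement of `W` in `W^⊥`. A vector orthogonal
to it and to `W` is null, hence in `W`. Unlike in a curvature frame, the `eᵢ` need not be
orthogonal. -/
theorem mem_of_orthogonal {W : Submodule ℝ R42} (hW : Module.finrank ℝ W = 2) (hiso : W ≤ perp W)
    {e₁ e₂ w : R42} (h₁ : e₁ ∈ perp W) (h₂ : e₂ ∈ perp W) (hw : w ∈ perp W)
    (hdet : form e₁ e₁ * form e₂ e₂ - form e₁ e₂ * form e₁ e₂ ≠ 0)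
    (o₁ : form w e₁ = 0) (o₂ : form w e₂ = 0) : w ∈ W := by
  have key : ∀ c d : ℝ, form (c • e₁ + d • e₂) e₁ = 0 → form (c • e₁ + d • e₂) e₂ = 0 →
      c = 0 ∧ d = 0 := by
    intro c d q1 q2
    simp only [map_add, map_smul, LinearMap.add_apply, LinearMap.smul_apply, smul_eq_mul,
      form_comm e₂ e₁] at q1 q2
    constructor
    · refine (mul_eq_zero.1 (?_ : c * (form e₁ e₁ * form e₂ e₂ - form e₁ e₂ * form e₁ e₂) = 0)
        ).resolve_right hdet
      linear_combination form e₂ e₂ * q1 - form e₁ e₂ * q2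
    · refine (mul_eq_zero.1 (?_ : d * (form e₁ e₁ * form e₂ e₂ - form e₁ e₂ * form e₁ e₂) = 0)
        ).resolve_right hdet
      linear_combination form e₁ e₁ * q2 - form e₁ e₂ * q1
  have hdis : Disjoint W (Submodule.span ℝ {e₁, e₂}) := by
    rw [Submodule.disjoint_def]
    intro v hv hv'
    obtain ⟨c, d, rfl⟩ := Submodule.mem_span_pair.1 hv'
    obtain ⟨rfl, rfl⟩ := key c d (h₁ _ hv) (h₂ _ hv)
    simp
  have hind : LinearIndependent ℝ ![e₁, e₂] := by
    rw [LinearIndependent.pair_iff]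
    intro c d hcd
    exact key c d (by rw [hcd]; simp) (by rw [hcd]; simp)
  have hr := finrank_span_eq_card hind
  rw [Matrix.range_cons, Matrix.range_cons, Matrix.range_empty, Set.union_empty,
    Set.singleton_union] at hr
  have hle : W ⊔ Submodule.span ℝ {e₁, e₂} ≤ perp W := by
    refine sup_le hiso ?_
    rw [Submodule.span_le]
    rintro v (rfl | rfl) <;> assumption
  have hsum := Submodule.finrank_sup_add_finrank_inf_eq W (Submodule.span ℝ {e₁, e₂})
  rw [disjoint_iff.1 hdis, finrank_bot, hr, hW] at hsum
  have hp := finrank_perp_add W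
  rw [hW] at hp
  have heq := Submodule.eq_of_le_of_finrank_eq hle (by simp at hsum; omega)
  have hw' := hw
  rw [← heq] at hw'
  obtain ⟨v, hv, u, hu, huv⟩ := Submodule.mem_sup.1 hw'
  obtain ⟨c, d, rfl⟩ := Submodule.mem_span_pair.1 hu
  refine (form_self_nonneg hW hiso hw).2 ?_
  have hv0 : form w v = 0 := by rw [form_comm]; exact hw v hv
  nth_rewrite 2 [← huv]
  simp [hv0, o₁, o₂]

section NormalizedFrames

variable {M : Type*} [TopologicalSpace M] [ChartedSpace (EuclideanSpace ℝ (Fin 2)) M]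
variable {f : M → Submodule ℝ R42}

/-- A singular symmetric matrix field has a smooth kernel field where it does not vanish. -/
theorem exists_kernel_field {U : Set M} (hU : IsOpen U) {p q r : M → ℝ} (hp : SmoothOn p U)
    (hq : SmoothOn q U) (hr : SmoothOn r U) (hdet : ∀ y ∈ U, p y * r y = q y * q y) {x : M}
    (hx : x ∈ U) (h0 : ¬ (p x = 0 ∧ q x = 0 ∧ r x = 0)) :
    ∃ V ⊆ U, IsOpen V ∧ x ∈ V ∧ ∃ u v : M → ℝ, SmoothOn u V ∧ SmoothOn v V ∧ ∀ y ∈ V,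
      ¬ (u y = 0 ∧ v y = 0) ∧ p y * u y + q y * v y = 0 ∧ q y * u y + r y * v y = 0 := by
  -- A non-zero singular symmetric matrix has a non-zero diagonal entry. The kernel is spanned by
  -- `(-q, p)` where `p ≠ 0`, and by `(r, -q)` where `r ≠ 0`.
  by_cases hpx : p x = 0
  · have hrx : r x ≠ 0 := fun hrx => h0 ⟨hpx, by
      have := hdet x hx
      rw [hpx, zero_mul, eq_comm, mul_self_eq_zero] at this
      exact this, hrx⟩
    refine ⟨_, Set.inter_subset_left, hr.isOpen_ne_zero hU, ⟨hx, hrx⟩, r, fun y => - q y,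
      hr.mono Set.inter_subset_left, (hq.mono Set.inter_subset_left).neg, fun y hy =>
      ⟨fun h => hy.2 h.1, ?_, by ring⟩⟩
    linear_combination hdet y hy.1
  · refine ⟨_, Set.inter_subset_left, hp.isOpen_ne_zero hU, ⟨hx, hpx⟩, fun y => - q y, p,
      (hq.mono Set.inter_subset_left).neg, hp.mono Set.inter_subset_left, fun y hy =>
      ⟨fun h => hy.2 h.2, by ring, ?_⟩⟩
    linear_combination hdet y hy.1

/-- Sections of `f` adapted to the conformal geometry of `⟨𝔭⟩^⊥`. -/
structure IsPointFrame (f : M → Submodule ℝ R42) (𝔭 : R42) (U : Set M) (σ ς : M → R42) :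
    Prop where
  point : IsSectionOn f U σ
  sphere : IsSectionOn f U ς
  ne_zero : ∀ y ∈ U, σ y ≠ 0
  form_point : ∀ y ∈ U, form (σ y) 𝔭 = 0
  form_sphere : ∀ y ∈ U, form (ς y) 𝔭 = 1
  immersed : ∀ y ∈ U, ∀ Z, dAt σ y Z ∈ f y → Z = 0

theorem IsPointFrame.mono {𝔭 : R42} {U V : Set M} {σ ς : M → R42} (h : IsPointFrame f 𝔭 U σ ς)
    (hV : V ⊆ U) : IsPointFrame f 𝔭 V σ ς where
  point := h.point.mono hV
  sphere := h.sphere.mono hV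
  ne_zero y hy := h.ne_zero y (hV hy)
  form_point y hy := h.form_point y (hV hy)
  form_sphere y hy := h.form_sphere y (hV hy)
  immersed y hy := h.immersed y (hV hy)

theorem IsPointFrame.indep {𝔭 : R42} {U : Set M} {σ ς : M → R42} (h : IsPointFrame f 𝔭 U σ ς)
    {y : M} (hy : y ∈ U) : LinearIndependent ℝ ![σ y, ς y] := by
  rw [LinearIndependent.pair_iff' (h.ne_zero y hy)]
  intro c hc
  have := h.form_sphere y hy
  rw [← hc] at this
  simp [h.form_point y hy] at this

theorem form_dAt_eq_zero {𝔭 : R42} {U : Set M} (hU : IsOpen U) {σ : M → R42} (hσ : SmoothOn σ U)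
    {c : ℝ} (hc : ∀ y ∈ U, form (σ y) 𝔭 = c) {y : M} (hy : y ∈ U) (Z : TangentSpace (𝓡 2) y) :
    form (dAt σ y Z) 𝔭 = 0 := by
  have hc' : MDifferentiableAt (𝓡 2) 𝓘(ℝ, R42) (fun _ : M => 𝔭) y := mdifferentiableAt_const
  have h1 := dAt_form (hσ.mdifferentiableAt hU hy) hc' Z
  rw [dAt_congr_on hU hy hc, dAt_const, dAt_const] at h1
  simpa using h1.symm

/-- If `f x` were orthogonal to `𝔭`, the line `Λ x` would be the whole plane `f x`. -/
theorem exists_form_ne_zero (hf : IsLegendre f) {Λ : M → Submodule ℝ R42} {𝔭 : R42}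
    (hsub : IsSubbundle 1 Λ) (hΛ : ∀ x, Λ x = f x ⊓ perp (Submodule.span ℝ {𝔭})) (x : M) :
    ∃ v ∈ f x, form v 𝔭 ≠ 0 := by
  by_contra! hcon
  have h1 : Λ x = f x := by
    rw [hΛ x, inf_eq_left]
    exact fun v hv => mem_perp_span_singleton.2 (hcon v hv)
  obtain ⟨U, hU, hx, e, he, hspan⟩ := hsub x
  have h2 := finrank_span_eq_card (hspan x hx).1
  rw [← (hspan x hx).2, h1, hf.subbundle.finrank_eq] at h2
  simp at h2

/-- Immersivity of `Λ` is a statement modulo `Λ`, the frame needs it modulo `f`. They agree because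
derivatives of sections of `Λ` stay orthogonal to `𝔭`, and `f ∩ 𝔭^⊥ = Λ`. -/
theorem exists_pointFrame (hf : IsLegendre f) {Λ : M → Submodule ℝ R42} {𝔭 : R42}
    (hsub : IsSubbundle 1 Λ) (hΛ : ∀ x, Λ x = f x ⊓ perp (Submodule.span ℝ {𝔭}))
    (himm : IsImmersive Λ) (x : M) :
    ∃ U : Set M, IsOpen U ∧ x ∈ U ∧ ∃ σ ς : M → R42, IsPointFrame f 𝔭 U σ ς := by
  obtain ⟨v, hv, hvp⟩ := exists_form_ne_zero hf hsub hΛ x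
  obtain ⟨U₁, hU₁, hx₁, ς, hς, hς1⟩ := exists_section_form_eq_one hf.subbundle hv hvp
  obtain ⟨U₂, hU₂, hx₂, e, he, hspan⟩ := hsub x
  have hsec : IsSectionOn f U₂ (e 0) := ⟨(he 0).smooth, fun y hy => by
    have := (he 0).mem y hy
    rw [hΛ] at this
    exact this.1⟩
  have hp : ∀ y ∈ U₂, form (e 0 y) 𝔭 = 0 := fun y hy => by
    have := (he 0).mem y hy
    rw [hΛ] at this
    exact mem_perp_span_singleton.1 this.2
  refine ⟨U₁ ∩ U₂, hU₁.inter hU₂, ⟨hx₁, hx₂⟩, e 0, ς, hsec.mono Set.inter_subset_right,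
    hς.mono Set.inter_subset_left, fun y hy => (hspan y hy.2).1.ne_zero 0,
    fun y hy => hp y hy.2, fun y hy => hς1 y hy.1, fun y hy Z hZ => ?_⟩
  refine himm y Z fun v hv V σ' hV hyV hσ' hv' => ?_
  rw [(hspan y hy.2).2, Set.range_unique, Submodule.mem_span_singleton] at hv
  obtain ⟨c, hc⟩ := hv
  have hsec' : IsSectionOn f V σ' := ⟨hσ'.smooth, fun y hy => by
    have := hσ'.mem y hy
    rw [hΛ] at this
    exact this.1⟩
  have hp' : ∀ y ∈ V, form (σ' y) 𝔭 = 0 := fun y hy => by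
    have := hσ'.mem y hy
    rw [hΛ] at this
    exact mem_perp_span_singleton.1 this.2
  rw [hΛ y]
  refine ⟨?_, mem_perp_span_singleton.2 (form_dAt_eq_zero hV hσ'.smoothOn hp' hyV Z)⟩
  have h1 := dAt_linear_mod hf.subbundle hU₂ hV hy.2 hyV hsec hsec hsec' (a := c) (b := 0)
    (by rw [hv', ← hc]; simp) Z
  have h2 := (f y).add_mem h1 ((f y).smul_mem c hZ)
  rwa [zero_smul, add_zero, sub_add_cancel] at h2

section

variable {𝔭 : R42} {U : Set M} {σ ς : M → R42} {A B : ∀ y : M, TangentSpace (𝓡 2) y}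

theorem IsPointFrame.gram_pos (h : IsPointFrame f 𝔭 U σ ς) (hf : IsLegendre f) (hU : IsOpen U)
    {y : M} (hy : y ∈ U) (hAB : LinearIndependent ℝ ![A y, B y]) :
    0 < form (dAt σ y (A y)) (dAt σ y (A y)) * form (dAt σ y (B y)) (dAt σ y (B y)) -
      form (dAt σ y (A y)) (dAt σ y (B y)) * form (dAt σ y (A y)) (dAt σ y (B y)) := by
  have hpos : ∀ u v : ℝ, ¬ (u = 0 ∧ v = 0) → 0 < form (dAt σ y (u • A y + v • B y))
      (dAt σ y (u • A y + v • B y)) := fun u v huv =>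
    form_self_pos (hf.subbundle.finrank_eq y) (hf.isotropic y) (hf.dAt_mem_perp hU hy h.point _)
      fun hmem => huv (LinearIndependent.pair_iff.1 hAB u v (h.immersed y hy _ hmem))
  have h1 := hpos 1 0 (by simp)
  simp only [one_smul, zero_smul, add_zero] at h1
  -- With `E`, `F`, `G` the coefficients of the metric of `σ`, the vector `-F A + E B` has square
  -- length `E (EG - F²)`.
  have h2 := hpos (- form (dAt σ y (A y)) (dAt σ y (B y))) (form (dAt σ y (A y)) (dAt σ y (A y)))
    (fun h => h1.ne' h.2)
  simp only [map_add, map_smul, LinearMap.add_apply, LinearMap.smul_apply, smul_eq_mul,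
    form_comm (dAt σ y (B y)) (dAt σ y (A y))] at h2
  refine pos_of_mul_pos_right (?_ : 0 < form (dAt σ y (A y)) (dAt σ y (A y)) * _) h1.le
  nlinarith [h2]

variable [IsManifold (𝓡 2) ∞ M]

theorem SmoothVF.smul_add_smul {U : Set M} {u v : M → ℝ} {X Y : ∀ y : M, TangentSpace (𝓡 2) y}
    (hu : SmoothOn u U) (hX : SmoothVF X U) (hv : SmoothOn v U) (hY : SmoothVF Y U) :
    SmoothVF (fun y => u y • X y + v y • Y y) U :=
  (ContMDiffOn.smul_section hu hX).add_section (ContMDiffOn.smul_section hv hY)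

/-- The curvature condition for the sphere `ς + k σ` in terms of the two fundamental forms. -/
theorem IsPointFrame.mem_iff (h : IsPointFrame f 𝔭 U σ ς) (hf : IsLegendre f) (hU : IsOpen U)
    (hA : SmoothVF A U) (hB : SmoothVF B U)
    {y : M} (hy : y ∈ U) (hAB : LinearIndependent ℝ ![A y, B y]) (k u v : ℝ) :
    dAt ς y (u • A y + v • B y) + k • dAt σ y (u • A y + v • B y) ∈ f y ↔
      (form (dAt ς y (A y)) (dAt σ y (A y)) + k * form (dAt σ y (A y)) (dAt σ y (A y))) * u +
        (form (dAt ς y (A y)) (dAt σ y (B y)) + k * form (dAt σ y (A y)) (dAt σ y (B y))) * v = 0 ∧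
      (form (dAt ς y (A y)) (dAt σ y (B y)) + k * form (dAt σ y (A y)) (dAt σ y (B y))) * u +
        (form (dAt ς y (B y)) (dAt σ y (B y)) + k * form (dAt σ y (B y)) (dAt σ y (B y))) * v = 0 := by
  have hsym := hf.form_dAt_comm hU hy h.sphere h.point hA hB
  have pA := hf.dAt_mem_perp hU hy h.point (A y)
  have pB := hf.dAt_mem_perp hU hy h.point (B y)
  have eA : form (dAt ς y (u • A y + v • B y) + k • dAt σ y (u • A y + v • B y)) (dAt σ y (A y)) =
      (form (dAt ς y (A y)) (dAt σ y (A y)) + k * form (dAt σ y (A y)) (dAt σ y (A y))) * u +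
        (form (dAt ς y (A y)) (dAt σ y (B y)) + k * form (dAt σ y (A y)) (dAt σ y (B y))) * v := by
    simp only [map_add, map_smul, LinearMap.add_apply, LinearMap.smul_apply, smul_eq_mul,
      form_comm (dAt σ y (B y)) (dAt σ y (A y)), hsym]
    ring
  have eB : form (dAt ς y (u • A y + v • B y) + k • dAt σ y (u • A y + v • B y)) (dAt σ y (B y)) =
      (form (dAt ς y (A y)) (dAt σ y (B y)) + k * form (dAt σ y (A y)) (dAt σ y (B y))) * u +
        (form (dAt ς y (B y)) (dAt σ y (B y)) + k * form (dAt σ y (B y)) (dAt σ y (B y))) * v := by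
    simp only [map_add, map_smul, LinearMap.add_apply, LinearMap.smul_apply, smul_eq_mul]
    ring
  rw [← eA, ← eB]
  refine ⟨fun hm => ⟨pA _ hm, pB _ hm⟩, fun hm => ?_⟩
  exact mem_of_orthogonal (hf.subbundle.finrank_eq y) (hf.isotropic y) pA pB
    ((perp (f y)).add_mem (hf.dAt_mem_perp hU hy h.sphere _)
      ((perp (f y)).smul_mem k (hf.dAt_mem_perp hU hy h.point _)))
    (h.gram_pos hf hU hy hAB).ne' hm.1 hm.2

/-- Immersivity keeps the point sphere `σ` from being a curvature sphere, so a curvature sphere is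
`ς + k σ`. Its curvature direction is a kernel vector of the second fundamental form plus `k` times
the first, whose determinant vanishes. -/
theorem IsPointFrame.exists_root (h : IsPointFrame f 𝔭 U σ ς) (hf : IsLegendre f) (hU : IsOpen U)
    (hA : SmoothVF A U) (hB : SmoothVF B U)
    {y : M} (hy : y ∈ U) (hAB : LinearIndependent ℝ ![A y, B y]) {s : Submodule ℝ R42}
    (hs : IsCurvatureSphere f y s) : ∃ k : ℝ, s = Submodule.span ℝ {ς y + k • σ y} ∧
      (form (dAt ς y (A y)) (dAt σ y (A y)) + k * form (dAt σ y (A y)) (dAt σ y (A y))) *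
        (form (dAt ς y (B y)) (dAt σ y (B y)) + k * form (dAt σ y (B y)) (dAt σ y (B y))) =
      (form (dAt ς y (A y)) (dAt σ y (B y)) + k * form (dAt σ y (A y)) (dAt σ y (B y))) *
        (form (dAt ς y (A y)) (dAt σ y (B y)) + k * form (dAt σ y (A y)) (dAt σ y (B y))) := by
  obtain ⟨hsf, hrank, T, hT, hTs⟩ := hs
  obtain ⟨X, hXT, hX⟩ := T.exists_mem_ne_zero_of_ne_bot hT
  obtain ⟨v, hv0, hv⟩ := finrank_eq_one_iff'.1 hrank
  have hsv : s = Submodule.span ℝ {(v : R42)} := by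
    refine le_antisymm (fun w hw => ?_) ?_
    · obtain ⟨c, hc⟩ := hv ⟨w, hw⟩
      exact Submodule.mem_span_singleton.2 ⟨c, congrArg Subtype.val hc⟩
    · rw [Submodule.span_le, Set.singleton_subset_iff]; exact v.2
  have hvf := hsf v.2
  rw [hf.span_eq (h.point.mem y hy) (h.sphere.mem y hy) (h.indep hy)] at hvf
  obtain ⟨a, b, hab⟩ := Submodule.mem_span_pair.1 hvf
  have hsec := (h.point.const_smul a).add (h.sphere.const_smul b)
  have hm := hTs X hXT v v.2 U _ hU hy hsec hab
  have hm' : a • dAt σ y X + b • dAt ς y X ∈ f y := by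
    have h1 := dAt_linear_mod hf.subbundle hU hU hy hy h.point h.sphere hsec rfl X
    have h2 := (f y).sub_mem hm h1
    rwa [sub_sub_cancel] at h2
  have hb : b ≠ 0 := by
    rintro rfl
    rw [zero_smul, add_zero] at hm' hab
    have ha : a ≠ 0 := by
      rintro rfl
      rw [zero_smul] at hab
      exact hv0 (Subtype.ext hab.symm)
    have := (f y).smul_mem a⁻¹ hm'
    rw [inv_smul_smul₀ ha] at this
    exact hX (h.immersed y hy X this)
  have hm'' : dAt ς y X + (a / b) • dAt σ y X ∈ f y := by
    have := (f y).smul_mem b⁻¹ hm'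
    rw [smul_add, smul_smul, inv_smul_smul₀ hb, add_comm, inv_mul_eq_div] at this
    exact this
  refine ⟨a / b, ?_, ?_⟩
  · rw [hsv, ← hab, show a • σ y + b • ς y = b • (ς y + (a / b) • σ y) by
      rw [smul_add, smul_smul, mul_div_cancel₀ _ hb, add_comm],
      Submodule.span_singleton_smul_eq (IsUnit.mk0 _ hb)]
  · obtain ⟨z, w, rfl⟩ := tangent_span hAB X
    obtain ⟨h1, h2⟩ := (h.mem_iff hf hU hA hB hy hAB (a / b) z w).1 hm''
    generalize form (dAt ς y (A y)) (dAt σ y (A y)) + a / b * form (dAt σ y (A y)) (dAt σ y (A y))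
      = p at h1 h2 ⊢
    generalize form (dAt ς y (A y)) (dAt σ y (B y)) + a / b * form (dAt σ y (A y)) (dAt σ y (B y))
      = q at h1 h2 ⊢
    generalize form (dAt ς y (B y)) (dAt σ y (B y)) + a / b * form (dAt σ y (B y)) (dAt σ y (B y))
      = r at h1 h2 ⊢
    by_cases hz : z = 0
    · have hw : w ≠ 0 := by rintro rfl; exact hX (by simp [hz])
      refine mul_right_cancel₀ hw ?_
      linear_combination p * h2 - q * h1
    · refine mul_right_cancel₀ hz ?_
      linear_combination r * h1 - q * h2

/-- The determinant is quadratic in `k` with leading coefficient `α = EG - F² > 0`. Two distinct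
curvature spheres give distinct roots `k`, `l`, and the discriminant is `(α (k - l))²`. -/
theorem IsPointFrame.disc_pos (h : IsPointFrame f 𝔭 U σ ς) (hf : IsLegendre f)
    (hu : IsUmbilicFree f) (hU : IsOpen U) (hA : SmoothVF A U) (hB : SmoothVF B U)
    {y : M} (hy : y ∈ U) (hAB : LinearIndependent ℝ ![A y, B y]) {E F G L N P : ℝ}
    (hE : form (dAt σ y (A y)) (dAt σ y (A y)) = E) (hF : form (dAt σ y (A y)) (dAt σ y (B y)) = F)
    (hG : form (dAt σ y (B y)) (dAt σ y (B y)) = G) (hL : form (dAt ς y (A y)) (dAt σ y (A y)) = L)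
    (hP : form (dAt ς y (A y)) (dAt σ y (B y)) = P)
    (hN : form (dAt ς y (B y)) (dAt σ y (B y)) = N) :
    0 < (E * N + G * L - 2 * F * P) * (E * N + G * L - 2 * F * P) -
      4 * (E * G - F * F) * (L * N - P * P) := by
  obtain ⟨s₁, s₂, hne, hs₁, hs₂⟩ := hu y
  obtain ⟨k, hk, rk⟩ := h.exists_root hf hU hA hB hy hAB hs₁
  obtain ⟨l, hl, rl⟩ := h.exists_root hf hU hA hB hy hAB hs₂
  have hα := h.gram_pos hf hU hy hAB
  rw [hE, hF, hG] at hα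
  rw [hE, hF, hG, hL, hP, hN] at rk rl
  have hkl : k - l ≠ 0 := fun hkl => hne (by rw [hk, hl, sub_eq_zero.1 hkl])
  have h1 : (E * G - F * F) * (k + l) + (E * N + G * L - 2 * F * P) = 0 := by
    refine mul_right_cancel₀ hkl ?_
    linear_combination rk - rl
  have h2 : (E * N + G * L - 2 * F * P) * (E * N + G * L - 2 * F * P) -
      4 * (E * G - F * F) * (L * N - P * P) = ((E * G - F * F) * (k - l)) ^ 2 := by
    linear_combination (E * N + G * L - 2 * F * P - (E * G - F * F) * (k + l) +
      4 * (E * G - F * F) * k) * h1 - 4 * (E * G - F * F) * rk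
  rw [h2]
  exact sq_pos_iff.2 (mul_ne_zero hα.ne' hkl)

/-- For a smooth root `k` the matrix is singular but, by `h0`, not zero; its kernel is then a line
field with a smooth local section. -/
theorem IsPointFrame.exists_curvature_direction (h : IsPointFrame f 𝔭 U σ ς) (hf : IsLegendre f)
    (hU : IsOpen U) (hA : SmoothVF A U) (hB : SmoothVF B U)
    (hAB : ∀ y ∈ U, LinearIndependent ℝ ![A y, B y]) {k : M → ℝ} (hk : SmoothOn k U)
    (hroot : ∀ y ∈ U,
      (form (dAt ς y (A y)) (dAt σ y (A y)) + k y * form (dAt σ y (A y)) (dAt σ y (A y))) *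
        (form (dAt ς y (B y)) (dAt σ y (B y)) + k y * form (dAt σ y (B y)) (dAt σ y (B y))) =
      (form (dAt ς y (A y)) (dAt σ y (B y)) + k y * form (dAt σ y (A y)) (dAt σ y (B y))) *
        (form (dAt ς y (A y)) (dAt σ y (B y)) + k y * form (dAt σ y (A y)) (dAt σ y (B y))))
    {x : M} (hx : x ∈ U)
    (h0 : ¬ (form (dAt ς x (A x)) (dAt σ x (A x)) + k x * form (dAt σ x (A x)) (dAt σ x (A x)) = 0 ∧
      form (dAt ς x (A x)) (dAt σ x (B x)) + k x * form (dAt σ x (A x)) (dAt σ x (B x)) = 0 ∧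
      form (dAt ς x (B x)) (dAt σ x (B x)) + k x * form (dAt σ x (B x)) (dAt σ x (B x)) = 0)) :
    ∃ V ⊆ U, IsOpen V ∧ x ∈ V ∧ ∃ X : ∀ y : M, TangentSpace (𝓡 2) y, SmoothVF X V ∧
      (∀ y ∈ V, X y ≠ 0) ∧ ∀ y ∈ V, SolderVanishes f y (X y) (ς y + k y • σ y) := by
  have sσA := SmoothOn.dirDeriv hU h.point.smoothOn hA
  have sσB := SmoothOn.dirDeriv hU h.point.smoothOn hB
  have sςA := SmoothOn.dirDeriv hU h.sphere.smoothOn hA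
  have sςB := SmoothOn.dirDeriv hU h.sphere.smoothOn hB
  obtain ⟨V, hVU, hV, hxV, u, v, su, sv, huv⟩ := exists_kernel_field hU
    (p := fun y => form (dirDeriv A ς y) (dirDeriv A σ y) +
      k y * form (dirDeriv A σ y) (dirDeriv A σ y))
    (q := fun y => form (dirDeriv A ς y) (dirDeriv B σ y) +
      k y * form (dirDeriv A σ y) (dirDeriv B σ y))
    (r := fun y => form (dirDeriv B ς y) (dirDeriv B σ y) +
      k y * form (dirDeriv B σ y) (dirDeriv B σ y))
    (ContMDiffOn.add (sςA.form sσA) (ContMDiffOn.mul hk (sσA.form sσA)))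
    (ContMDiffOn.add (sςA.form sσB) (ContMDiffOn.mul hk (sσA.form sσB)))
    (ContMDiffOn.add (sςB.form sσB) (ContMDiffOn.mul hk (sσB.form sσB))) hroot hx h0
  refine ⟨V, hVU, hV, hxV, fun y => u y • A y + v y • B y,
    SmoothVF.smul_add_smul su (ContMDiffOn.mono hA hVU) sv (ContMDiffOn.mono hB hVU),
    fun y hy h0 => (huv y hy).1 (LinearIndependent.pair_iff.1 (hAB y (hVU hy)) _ _ h0),
    fun y hy => ?_⟩
  have hyU := hVU hy
  have hsec : IsSectionOn f U (fun y => ς y + k y • σ y) := h.sphere.add (h.point.smul hk)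
  refine solderVanishes_of_mem hf.subbundle hU hyU hsec ?_
  have h1 := (h.mem_iff hf hU hA hB hyU (hAB y hyU) (k y) (u y) (v y)).2 (huv y hy).2
  have h2 := dAt_linear_mod hf.subbundle hU hU hyU hyU h.sphere h.point hsec (a := 1) (b := k y)
    (by rw [one_smul]) (u y • A y + v y • B y)
  have h3 := (f y).add_mem h2 h1
  rwa [one_smul, sub_add_cancel] at h3

end

theorem SolderVanishes.smul {y : M} {Z : TangentSpace (𝓡 2) y} {v : R42}
    (h : SolderVanishes f y Z v) (c : ℝ) : SolderVanishes f y (c • Z) v :=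
  fun U σ hU hy hσ hv => by
    rw [map_smul]
    exact (f y).smul_mem c (h U σ hU hy hσ hv)

variable [IsManifold (𝓡 2) ∞ M]

/-- A curvature frame whose curvature spheres are normalised by `(σ₁, 𝔭) = 1 = - (σ₂, 𝔭)` and whose
curvature directions have unit length for the induced metrics. -/
structure IsNormalizedFrame (f : M → Submodule ℝ R42) (𝔭 : R42) (U : Set M) (σ₁ σ₂ : M → R42)
    (X Y : ∀ y : M, TangentSpace (𝓡 2) y) : Prop where
  frame : IsCurvatureFrame f U σ₁ σ₂ X Y
  form₁ : ∀ y ∈ U, form (σ₁ y) 𝔭 = 1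
  form₂ : ∀ y ∈ U, form (σ₂ y) 𝔭 = -1
  unit₁ : ∀ y ∈ U, form (dAt σ₁ y (Y y)) (dAt σ₁ y (Y y)) = 1
  unit₂ : ∀ y ∈ U, form (dAt σ₂ y (X y)) (dAt σ₂ y (X y)) = 1

/-- Exchanging the spheres reverses the signs of their products with `𝔭`; replacing `𝔭` by `-𝔭`
restores the normalisation and makes every lemma usable for the other sphere. -/
theorem IsNormalizedFrame.swap {𝔭 : R42} {U : Set M} {σ₁ σ₂ : M → R42}
    {X Y : ∀ y : M, TangentSpace (𝓡 2) y} (h : IsNormalizedFrame f 𝔭 U σ₁ σ₂ X Y) :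
    IsNormalizedFrame f (-𝔭) U σ₂ σ₁ Y X where
  frame := h.frame.swap
  form₁ y hy := by rw [map_neg, h.form₂ y hy, neg_neg]
  form₂ y hy := by rw [map_neg, h.form₁ y hy]
  unit₁ := h.unit₂
  unit₂ := h.unit₁

theorem IsCurvatureFrame.normalize {𝔭 : R42} {U : Set M} {σ₁ σ₂ : M → R42}
    {X Y : ∀ y : M, TangentSpace (𝓡 2) y} (hF : IsCurvatureFrame f U σ₁ σ₂ X Y)
    (hf : IsLegendre f) (hU : IsOpen U) (h₁ : ∀ y ∈ U, form (σ₁ y) 𝔭 = 1)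
    (h₂ : ∀ y ∈ U, form (σ₂ y) 𝔭 = -1) :
    ∃ X Y : ∀ y : M, TangentSpace (𝓡 2) y, IsNormalizedFrame f 𝔭 U σ₁ σ₂ X Y := by
  have key : ∀ (σ : M → R42) (Z : ∀ y : M, TangentSpace (𝓡 2) y), SmoothOn σ U → SmoothVF Z U →
      (∀ y ∈ U, 0 < form (dAt σ y (Z y)) (dAt σ y (Z y))) → ∃ g : M → ℝ, SmoothOn g U ∧
        (∀ y ∈ U, g y ≠ 0) ∧
        ∀ y ∈ U, form (dAt σ y (g y • Z y)) (dAt σ y (g y • Z y)) = 1 := by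
    intro σ Z hσ hZ hpos
    have hd := SmoothOn.dirDeriv hU hσ hZ
    have hs : SmoothOn (fun y => form (dAt σ y (Z y)) (dAt σ y (Z y))) U := hd.form hd
    refine ⟨fun y => (Real.sqrt (form (dAt σ y (Z y)) (dAt σ y (Z y))))⁻¹,
      (hs.sqrt fun y hy => (hpos y hy).ne').inv fun y hy => (Real.sqrt_pos.2 (hpos y hy)).ne',
      fun y hy => inv_ne_zero (Real.sqrt_pos.2 (hpos y hy)).ne', fun y hy => ?_⟩
    have h1 := Real.mul_self_sqrt (hpos y hy).le
    have h2 := (Real.sqrt_pos.2 (hpos y hy)).ne'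
    simp only [map_smul, LinearMap.smul_apply, smul_eq_mul]
    rw [← mul_assoc, ← mul_inv, h1, inv_mul_cancel₀ (hpos y hy).ne']
  obtain ⟨g, sg, g0, g1⟩ := key σ₁ Y hF.section₁.smoothOn hF.smooth_Y fun y hy => hF.e_pos hf hU hy
  obtain ⟨k, sk, k0, k1⟩ := key σ₂ X hF.section₂.smoothOn hF.smooth_X
    fun y hy => hF.swap.e_pos hf hU hy
  exact ⟨fun y => k y • X y, fun y => g y • Y y, ⟨hF.section₁, hF.section₂,
    ContMDiffOn.smul_section sk hF.smooth_X, ContMDiffOn.smul_section sg hF.smooth_Y, hF.indep,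
    fun y hy => smul_ne_zero (k0 y hy) (hF.X_ne y hy),
    fun y hy => smul_ne_zero (g0 y hy) (hF.Y_ne y hy),
    fun y hy => (hF.curv₁ y hy).smul _, fun y hy => (hF.curv₂ y hy).smul _⟩, h₁, h₂, g1, k1⟩

/-- Umbilic-freeness provides curvature spheres only pointwise. Their smoothness comes from the
quadratic formula, whose discriminant is positive. -/
theorem exists_normalizedFrame (hf : IsLegendre f) (hu : IsUmbilicFree f)
    {Λ : M → Submodule ℝ R42} {𝔭 : R42}
    (hsub : IsSubbundle 1 Λ) (hΛ : ∀ x, Λ x = f x ⊓ perp (Submodule.span ℝ {𝔭}))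
    (himm : IsImmersive Λ) (x : M) :
    ∃ U : Set M, IsOpen U ∧ x ∈ U ∧ ∃ (σ₁ σ₂ : M → R42) (X Y : ∀ y : M, TangentSpace (𝓡 2) y),
      IsNormalizedFrame f 𝔭 U σ₁ σ₂ X Y := by
  obtain ⟨U₁, hU₁, hx₁, σ, ς, hP⟩ := exists_pointFrame hf hsub hΛ himm x
  obtain ⟨U₂, hU₂, hx₂, A, B, hA, hB, hAB⟩ := exists_coordinate_frame x
  obtain ⟨U, hU, hx, hUU₁, hUU₂⟩ : ∃ U : Set M, IsOpen U ∧ x ∈ U ∧ U ⊆ U₁ ∧ U ⊆ U₂ :=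
    ⟨U₁ ∩ U₂, hU₁.inter hU₂, ⟨hx₁, hx₂⟩, Set.inter_subset_left, Set.inter_subset_right⟩
  replace hP := hP.mono hUU₁
  replace hA : SmoothVF A U := ContMDiffOn.mono hA hUU₂
  replace hB : SmoothVF B U := ContMDiffOn.mono hB hUU₂
  replace hAB : ∀ y ∈ U, LinearIndependent ℝ ![A y, B y] := fun y hy => hAB y (hUU₂ hy)
  have sσA := SmoothOn.dirDeriv hU hP.point.smoothOn hA
  have sσB := SmoothOn.dirDeriv hU hP.point.smoothOn hB
  have sςA := SmoothOn.dirDeriv hU hP.sphere.smoothOn hA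
  have sςB := SmoothOn.dirDeriv hU hP.sphere.smoothOn hB
  obtain ⟨E, hE⟩ : ∃ E : M → ℝ, E = fun y => form (dAt σ y (A y)) (dAt σ y (A y)) := ⟨_, rfl⟩
  obtain ⟨F, hF⟩ : ∃ F : M → ℝ, F = fun y => form (dAt σ y (A y)) (dAt σ y (B y)) := ⟨_, rfl⟩
  obtain ⟨G, hG⟩ : ∃ G : M → ℝ, G = fun y => form (dAt σ y (B y)) (dAt σ y (B y)) := ⟨_, rfl⟩
  obtain ⟨L, hL⟩ : ∃ L : M → ℝ, L = fun y => form (dAt ς y (A y)) (dAt σ y (A y)) := ⟨_, rfl⟩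
  obtain ⟨P, hPd⟩ : ∃ P : M → ℝ, P = fun y => form (dAt ς y (A y)) (dAt σ y (B y)) := ⟨_, rfl⟩
  obtain ⟨N, hN⟩ : ∃ N : M → ℝ, N = fun y => form (dAt ς y (B y)) (dAt σ y (B y)) := ⟨_, rfl⟩
  have sE : SmoothOn E U := hE ▸ sσA.form sσA
  have sF : SmoothOn F U := hF ▸ sσA.form sσB
  have sG : SmoothOn G U := hG ▸ sσB.form sσB
  have sL : SmoothOn L U := hL ▸ sςA.form sσA
  have sP : SmoothOn P U := hPd ▸ sςA.form sσB
  have sN : SmoothOn N U := hN ▸ sςB.form sσB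
  have vE := fun y => (congrFun hE y).symm
  have vF := fun y => (congrFun hF y).symm
  have vG := fun y => (congrFun hG y).symm
  have vL := fun y => (congrFun hL y).symm
  have vP := fun y => (congrFun hPd y).symm
  have vN := fun y => (congrFun hN y).symm
  obtain ⟨α, hα⟩ : ∃ α : M → ℝ, α = fun y => E y * G y - F y * F y := ⟨_, rfl⟩
  obtain ⟨β, hβ⟩ : ∃ β : M → ℝ, β = fun y => E y * N y + G y * L y - 2 * F y * P y := ⟨_, rfl⟩
  obtain ⟨D, hD⟩ : ∃ D : M → ℝ, D = fun y => β y * β y - 4 * α y * (L y * N y - P y * P y) :=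
    ⟨_, rfl⟩
  have c2 : SmoothOn (fun _ : M => (2 : ℝ)) U := contMDiffOn_const
  have c4 : SmoothOn (fun _ : M => (4 : ℝ)) U := contMDiffOn_const
  have sα : SmoothOn α U := hα ▸ (sE.mul sG).sub (sF.mul sF)
  have sβ : SmoothOn β U := hβ ▸ ((sE.mul sN).add (sG.mul sL)).sub ((c2.mul sF).mul sP)
  have sD : SmoothOn D U := hD ▸ (sβ.mul sβ).sub ((c4.mul sα).mul ((sL.mul sN).sub (sP.mul sP)))
  have pα : ∀ y ∈ U, 0 < α y := fun y hy => by
    have := hP.gram_pos hf hU hy (hAB y hy)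
    rw [vE, vF, vG] at this
    rw [hα]; exact this
  have pD : ∀ y ∈ U, 0 < D y := fun y hy => by
    have := hP.disc_pos hf hu hU hA hB hy (hAB y hy) (vE y) (vF y) (vG y) (vL y) (vP y) (vN y)
    rw [hD, hα, hβ]; exact this
  -- The sign `ε = ±1` selects one of the two roots.
  have main : ∀ ε : ℝ, ε * ε = 1 → ∃ (k : M → ℝ) (V : Set M), SmoothOn k U ∧ V ⊆ U ∧ IsOpen V ∧
      x ∈ V ∧ (∀ y ∈ U, k y = (- β y + ε * Real.sqrt (D y)) / (2 * α y)) ∧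
      ∃ X : ∀ y : M, TangentSpace (𝓡 2) y, SmoothVF X V ∧ (∀ y ∈ V, X y ≠ 0) ∧
        ∀ y ∈ V, SolderVanishes f y (X y) (ς y + k y • σ y) := by
    intro ε hε
    obtain ⟨k, hk⟩ : ∃ k : M → ℝ, k = fun y => (- β y + ε * Real.sqrt (D y)) * (2 * α y)⁻¹ :=
      ⟨_, rfl⟩
    have cε : SmoothOn (fun _ : M => ε) U := contMDiffOn_const
    have s2α : SmoothOn (fun y => 2 * α y) U := c2.mul sα
    have sk : SmoothOn k U := hk ▸ (sβ.neg.add (cε.mul (sD.sqrt fun y hy => (pD y hy).ne'))).mul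
      (s2α.inv fun y hy => mul_ne_zero two_ne_zero (pα y hy).ne')
    have kα : ∀ y ∈ U, 2 * α y * k y + β y = ε * Real.sqrt (D y) := fun y hy => by
      have := (pα y hy).ne'
      rw [hk]; field_simp; ring
    have hsq : ∀ y ∈ U, (2 * α y * k y + β y) * (2 * α y * k y + β y) = D y := fun y hy => by
      rw [kα y hy]
      linear_combination (Real.sqrt (D y) * Real.sqrt (D y)) * hε +
        Real.mul_self_sqrt (pD y hy).le
    have hroot : ∀ y ∈ U, (L y + k y * E y) * (N y + k y * G y) =
        (P y + k y * F y) * (P y + k y * F y) := fun y hy => by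
      have h1 := hsq y hy
      have h2 := (pα y hy).ne'
      refine mul_left_cancel₀ (mul_ne_zero four_ne_zero h2) ?_
      rw [hD] at h1
      rw [hβ] at h1
      rw [hα] at h1 ⊢
      linear_combination h1
    -- If the whole matrix vanished, `k x` would be a double root and the discriminant would be
    -- zero.
    have h0 : ¬ (L x + k x * E x = 0 ∧ P x + k x * F x = 0 ∧ N x + k x * G x = 0) := by
      rintro ⟨z1, z2, z3⟩
      have h1 := hsq x hx
      have h2 : 2 * α x * k x + β x = 0 := by
        rw [hα, hβ]
        linear_combination E x * z3 + G x * z1 - 2 * F x * z2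
      rw [h2, mul_zero] at h1
      exact (pD x hx).ne h1
    have hdir := hP.exists_curvature_direction hf hU hA hB hAB sk
    simp only [vE, vF, vG, vL, vP, vN] at hdir
    obtain ⟨V, hVU, hV, hxV, X, hX⟩ := hdir hroot hx h0
    exact ⟨k, V, sk, hVU, hV, hxV, fun y _ => by rw [hk, div_eq_mul_inv], X, hX⟩
  obtain ⟨k, V, sk, hVU, hV, hxV, hkv, X, sX, X0, hX⟩ := main 1 (by norm_num)
  obtain ⟨l, W, sl, hWU, hW, hxW, hlv, Y, sY, Y0, hY⟩ := main (-1) (by norm_num)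
  have hkl : ∀ y ∈ U, k y ≠ l y := fun y hy h => by
    rw [hkv y hy, hlv y hy, div_left_inj' (mul_ne_zero two_ne_zero (pα y hy).ne')] at h
    have := Real.sqrt_pos.2 (pD y hy)
    linarith
  have sec : ∀ m : M → ℝ, SmoothOn m U → IsSectionOn f U (fun y => ς y + m y • σ y) := fun m hm =>
    hP.sphere.add (hP.point.smul hm)
  have hV1 : V ∩ W ⊆ V := Set.inter_subset_left
  have hV2 : V ∩ W ⊆ W := Set.inter_subset_right
  -- The factor `-1` on the second sphere produces `(σ₂,𝔭) = -1`.
  have frame : IsCurvatureFrame f (V ∩ W) (fun y => ς y + k y • σ y)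
      (fun y => (-1 : ℝ) • (ς y + l y • σ y)) X Y := by
    refine ⟨(sec k sk).mono (hV1.trans hVU), ((sec l sl).const_smul _).mono (hV1.trans hVU),
      ContMDiffOn.mono sX hV1, ContMDiffOn.mono sY hV2, fun y hy => ?_, fun y hy => X0 y hy.1,
      fun y hy => Y0 y hy.2, fun y hy => hX y hy.1, fun y hy => ?_⟩
    · have hyU := hVU hy.1
      rw [LinearIndependent.pair_iff]
      intro a b hab
      have h1 : (a * k y - b * l y) • σ y + (a - b) • ς y = 0 := by rw [← hab]; module
      obtain ⟨h2, h3⟩ := LinearIndependent.pair_iff.1 (hP.indep hyU) _ _ h1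
      have hb : a = b := sub_eq_zero.1 h3
      rw [← hb, ← mul_sub] at h2
      have ha := (mul_eq_zero.1 h2).resolve_right (sub_ne_zero.2 (hkl y hyU))
      exact ⟨ha, hb ▸ ha⟩
    · have hyU := hVU hy.1
      refine solderVanishes_of_mem hf.subbundle hU hyU ((sec l sl).const_smul (-1)) ?_
      have h1 := hY y hy.2 U _ hU hyU (sec l sl) rfl
      have h2 := dAt_linear_mod hf.subbundle hU hU hyU hyU (sec l sl) (sec l sl)
        ((sec l sl).const_smul (-1)) (a := -1) (b := 0) (by simp) (Y y)
      have h3 := (f y).add_mem h2 ((f y).smul_mem (-1) h1)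
      rwa [zero_smul, add_zero, sub_add_cancel] at h3
  obtain ⟨X', Y', h⟩ := frame.normalize (𝔭 := 𝔭) hf (hV.inter hW)
    (fun y hy => by simp [hP.form_sphere y (hVU hy.1), hP.form_point y (hVU hy.1)])
    (fun y hy => by simp [hP.form_sphere y (hVU hy.1), hP.form_point y (hVU hy.1)])
  exact ⟨_, hV.inter hW, ⟨hxV, hxW⟩, _, _, X', Y', h⟩

end NormalizedFrames

end LieSphere

end

/-! ### Structure equations and closed forms in a normalised frame -/

noncomputable section

namespace LieSphere

section NormalizedCalculus

variable {M : Type*} [TopologicalSpace M] [ChartedSpace (EuclideanSpace ℝ (Fin 2)) M]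
variable {f : M → Submodule ℝ R42}

/-- The coefficient of `d_X σ` along a point section paired with `- d_X d_X ς`. -/
def connCoeff (σ ς : M → R42) (X : ∀ y : M, TangentSpace (𝓡 2) y) : M → ℝ :=
  fun y => - form (dAt σ y (X y)) (dAt (dirDeriv X ς) y (X y))

/-- The coefficient of the one-form `θ` in the curvature direction `X`. -/
def potCoeff (θ : OneForm M) (ς : M → R42) (X : ∀ y : M, TangentSpace (𝓡 2) y) : M → ℝ :=
  fun y => form (θ y (X y) (dAt ς y (X y))) (dAt (dirDeriv X ς) y (X y))

/-- A closed one-form whose values are bivectors `s ∧ ξ` with `s` in `f ∩ 𝔭^⊥` and `ξ` in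
`f^⊥ ∩ 𝔭^⊥`. -/
structure IsPointForm (f : M → Submodule ℝ R42) (𝔭 : R42) (θ : OneForm M) : Prop where
  closed : IsClosedForm θ
  kills : ∀ x Z, ∀ v ∈ f x, θ x Z v = 0
  values : ∀ x Z, ∀ s ∈ f x, form s 𝔭 = 0 → s ≠ 0 →
    ∃ ξ ∈ perp (f x), form ξ 𝔭 = 0 ∧ θ x Z = wedge s ξ

theorem IsPointForm.neg {𝔭 : R42} {θ : OneForm M} (h : IsPointForm f 𝔭 θ) :
    IsPointForm f (-𝔭) θ where
  closed := h.closed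
  kills := h.kills
  values x Z s hs hsp h0 := by
    obtain ⟨ξ, hξ, hξp, he⟩ := h.values x Z s hs (by simpa using hsp) h0
    exact ⟨ξ, hξ, by simpa using hξp, he⟩

/-- A function satisfying a linear first order equation vanishes near each of its zeros. -/
theorem eventually_eq_zero_of_dAt_eq [IsManifold (𝓡 2) ∞ M] {U : Set M} (hU : IsOpen U) {g : M → ℝ}
    {σ₁ σ₂ w₁ w₂ : M → R42} (hg : SmoothOn g U) (hσ₁ : SmoothOn σ₁ U) (hσ₂ : SmoothOn σ₂ U)
    (hw₁ : SmoothOn w₁ U) (hw₂ : SmoothOn w₂ U)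
    (hd : ∀ y ∈ U, ∀ Z, dAt g y Z = (form (dAt σ₁ y Z) (w₁ y) + form (dAt σ₂ y Z) (w₂ y)) * g y)
    {x : M} (hx : x ∈ U) (h0 : g x = 0) : ∀ᶠ y in 𝓝 x, g y = 0 := by
  set φ := chartAt (EuclideanSpace ℝ (Fin 2)) x with hφ
  have hxs : x ∈ φ.source := mem_chart_source _ x
  set O := φ.target ∩ φ.symm ⁻¹' U with hO
  have hOo : IsOpen O := φ.isOpen_inter_preimage_symm hU
  have hxO : φ x ∈ O := ⟨φ.map_source hxs, by
    change φ.symm (φ x) ∈ U; rw [φ.left_inv hxs]; exact hx⟩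
  obtain ⟨r, hr, hball⟩ := Metric.isOpen_iff.1 hOo _ hxO
  have cg : ContDiffOn ℝ ∞ (g ∘ φ.symm) O := contDiffOn_comp_symm (chart_mem x) hg
  have c1 : ContDiffOn ℝ ∞ (σ₁ ∘ φ.symm) O := contDiffOn_comp_symm (chart_mem x) hσ₁
  have c2 : ContDiffOn ℝ ∞ (σ₂ ∘ φ.symm) O := contDiffOn_comp_symm (chart_mem x) hσ₂
  have c3 : ContDiffOn ℝ ∞ (w₁ ∘ φ.symm) O := contDiffOn_comp_symm (chart_mem x) hw₁
  have c4 : ContDiffOn ℝ ∞ (w₂ ∘ φ.symm) O := contDiffOn_comp_symm (chart_mem x) hw₂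
  have hzero : ∀ u ∈ Metric.ball (φ x) r, g (φ.symm u) = 0 := by
    intro u hu
    set v := u - φ x with hv
    set γ : ℝ → EuclideanSpace ℝ (Fin 2) := fun t => φ x + t • v with hγ
    have hγO : ∀ t ∈ Set.Icc (0 : ℝ) 1, γ t ∈ O := by
      intro t ht
      refine hball ?_
      rw [Metric.mem_ball, dist_eq_norm, hγ, add_sub_cancel_left, norm_smul, Real.norm_eq_abs,
        abs_of_nonneg ht.1]
      rw [Metric.mem_ball, dist_eq_norm] at hu
      exact (mul_le_of_le_one_left (norm_nonneg _) ht.2).trans_lt hu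
    have hγc : Continuous γ := by fun_prop
    have hγd : ∀ t, HasDerivAt γ v t := fun t => by
      have := ((hasDerivAt_id t).smul_const v).const_add (φ x)
      rw [one_smul] at this
      exact this
    -- The coefficient of the equation along a segment in the chart. The shape of `hd` makes it
    -- visibly continuous, hence bounded on the segment, so a Grönwall estimate applies.
    set c : ℝ → ℝ := fun t =>
      formL (fderiv ℝ (σ₁ ∘ φ.symm) (γ t) v) (w₁ (φ.symm (γ t))) +
        formL (fderiv ℝ (σ₂ ∘ φ.symm) (γ t) v) (w₂ (φ.symm (γ t))) with hc
    have hcc : ContinuousOn c (Set.Icc 0 1) := by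
      have d1 : ContinuousOn (fun t => fderiv ℝ (σ₁ ∘ φ.symm) (γ t)) (Set.Icc 0 1) :=
        (c1.continuousOn_fderiv_of_isOpen hOo (by simp)).comp hγc.continuousOn hγO
      have d2 : ContinuousOn (fun t => fderiv ℝ (σ₂ ∘ φ.symm) (γ t)) (Set.Icc 0 1) :=
        (c2.continuousOn_fderiv_of_isOpen hOo (by simp)).comp hγc.continuousOn hγO
      have d3 : ContinuousOn (fun t => w₁ (φ.symm (γ t))) (Set.Icc 0 1) :=
        c3.continuousOn.comp hγc.continuousOn hγO
      have d4 : ContinuousOn (fun t => w₂ (φ.symm (γ t))) (Set.Icc 0 1) :=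
        c4.continuousOn.comp hγc.continuousOn hγO
      exact ((formL.continuous.comp_continuousOn (d1.clm_apply continuousOn_const)).clm_apply d3).add
        ((formL.continuous.comp_continuousOn (d2.clm_apply continuousOn_const)).clm_apply d4)
    obtain ⟨K, hK⟩ := isCompact_Icc.exists_bound_of_continuousOn hcc
    have hderiv : ∀ t ∈ Set.Icc (0 : ℝ) 1, HasDerivAt (fun t => g (φ.symm (γ t)))
        (c t * g (φ.symm (γ t))) t := by
      intro t ht
      have htO := hγO t ht
      have h1 : DifferentiableAt ℝ (g ∘ φ.symm) (γ t) :=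
        (cg.contDiffAt (hOo.mem_nhds htO)).differentiableAt (by simp)
      have h2 := h1.hasFDerivAt.comp_hasDerivAt t (hγd t)
      have h3 : fderiv ℝ (g ∘ φ.symm) (γ t) v = c t * g (φ.symm (γ t)) := by
        have q0 : fderiv ℝ (g ∘ φ.symm) (γ t) v = _ :=
          fderiv_comp_symm (chart_mem x) htO.1 (hg.mdifferentiableAt hU htO.2) v
        have q1 : fderiv ℝ (σ₁ ∘ φ.symm) (γ t) v = _ :=
          fderiv_comp_symm (chart_mem x) htO.1 (hσ₁.mdifferentiableAt hU htO.2) v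
        have q2 : fderiv ℝ (σ₂ ∘ φ.symm) (γ t) v = _ :=
          fderiv_comp_symm (chart_mem x) htO.1 (hσ₂.mdifferentiableAt hU htO.2) v
        simp only [hc, formL_apply]
        rw [q0, q1, q2]
        exact hd _ htO.2 _
      rw [h3] at h2
      exact h2
    have hres := eq_zero_of_abs_deriv_le_mul_abs_self_of_eq_zero_right
      (f := fun t => g (φ.symm (γ t))) (f' := fun t => c t * g (φ.symm (γ t))) (K := K)
      (a := 0) (b := 1) (fun t ht => (hderiv t ht).continuousAt.continuousWithinAt)
      (fun t ht => (hderiv t (Set.Ico_subset_Icc_self ht)).hasDerivWithinAt)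
      (by simp [hγ, φ.left_inv hxs, h0])
      (fun t ht => by
        rw [norm_mul]
        exact mul_le_mul_of_nonneg_right (hK t (Set.Ico_subset_Icc_self ht)) (norm_nonneg _))
      1 ⟨zero_le_one, le_rfl⟩
    simpa [hγ, hv] using hres
  have hcont := φ.continuousAt hxs
  filter_upwards [hcont.preimage_mem_nhds (Metric.ball_mem_nhds (φ x) hr),
    φ.open_source.mem_nhds hxs] with y hy hys
  have := hzero (φ y) hy
  rwa [φ.left_inv hys] at this

variable [IsManifold (𝓡 2) ∞ M]

section

variable {𝔭 : R42} {U : Set M} {σ₁ σ₂ : M → R42} {X Y : ∀ y : M, TangentSpace (𝓡 2) y} {y : M}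

theorem IsNormalizedFrame.section_sum (h : IsNormalizedFrame f 𝔭 U σ₁ σ₂ X Y) :
    IsSectionOn f U (fun y => σ₁ y + σ₂ y) :=
  h.frame.section₁.add h.frame.section₂

theorem IsNormalizedFrame.form_sum (h : IsNormalizedFrame f 𝔭 U σ₁ σ₂ X Y) (hy : y ∈ U) :
    form (σ₁ y + σ₂ y) 𝔭 = 0 := by
  rw [map_add, LinearMap.add_apply, h.form₁ y hy, h.form₂ y hy, add_neg_cancel]

theorem IsNormalizedFrame.sum_ne_zero (h : IsNormalizedFrame f 𝔭 U σ₁ σ₂ X Y) (hy : y ∈ U) :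
    σ₁ y + σ₂ y ≠ 0 := fun h0 => by
  have := LinearIndependent.pair_iff.1 (h.frame.indep y hy) 1 1 (by simpa using h0)
  exact one_ne_zero this.1

theorem IsNormalizedFrame.eq_smul_sum (h : IsNormalizedFrame f 𝔭 U σ₁ σ₂ X Y) (hf : IsLegendre f)
    (hy : y ∈ U) {v : R42} (hv : v ∈ f y) (hvp : form v 𝔭 = 0) :
    ∃ c : ℝ, v = c • (σ₁ y + σ₂ y) := by
  rw [h.frame.span_eq hf hy] at hv
  obtain ⟨a, b, rfl⟩ := Submodule.mem_span_pair.1 hv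
  simp only [map_add, map_smul, LinearMap.add_apply, LinearMap.smul_apply, smul_eq_mul,
    h.form₁ y hy, h.form₂ y hy] at hvp
  refine ⟨a, ?_⟩
  rw [smul_add, show b = a by linarith]

/-- The sum of the curvature spheres is orthogonal to `f^⊥`. -/
theorem IsNormalizedFrame.form_sum_e (h : IsNormalizedFrame f 𝔭 U σ₁ σ₂ X Y) (hf : IsLegendre f)
    (hU : IsOpen U) (hy : y ∈ U) : form (σ₁ y + σ₂ y) (dAt σ₁ y (Y y)) = 0 :=
  hf.dAt_mem_perp hU hy h.frame.section₁ _ _ (h.section_sum.mem y hy)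

/-- Differentiating `(σᵢ, d_X σ₂) = 0` gives `0` for `σ₁`, as `d_X σ₁ ∈ f`, and `-1` for `σ₂`. So
`-d_X d_X σ₂` reads off coefficients of `σ₁ + σ₂` smoothly, as in `connCoeff` and `potCoeff`. -/
theorem IsNormalizedFrame.form_sum_dAt_e (h : IsNormalizedFrame f 𝔭 U σ₁ σ₂ X Y)
    (hf : IsLegendre f) (hU : IsOpen U) (hy : y ∈ U) :
    form (σ₁ y + σ₂ y) (dAt (dirDeriv X σ₂) y (X y)) = -1 := by
  have h1 := hf.form_dAt_dirDeriv hU hy h.frame.section₁ h.frame.section₂ h.frame.smooth_X (X y)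
  have h2 := hf.form_dAt_dirDeriv hU hy h.frame.section₂ h.frame.section₂ h.frame.smooth_X (X y)
  have h3 : form (dAt σ₁ y (X y)) (dAt σ₂ y (X y)) = 0 :=
    hf.dAt_mem_perp hU hy h.frame.section₂ _ _ (h.frame.dAt_X_mem hU hy)
  rw [map_add, LinearMap.add_apply, h1, h2, h3, h.unit₂ y hy, neg_zero, zero_add]

/-- The derivative lies in `f`, and in `𝔭^⊥` because `(σ₁,𝔭)` is constant; their intersection is
spanned by `σ₁ + σ₂`. -/
theorem IsNormalizedFrame.dAt_X_eq (h : IsNormalizedFrame f 𝔭 U σ₁ σ₂ X Y)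
    (hf : IsLegendre f) (hU : IsOpen U) (hy : y ∈ U) :
    dAt σ₁ y (X y) = connCoeff σ₁ σ₂ X y • (σ₁ y + σ₂ y) := by
  obtain ⟨c, hc⟩ := h.eq_smul_sum hf hy (h.frame.dAt_X_mem hU hy)
    (form_dAt_eq_zero hU h.frame.section₁.smoothOn h.form₁ hy _)
  have : connCoeff σ₁ σ₂ X y = c := by
    rw [connCoeff, hc, map_smul, LinearMap.smul_apply, h.form_sum_dAt_e hf hU hy]
    simp
  rw [this, hc]

theorem IsNormalizedFrame.dAt_sum_X (h : IsNormalizedFrame f 𝔭 U σ₁ σ₂ X Y)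
    (hf : IsLegendre f) (hU : IsOpen U) (hy : y ∈ U) :
    dAt (fun y => σ₁ y + σ₂ y) y (X y) =
      connCoeff σ₁ σ₂ X y • (σ₁ y + σ₂ y) + dAt σ₂ y (X y) := by
  rw [dAt_add (h.frame.section₁.smoothOn.mdifferentiableAt hU hy)
    (h.frame.section₂.smoothOn.mdifferentiableAt hU hy), h.dAt_X_eq hf hU hy]

theorem IsNormalizedFrame.dAt_sum_Y (h : IsNormalizedFrame f 𝔭 U σ₁ σ₂ X Y)
    (hf : IsLegendre f) (hU : IsOpen U) (hy : y ∈ U) :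
    dAt (fun y => σ₁ y + σ₂ y) y (Y y) =
      connCoeff σ₂ σ₁ Y y • (σ₁ y + σ₂ y) + dAt σ₁ y (Y y) := by
  rw [dAt_add (h.frame.section₁.smoothOn.mdifferentiableAt hU hy)
    (h.frame.section₂.smoothOn.mdifferentiableAt hU hy), h.swap.dAt_X_eq hf hU hy, add_comm (σ₂ y),
    add_comm]

theorem IsCurvatureFrame.smoothOn_connCoeff (h : IsCurvatureFrame f U σ₁ σ₂ X Y)
    (hU : IsOpen U) : SmoothOn (connCoeff σ₁ σ₂ X) U := by
  have h1 := SmoothOn.dirDeriv hU h.section₁.smoothOn h.smooth_X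
  have h2 := SmoothOn.dirDeriv hU (SmoothOn.dirDeriv hU h.section₂.smoothOn h.smooth_X) h.smooth_X
  exact (h1.form h2).neg

/-- The derivatives of the unit normals and the commutator of the curvature directions. -/
theorem IsNormalizedFrame.dAt_e (h : IsNormalizedFrame f 𝔭 U σ₁ σ₂ X Y)
    (hf : IsLegendre f) (hU : IsOpen U) (hy : y ∈ U) {b c : ℝ}
    (hB : dAt (dirDeriv Y σ₁) y (X y) - dAt (dirDeriv X σ₁) y (Y y) =
      dAt σ₁ y (b • X y + c • Y y)) :
    c = - connCoeff σ₁ σ₂ X y ∧ ∃ ρ : ℝ, dAt (dirDeriv Y σ₁) y (X y) = ρ • (σ₁ y + σ₂ y) := by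
  have h1 : dAt (dirDeriv X σ₁) y (Y y) = dAt (connCoeff σ₁ σ₂ X) y (Y y) • (σ₁ y + σ₂ y) +
      connCoeff σ₁ σ₂ X y • (connCoeff σ₂ σ₁ Y y • (σ₁ y + σ₂ y) + dAt σ₁ y (Y y)) := by
    rw [dAt_congr_on (σ := dirDeriv X σ₁) hU hy (fun z hz => h.dAt_X_eq hf hU hz), dAt_smul
      ((h.frame.smoothOn_connCoeff hU).mdifferentiableAt hU hy)
      (h.section_sum.smoothOn.mdifferentiableAt hU hy), h.dAt_sum_Y hf hU hy]
  have h2 : dAt σ₁ y (b • X y + c • Y y) =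
      (b * connCoeff σ₁ σ₂ X y) • (σ₁ y + σ₂ y) + c • dAt σ₁ y (Y y) := by
    rw [map_add, map_smul, map_smul, h.dAt_X_eq hf hU hy, smul_smul]
  have h3 : dAt (dirDeriv Y σ₁) y (X y) =
      (b * connCoeff σ₁ σ₂ X y + dAt (connCoeff σ₁ σ₂ X) y (Y y) +
        connCoeff σ₁ σ₂ X y * connCoeff σ₂ σ₁ Y y) • (σ₁ y + σ₂ y) +
      (c + connCoeff σ₁ σ₂ X y) • dAt σ₁ y (Y y) := by
    rw [sub_eq_iff_eq_add.1 hB, h1, h2]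
    module
  have hd := SmoothOn.dirDeriv hU h.frame.section₁.smoothOn h.frame.smooth_Y
  have h4 := dAt_form (hd.mdifferentiableAt hU hy) (hd.mdifferentiableAt hU hy) (X y)
  rw [dAt_congr_on (σ := fun z => form (dirDeriv Y σ₁ z) (dirDeriv Y σ₁ z)) hU hy
    (fun z hz => h.unit₁ z hz), dAt_const, form_comm (dirDeriv Y σ₁ y)] at h4
  -- Unit length of `e₁` makes `d_X e₁` orthogonal to `e₁`, which determines the `Y` component `c`
  -- of the bracket.
  have h5 : form (dAt (dirDeriv Y σ₁) y (X y)) (dAt σ₁ y (Y y)) = 0 := by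
    have h6 : (0 : ℝ) = form (dAt (dirDeriv Y σ₁) y (X y)) (dAt σ₁ y (Y y)) +
      form (dAt (dirDeriv Y σ₁) y (X y)) (dAt σ₁ y (Y y)) := h4
    linarith
  rw [h3, map_add, LinearMap.add_apply, map_smul, map_smul, LinearMap.smul_apply,
    LinearMap.smul_apply, h.form_sum_e hf hU hy, h.unit₁ y hy, smul_zero, zero_add, smul_eq_mul,
    mul_one] at h5
  rw [h5, zero_smul, add_zero] at h3
  exact ⟨by linarith, _, h3⟩

variable {θ : OneForm M}

theorem IsNormalizedFrame.form_X_e (h : IsNormalizedFrame f 𝔭 U σ₁ σ₂ X Y) (hU : IsOpen U)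
    (hθ : IsPointForm f 𝔭 θ) (hy : y ∈ U) : θ y (X y) (dAt σ₁ y (Y y)) = 0 := by
  rw [hθ.closed.apply_dAt_comm hθ.kills hU h.frame.smooth_X h.frame.smooth_Y hy h.frame.section₁]
  exact hθ.kills y _ _ (h.frame.dAt_X_mem hU hy)

/-- Write `θ(X) = S ∧ ξ` with `S = σ₁ + σ₂`. The condition `θ(X) e₁ = 0` removes the `e₁` part of
`ξ`, and its `f` part is a multiple of `S`, which the wedge kills. -/
theorem IsNormalizedFrame.form_X_eq (h : IsNormalizedFrame f 𝔭 U σ₁ σ₂ X Y) (hf : IsLegendre f)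
    (hU : IsOpen U) (hθ : IsPointForm f 𝔭 θ) (hy : y ∈ U) :
    θ y (X y) = potCoeff θ σ₂ X y • wedge (σ₁ y + σ₂ y) (dAt σ₂ y (X y)) := by
  have hS := h.sum_ne_zero hy
  have hSf := h.section_sum.mem y hy
  have hSe := h.form_sum_e hf hU hy
  have hSe' : form (σ₁ y + σ₂ y) (dAt σ₂ y (X y)) = 0 := by
    rw [add_comm]; exact h.swap.form_sum_e hf hU hy
  have o := h.frame.e_orth hf hU hy
  obtain ⟨ξ, hξ, hξp, he⟩ := hθ.values y (X y) _ hSf (h.form_sum hy) hS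
  obtain ⟨w, hw, c, d, hwcd⟩ := h.frame.mem_perp_decomp hf hU hy hξ
  have hwe : form w (dAt σ₁ y (Y y)) = 0 := hf.dAt_mem_perp hU hy h.frame.section₁ _ _ hw
  have hc : c = 0 := by
    have h1 := h.form_X_e hU hθ hy
    rw [he, wedge_apply, hSe, zero_smul, zero_sub, neg_eq_zero] at h1
    have h2 := (smul_eq_zero.1 h1).resolve_right hS
    rw [hwcd] at h2
    simpa [hwe, h.unit₁ y hy, form_comm (dAt σ₂ y (X y)), o] using h2
  have hep : form (dAt σ₂ y (X y)) 𝔭 = 0 :=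
    form_dAt_eq_zero hU h.frame.section₂.smoothOn h.form₂ hy _
  rw [hc, zero_smul, add_zero] at hwcd
  have hwp : form w 𝔭 = 0 := by
    rw [hwcd] at hξp
    simpa [hep] using hξp
  obtain ⟨k, hk⟩ := h.eq_smul_sum hf hy hw hwp
  have hval : θ y (X y) = d • wedge (σ₁ y + σ₂ y) (dAt σ₂ y (X y)) := by
    rw [he, hwcd, hk, wedge_add_right, wedge_smul_right, wedge_smul_right, wedge_self, smul_zero,
      zero_add]
  have hd : potCoeff θ σ₂ X y = d := by
    rw [potCoeff, hval, smul_apply, wedge_apply, hSe', h.unit₂ y hy]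
    simp only [zero_smul, one_smul, zero_sub, smul_neg, map_neg, map_smul, LinearMap.neg_apply,
      LinearMap.smul_apply, h.form_sum_dAt_e hf hU hy]
    simp
  rw [hd, hval]

theorem IsNormalizedFrame.form_Y_eq (h : IsNormalizedFrame f 𝔭 U σ₁ σ₂ X Y) (hf : IsLegendre f)
    (hU : IsOpen U) (hθ : IsPointForm f 𝔭 θ) (hy : y ∈ U) :
    θ y (Y y) = potCoeff θ σ₁ Y y • wedge (σ₁ y + σ₂ y) (dAt σ₁ y (Y y)) := by
  rw [h.swap.form_X_eq hf hU hθ.neg hy, add_comm]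

theorem IsNormalizedFrame.smoothOn_potCoeff (h : IsNormalizedFrame f 𝔭 U σ₁ σ₂ X Y)
    (hU : IsOpen U) (hθ : IsPointForm f 𝔭 θ) : SmoothOn (potCoeff θ σ₂ X) U := by
  have h1 := SmoothOn.dirDeriv hU h.frame.section₂.smoothOn h.frame.smooth_X
  have h2 := SmoothOn.dirDeriv hU h1 h.frame.smooth_X
  have h3 := hθ.closed.smoothOn_apply hU h.frame.smooth_X
  exact SmoothOn.form (ContMDiffOn.clm_apply h3 h1) h2

/-- This is `dθ(X,Y) = 0` for `θ(X) = l₂ S ∧ e₂`, `θ(Y) = l₁ S ∧ e₁`. The `e₁ ∧ e₂` part gives `l₁ +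
l₂ = 0`; the `S ∧ e₁` and `S ∧ e₂` parts give the two derivatives, with factor `2` from the
derivative of `S` and the bracket together. -/
theorem IsNormalizedFrame.potCoeff_relations (h : IsNormalizedFrame f 𝔭 U σ₁ σ₂ X Y)
    (hf : IsLegendre f) (hU : IsOpen U) (hθ : IsPointForm f 𝔭 θ) (hy : y ∈ U) :
    potCoeff θ σ₁ Y y = - potCoeff θ σ₂ X y ∧
    dAt (potCoeff θ σ₁ Y) y (X y) = -2 * connCoeff σ₁ σ₂ X y * potCoeff θ σ₁ Y y ∧
    dAt (potCoeff θ σ₂ X) y (Y y) = -2 * connCoeff σ₂ σ₁ Y y * potCoeff θ σ₂ X y := by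
  obtain ⟨B, hB, hBθ⟩ := exists_bracket hU h.frame.smooth_X h.frame.smooth_Y hy
  obtain ⟨b, c, rfl⟩ := tangent_span (h.frame.tangent_indep hf hU hy) B
  obtain ⟨hc, ρ, hρ⟩ := h.dAt_e hf hU hy (hB σ₁ h.frame.section₁.smoothOn)
  have hB2 : dAt (dirDeriv X σ₂) y (Y y) - dAt (dirDeriv Y σ₂) y (X y) =
      dAt σ₂ y ((-c) • Y y + (-b) • X y) := by
    have h1 := hB σ₂ h.frame.section₂.smoothOn
    have h2 : (-c) • Y y + (-b) • X y = -(b • X y + c • Y y) := by module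
    rw [h2, map_neg, ← h1, neg_sub]
  obtain ⟨hb, ρ', hρ'⟩ := h.swap.dAt_e hf hU hy hB2
  rw [add_comm (σ₂ y)] at hρ'
  have hid := hBθ θ hθ.closed
  have sS := h.section_sum.smoothOn.mdifferentiableAt hU hy
  have se₁ := (SmoothOn.dirDeriv hU h.frame.section₁.smoothOn h.frame.smooth_Y).mdifferentiableAt
    hU hy
  have se₂ := (SmoothOn.dirDeriv hU h.frame.section₂.smoothOn h.frame.smooth_X).mdifferentiableAt
    hU hy
  have sl₁ := (h.swap.smoothOn_potCoeff hU hθ.neg).mdifferentiableAt hU hy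
  have sl₂ := (h.smoothOn_potCoeff hU hθ).mdifferentiableAt hU hy
  have sW₁ : MDifferentiableAt (𝓡 2) 𝓘(ℝ, R42 →L[ℝ] R42)
      (fun z => wedge (σ₁ z + σ₂ z) (dirDeriv Y σ₁ z)) y :=
    (SmoothOn.wedge h.section_sum.smoothOn (SmoothOn.dirDeriv hU h.frame.section₁.smoothOn
      h.frame.smooth_Y)).mdifferentiableAt hU hy
  have sW₂ : MDifferentiableAt (𝓡 2) 𝓘(ℝ, R42 →L[ℝ] R42)
      (fun z => wedge (σ₁ z + σ₂ z) (dirDeriv X σ₂ z)) y :=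
    (SmoothOn.wedge h.section_sum.smoothOn (SmoothOn.dirDeriv hU h.frame.section₂.smoothOn
      h.frame.smooth_X)).mdifferentiableAt hU hy
  rw [dAt_congr_on (ς := fun z => potCoeff θ σ₁ Y z • wedge (σ₁ z + σ₂ z) (dirDeriv Y σ₁ z)) hU hy
      (fun z hz => h.form_Y_eq hf hU hθ hz),
    dAt_congr_on (ς := fun z => potCoeff θ σ₂ X z • wedge (σ₁ z + σ₂ z) (dirDeriv X σ₂ z)) hU hy
      (fun z hz => h.form_X_eq hf hU hθ hz),
    dAt_smul sl₁ sW₁, dAt_smul sl₂ sW₂, dAt_wedge sS se₁, dAt_wedge sS se₂, hρ, hρ',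
    h.dAt_sum_X hf hU hy, h.dAt_sum_Y hf hU hy, map_add, map_smul, map_smul,
    h.form_X_eq hf hU hθ hy, h.form_Y_eq hf hU hθ hy] at hid
  simp only [wedge_smul_right, wedge_self, smul_zero, add_zero] at hid
  have e₁ : dirDeriv Y σ₁ y = dAt σ₁ y (Y y) := rfl
  have e₂ : dirDeriv X σ₂ y = dAt σ₂ y (X y) := rfl
  rw [e₁, e₂] at hid
  have hS := h.sum_ne_zero hy
  have u₁ := h.unit₁ y hy
  have u₂ := h.unit₂ y hy
  have o := h.frame.e_orth hf hU hy
  have o' : form (dAt σ₂ y (X y)) (dAt σ₁ y (Y y)) = 0 := by rw [form_comm]; exact o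
  have q₁ := h.form_sum_e hf hU hy
  have q₂ := h.swap.form_sum_e hf hU hy
  rw [add_comm (σ₂ y)] at q₂
  have hb' : b = connCoeff σ₂ σ₁ Y y := by linarith
  -- Applying the bivector identity to `e₁` and `e₂` isolates its components, since `S`, `e₁`, `e₂`
  -- are mutually orthogonal and the `eᵢ` are units.
  have r₁ := DFunLike.congr_fun hid (dAt σ₁ y (Y y))
  have r₂ := DFunLike.congr_fun hid (dAt σ₂ y (X y))
  generalize dAt σ₁ y (Y y) = E₁ at *
  generalize dAt σ₂ y (X y) = E₂ at *
  generalize σ₁ y + σ₂ y = S at *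
  simp only [wedge_add_left, wedge_smul_left, add_apply, sub_apply, smul_apply, wedge_apply,
    u₁, u₂, o, o', q₁, q₂, zero_smul, one_smul, zero_sub, sub_zero, smul_zero, add_zero,
    zero_add, smul_neg] at r₁ r₂
  have t₁ := congrArg (fun v => form v E₂) r₁
  simp only [map_add, map_sub, map_neg, map_smul, LinearMap.add_apply, LinearMap.sub_apply,
    LinearMap.neg_apply, LinearMap.smul_apply, smul_eq_mul, u₂, q₂] at t₁
  have hl : potCoeff θ σ₁ Y y = - potCoeff θ σ₂ X y := by linarith
  refine ⟨hl, ?_, ?_⟩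
  · have : (dAt (potCoeff θ σ₁ Y) y (X y) - -2 * connCoeff σ₁ σ₂ X y * potCoeff θ σ₁ Y y) • S
        = 0 := by
      rw [hc, hl] at r₁
      rw [hl]
      linear_combination (norm := module) (-1 : ℝ) • r₁
    exact sub_eq_zero.1 ((smul_eq_zero.1 this).resolve_right hS)
  · have : (dAt (potCoeff θ σ₂ X) y (Y y) - -2 * connCoeff σ₂ σ₁ Y y * potCoeff θ σ₂ X y) • S
        = 0 := by
      rw [hb', hl] at r₂
      linear_combination (norm := module) (1 : ℝ) • r₂
    exact sub_eq_zero.1 ((smul_eq_zero.1 this).resolve_right hS)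

end

end NormalizedCalculus

end LieSphere

end

/-! ### From an isothermic surface to a linear conserved quantity -/

noncomputable section

namespace LieSphere

section Lifts

variable {M : Type*} [TopologicalSpace M] [ChartedSpace (EuclideanSpace ℝ (Fin 2)) M]
variable {f : M → Submodule ℝ R42} {𝔭 : R42} {θ : OneForm M}

/-- The vector `v` is the derivative coefficient of `θ` on the curvature spheres of `f` at `x`. -/
def IsSphereCoefficient (f : M → Submodule ℝ R42) (𝔭 : R42) (θ : OneForm M) (x : M) (v : R42) :
    Prop :=
  ∀ (U : Set M) (ς : M → R42), IsOpen U → x ∈ U → IsSectionOn f U ς →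
    IsCurvatureSphere f x (Submodule.span ℝ {ς x}) → form (ς x) 𝔭 = 1 →
    ∀ Z : TangentSpace (𝓡 2) x, θ x Z (dAt ς x Z) = form (dAt ς x Z) (dAt ς x Z) • v

variable [IsManifold (𝓡 2) ∞ M]

/-- Since `Λ` is a line, any sum of bivectors in `Λ ∧ Λ⁽¹⁾` collapses to one `s ∧ ξ`, and `Λ⁽¹⁾`
lies in `f^⊥ ∩ 𝔭^⊥`. -/
theorem isPointForm_of_values (hf : IsLegendre f) {Λ : M → Submodule ℝ R42}
    (hΛ : ∀ x, Λ x = f x ⊓ perp (Submodule.span ℝ {𝔭}))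
    (hframe : ∀ x : M, ∃ U : Set M, IsOpen U ∧ x ∈ U ∧
      ∃ (σ₁ σ₂ : M → R42) (X Y : ∀ y : M, TangentSpace (𝓡 2) y), IsNormalizedFrame f 𝔭 U σ₁ σ₂ X Y)
    (hc : IsClosedForm θ) (hv : ∀ x X, θ x X ∈ wedgeSpan (Λ x) (derived Λ x)) :
    IsPointForm f 𝔭 θ := by
  have hder : ∀ x, ∀ ξ ∈ derived Λ x, ξ ∈ perp (f x) ∧ form ξ 𝔭 = 0 := by
    intro x ξ hξ
    induction hξ using Submodule.span_induction with
    | mem v hv =>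
      obtain ⟨U, σ, hU, hx, hσ, h⟩ := hv
      have hσf : IsSectionOn f U σ := ⟨hσ.smooth, fun z hz => by
        have := hσ.mem z hz; rw [hΛ] at this; exact this.1⟩
      have hσp : ∀ z ∈ U, form (σ z) 𝔭 = 0 := fun z hz => by
        have := hσ.mem z hz; rw [hΛ] at this; exact mem_perp_span_singleton.1 this.2
      rcases h with rfl | ⟨Z, rfl⟩
      · exact ⟨hf.isotropic x (hσf.mem x hx), hσp x hx⟩
      · exact ⟨hf.dAt_mem_perp hU hx hσf Z, form_dAt_eq_zero hU hσ.smoothOn hσp hx Z⟩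
    | zero => exact ⟨zero_mem _, by simp⟩
    | add v w _ _ hv hw => exact ⟨add_mem hv.1 hw.1, by simp [hv.2, hw.2]⟩
    | smul c v _ hv => exact ⟨Submodule.smul_mem _ c hv.1, by simp [hv.2]⟩
  have hval : ∀ x Z, ∀ s ∈ f x, form s 𝔭 = 0 → s ≠ 0 →
      ∃ ξ ∈ perp (f x), form ξ 𝔭 = 0 ∧ θ x Z = wedge s ξ := by
    intro x Z s hs hsp hs0
    obtain ⟨U, hU, hx, σ₁, σ₂, X, Y, h⟩ := hframe x
    obtain ⟨d, hd⟩ := h.eq_smul_sum hf hx hs hsp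
    have hd0 : d ≠ 0 := by rintro rfl; exact hs0 (by rw [hd, zero_smul])
    refine wedgeSpan_induction (P := fun A => ∃ ξ ∈ perp (f x), form ξ 𝔭 = 0 ∧ A = wedge s ξ)
      ?_ ?_ ?_ ?_ (hv x Z)
    · intro a ha b hb
      rw [hΛ] at ha
      obtain ⟨c, hc⟩ := h.eq_smul_sum hf hx ha.1 (mem_perp_span_singleton.1 ha.2)
      obtain ⟨hb1, hb2⟩ := hder x b hb
      refine ⟨(c / d) • b, Submodule.smul_mem _ _ hb1, by simp [hb2], ?_⟩
      rw [wedge_smul_right, ← wedge_smul_left, hd, smul_smul, div_mul_cancel₀ _ hd0, ← hc]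
    · exact ⟨0, zero_mem _, by simp, by rw [← zero_smul ℝ (0 : R42), wedge_smul_right, zero_smul]⟩
    · rintro A B ⟨a, ha, hap, rfl⟩ ⟨b, hb, hbp, rfl⟩
      exact ⟨a + b, add_mem ha hb, by simp [hap, hbp], (wedge_add_right _ _ _).symm⟩
    · rintro t A ⟨a, ha, hap, rfl⟩
      exact ⟨t • a, Submodule.smul_mem _ _ ha, by simp [hap], (wedge_smul_right _ _ _).symm⟩
  refine ⟨hc, fun x Z v hvf => ?_, hval⟩
  obtain ⟨U, hU, hx, σ₁, σ₂, X, Y, h⟩ := hframe x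
  obtain ⟨ξ, hξ, -, he⟩ := hval x Z _ (h.section_sum.mem x hx) (h.form_sum hx) (h.sum_ne_zero hx)
  have h1 : form ξ v = 0 := by rw [form_comm]; exact hξ v hvf
  rw [he, wedge_apply, h1, hf.form_eq_zero (h.section_sum.mem x hx) hvf, zero_smul, zero_smul,
    sub_zero]

section

variable {U : Set M} {σ₁ σ₂ : M → R42} {X Y : ∀ y : M, TangentSpace (𝓡 2) y} {y : M}

theorem IsNormalizedFrame.form_X_e₂ (h : IsNormalizedFrame f 𝔭 U σ₁ σ₂ X Y) (hf : IsLegendre f)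
    (hU : IsOpen U) (hθ : IsPointForm f 𝔭 θ) (hy : y ∈ U) :
    θ y (X y) (dAt σ₂ y (X y)) = (- potCoeff θ σ₂ X y) • (σ₁ y + σ₂ y) := by
  have hSe : form (σ₁ y + σ₂ y) (dAt σ₂ y (X y)) = 0 := by
    rw [add_comm]; exact h.swap.form_sum_e hf hU hy
  rw [h.form_X_eq hf hU hθ hy, smul_apply, wedge_apply, hSe, h.unit₂ y hy, zero_smul, one_smul,
    zero_sub, smul_neg, neg_smul]

theorem IsNormalizedFrame.form_Y_e₁ (h : IsNormalizedFrame f 𝔭 U σ₁ σ₂ X Y) (hf : IsLegendre f)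
    (hU : IsOpen U) (hθ : IsPointForm f 𝔭 θ) (hy : y ∈ U) :
    θ y (Y y) (dAt σ₁ y (Y y)) = potCoeff θ σ₂ X y • (σ₁ y + σ₂ y) := by
  rw [h.swap.form_X_e₂ hf hU hθ.neg hy, (h.potCoeff_relations hf hU hθ hy).1, neg_neg,
    add_comm (σ₂ y)]

theorem IsNormalizedFrame.form_eq_zero_iff (h : IsNormalizedFrame f 𝔭 U σ₁ σ₂ X Y)
    (hf : IsLegendre f) (hU : IsOpen U) (hθ : IsPointForm f 𝔭 θ) (hy : y ∈ U) :
    θ y = 0 ↔ potCoeff θ σ₂ X y = 0 := by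
  refine ⟨fun h0 => ?_, fun h0 => ?_⟩
  · have h1 := h.form_X_e₂ hf hU hθ hy
    rw [h0] at h1
    have h2 : (- potCoeff θ σ₂ X y) • (σ₁ y + σ₂ y) = 0 := h1.symm
    exact neg_eq_zero.1 ((smul_eq_zero.1 h2).resolve_right (h.sum_ne_zero hy))
  · refine ContinuousLinearMap.ext fun Z => ?_
    obtain ⟨z, w, rfl⟩ := tangent_span (h.frame.tangent_indep hf hU hy) Z
    rw [map_add, map_smul, map_smul, h.form_X_eq hf hU hθ hy, h.form_Y_eq hf hU hθ hy,
      (h.potCoeff_relations hf hU hθ hy).1, h0, neg_zero, zero_smul, zero_smul, smul_zero, smul_zero,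
      add_zero]
    rfl

/-- Pairing `d_Z σ₁` with `e₁` and `d_Z σ₂` with `e₂` recovers the `Y` and `X` components of `Z`.
This brings the derivative into the form required by `eventually_eq_zero_of_dAt_eq`. -/
theorem IsNormalizedFrame.dAt_potCoeff (h : IsNormalizedFrame f 𝔭 U σ₁ σ₂ X Y)
    (hf : IsLegendre f) (hU : IsOpen U) (hθ : IsPointForm f 𝔭 θ) (hy : y ∈ U)
    (Z : TangentSpace (𝓡 2) y) :
    dAt (potCoeff θ σ₂ X) y Z =
      (form (dAt σ₁ y Z) ((-2 * connCoeff σ₂ σ₁ Y y) • dirDeriv Y σ₁ y) +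
        form (dAt σ₂ y Z) ((-2 * connCoeff σ₁ σ₂ X y) • dirDeriv X σ₂ y)) * potCoeff θ σ₂ X y := by
  obtain ⟨z, w, rfl⟩ := tangent_span (h.frame.tangent_indep hf hU hy) Z
  obtain ⟨h1, h2, h3⟩ := h.potCoeff_relations hf hU hθ hy
  have h4 : dAt (potCoeff θ σ₁ Y) y (X y) = - dAt (potCoeff θ σ₂ X) y (X y) := by
    have hc : MDifferentiableAt (𝓡 2) 𝓘(ℝ, ℝ) (fun _ : M => (-1 : ℝ)) y := mdifferentiableAt_const
    rw [dAt_congr_on (ς := fun z => (-1 : ℝ) • potCoeff θ σ₂ X z) hU hy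
      (fun z hz => by rw [(h.potCoeff_relations hf hU hθ hz).1, neg_one_smul]),
      dAt_smul hc ((h.smoothOn_potCoeff hU hθ).mdifferentiableAt hU hy), dAt_const]
    simp
  have h5 : dAt (potCoeff θ σ₂ X) y (X y) =
      -2 * connCoeff σ₁ σ₂ X y * potCoeff θ σ₂ X y := by
    rw [h4, h1] at h2
    linarith
  have q₁ := h.form_sum_e hf hU hy
  have q₂ := h.swap.form_sum_e hf hU hy
  rw [add_comm (σ₂ y)] at q₂
  have d₂ := h.swap.dAt_X_eq hf hU hy
  rw [add_comm (σ₂ y)] at d₂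
  have e₁ : dirDeriv Y σ₁ y = dAt σ₁ y (Y y) := rfl
  have e₂ : dirDeriv X σ₂ y = dAt σ₂ y (X y) := rfl
  have l₁ : dAt σ₁ y (z • X y + w • Y y) =
      z • connCoeff σ₁ σ₂ X y • (σ₁ y + σ₂ y) + w • dAt σ₁ y (Y y) := by
    rw [map_add, map_smul, map_smul, h.dAt_X_eq hf hU hy]
  have l₂ : dAt σ₂ y (z • X y + w • Y y) =
      z • dAt σ₂ y (X y) + w • connCoeff σ₂ σ₁ Y y • (σ₁ y + σ₂ y) := by
    rw [map_add, map_smul, map_smul, d₂]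
  rw [map_add, map_smul, map_smul, h3, h5, l₁, l₂, e₁, e₂]
  generalize σ₁ y + σ₂ y = S at q₁ q₂ ⊢
  simp only [map_add, map_smul, LinearMap.add_apply, LinearMap.smul_apply, smul_eq_mul, q₁, q₂,
    h.unit₁ y hy, h.unit₂ y hy]
  ring

theorem IsNormalizedFrame.eventually_potCoeff_eq_zero (h : IsNormalizedFrame f 𝔭 U σ₁ σ₂ X Y)
    (hf : IsLegendre f) (hU : IsOpen U) (hθ : IsPointForm f 𝔭 θ) (hy : y ∈ U)
    (h0 : potCoeff θ σ₂ X y = 0) : ∀ᶠ z in 𝓝 y, potCoeff θ σ₂ X z = 0 := by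
  have c : SmoothOn (fun _ : M => (-2 : ℝ)) U := contMDiffOn_const
  have w₁ : SmoothOn (fun y => -2 * connCoeff σ₂ σ₁ Y y) U :=
    c.mul (h.frame.swap.smoothOn_connCoeff hU)
  have w₂ : SmoothOn (fun y => -2 * connCoeff σ₁ σ₂ X y) U :=
    c.mul (h.frame.smoothOn_connCoeff hU)
  exact eventually_eq_zero_of_dAt_eq hU (h.smoothOn_potCoeff hU hθ) h.frame.section₁.smoothOn
    h.frame.section₂.smoothOn
    (w₁.smul' (SmoothOn.dirDeriv hU h.frame.section₁.smoothOn h.frame.smooth_Y))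
    (w₂.smul' (SmoothOn.dirDeriv hU h.frame.section₂.smoothOn h.frame.smooth_X))
    (fun z hz Z => h.dAt_potCoeff hf hU hθ hz Z) hy h0

/-- A curvature sphere with `(ς,𝔭) = 1` takes the value `σ₁` or `-σ₂`, and the two signs in `θ(Y) e₁
= l S`, `θ(X) e₂ = -l S` match these. Hence `l S` is characterised without reference to a frame or
to the order of the spheres, and local choices agree. -/
theorem IsNormalizedFrame.isSphereCoefficient (h : IsNormalizedFrame f 𝔭 U σ₁ σ₂ X Y)
    (hf : IsLegendre f) (hU : IsOpen U) (hθ : IsPointForm f 𝔭 θ) (hy : y ∈ U) :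
    IsSphereCoefficient f 𝔭 θ y (potCoeff θ σ₂ X y • (σ₁ y + σ₂ y)) := by
  intro V ς hV hyV hς hcurv hςp Z
  obtain ⟨a, b, hab⟩ : ∃ a b : ℝ, a • σ₁ y + b • σ₂ y = ς y := by
    have := hς.mem y hyV
    rw [h.frame.span_eq hf hy] at this
    exact Submodule.mem_span_pair.1 this
  have hp : a - b = 1 := by
    rw [← hab] at hςp
    simpa [h.form₁ y hy, h.form₂ y hy, sub_eq_add_neg] using hςp
  -- With both coefficients non-zero the section would be immersed modulo `f`, so it would have no
  -- curvature direction.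
  have hab0 : a * b = 0 := by
    obtain ⟨-, -, T, hT, hTs⟩ := hcurv
    obtain ⟨W, hWT, hW⟩ := T.exists_mem_ne_zero_of_ne_bot hT
    have h1 := hTs W hWT (ς y) (Submodule.mem_span_singleton_self _) V ς hV hyV hς rfl
    obtain ⟨z, w, rfl⟩ := tangent_span (h.frame.tangent_indep hf hU hy) W
    have h2 := (f y).sub_mem h1
      (h.frame.dAt_section_mod hf hU hy hV hyV hς hab.symm z w)
    rw [sub_sub_cancel] at h2
    obtain ⟨h3, h4⟩ := h.frame.eq_zero_of_mem hf hU hy h2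
    by_contra hne
    rw [(mul_eq_zero.1 h3).resolve_right (left_ne_zero_of_mul hne),
      (mul_eq_zero.1 h4).resolve_right (right_ne_zero_of_mul hne)] at hW
    exact hW (by simp)
  obtain ⟨z, w, rfl⟩ := tangent_span (h.frame.tangent_indep hf hU hy) Z
  have hmod := h.frame.dAt_section_mod hf hU hy hV hyV hς hab.symm z w
  obtain ⟨u, hu⟩ : ∃ u, u = dAt ς y (z • X y + w • Y y) -
    ((w * a) • dAt σ₁ y (Y y) + (z * b) • dAt σ₂ y (X y)) := ⟨_, rfl⟩
  rw [← hu] at hmod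
  have hd : dAt ς y (z • X y + w • Y y) =
      u + ((w * a) • dAt σ₁ y (Y y) + (z * b) • dAt σ₂ y (X y)) := by rw [hu]; abel
  have o := h.frame.e_orth hf hU hy
  have u₁ : form u (dAt σ₁ y (Y y)) = 0 := hf.dAt_mem_perp hU hy h.frame.section₁ _ _ hmod
  have u₂ : form u (dAt σ₂ y (X y)) = 0 := hf.dAt_mem_perp hU hy h.frame.section₂ _ _ hmod
  have hnorm : form (dAt ς y (z • X y + w • Y y)) (dAt ς y (z • X y + w • Y y)) =
      w * a * (w * a) + z * b * (z * b) := by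
    rw [hd]
    simp only [map_add, map_smul, LinearMap.add_apply, LinearMap.smul_apply, smul_eq_mul,
      hf.form_eq_zero hmod hmod, form_comm _ u, u₁, u₂, form_comm (dAt σ₂ y (X y)), o,
      h.unit₁ y hy, h.unit₂ y hy]
    ring
  have hval : θ y (z • X y + w • Y y) (dAt ς y (z • X y + w • Y y)) =
      (w * w * a - z * z * b) • potCoeff θ σ₂ X y • (σ₁ y + σ₂ y) := by
    rw [hd, map_add (θ y _), hθ.kills y _ u hmod, zero_add, map_add (θ y), map_smul (θ y),
      map_smul (θ y)]
    simp only [map_add, map_smul, add_apply, smul_apply, h.form_X_e hU hθ hy,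
      h.swap.form_X_e hU hθ.neg hy, h.form_X_e₂ hf hU hθ hy, h.form_Y_e₁ hf hU hθ hy]
    module
  rw [hval, hnorm]
  congr 1
  rcases mul_eq_zero.1 hab0 with rfl | rfl
  · have : b = -1 := by linarith
    rw [this]; ring
  · have : a = 1 := by linarith
    rw [this]; ring

theorem IsNormalizedFrame.eq_of_isSphereCoefficient (h : IsNormalizedFrame f 𝔭 U σ₁ σ₂ X Y)
    (hf : IsLegendre f) (hU : IsOpen U) (hθ : IsPointForm f 𝔭 θ) (hy : y ∈ U) {v : R42}
    (hv : IsSphereCoefficient f 𝔭 θ y v) : v = potCoeff θ σ₂ X y • (σ₁ y + σ₂ y) := by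
  have h1 := hv U σ₁ hU hy h.frame.section₁
    (by simpa using h.frame.isCurvatureSphere hf hU hy one_ne_zero) (h.form₁ y hy) (Y y)
  rw [h.unit₁ y hy, one_smul, h.form_Y_e₁ hf hU hθ hy] at h1
  exact h1.symm

end

/-- A non-zero point form on a connected surface has no zeros. -/
theorem IsPointForm.ne_zero [ConnectedSpace M] (hθ : IsPointForm f 𝔭 θ) (hf : IsLegendre f)
    (hframe : ∀ x : M, ∃ U : Set M, IsOpen U ∧ x ∈ U ∧
      ∃ (σ₁ σ₂ : M → R42) (X Y : ∀ y : M, TangentSpace (𝓡 2) y), IsNormalizedFrame f 𝔭 U σ₁ σ₂ X Y)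
    (hne : ∃ x, θ x ≠ 0) (x : M) : θ x ≠ 0 := by
  have hopen : IsOpen {x | θ x = 0} := by
    rw [isOpen_iff_mem_nhds]
    intro x hx
    obtain ⟨U, hU, hxU, σ₁, σ₂, X, Y, h⟩ := hframe x
    have h0 := h.eventually_potCoeff_eq_zero hf hU hθ hxU
      ((h.form_eq_zero_iff hf hU hθ hxU).1 hx)
    filter_upwards [h0, hU.mem_nhds hxU] with z hz hzU
    exact (h.form_eq_zero_iff hf hU hθ hzU).2 hz
  have hclosed : IsClosed {x | θ x = 0} := by
    rw [← isOpen_compl_iff, isOpen_iff_mem_nhds]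
    intro x hx
    obtain ⟨U, hU, hxU, σ₁, σ₂, X, Y, h⟩ := hframe x
    have hop := (h.smoothOn_potCoeff hU hθ).isOpen_ne_zero hU
    filter_upwards [hop.mem_nhds ⟨hxU, fun h0 => hx ((h.form_eq_zero_iff hf hU hθ hxU).2 h0)⟩]
      with z hz hz0
    exact hz.2 ((h.form_eq_zero_iff hf hU hθ hz.1).1 hz0)
  obtain ⟨x₀, hx₀⟩ := hne
  rcases isClopen_iff.1 ⟨hclosed, hopen⟩ with he | he
  · exact fun h0 => Set.notMem_empty x (he ▸ (h0 : x ∈ {x | θ x = 0}))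
  · exact absurd (he ▸ Set.mem_univ x₀ : x₀ ∈ {x | θ x = 0}) hx₀

/-- The sphere coefficients of a nowhere zero point form are a smooth section of `f ∩ 𝔭^⊥`. -/
theorem IsPointForm.exists_coefficient (hθ : IsPointForm f 𝔭 θ) (hf : IsLegendre f)
    (hframe : ∀ x : M, ∃ U : Set M, IsOpen U ∧ x ∈ U ∧
      ∃ (σ₁ σ₂ : M → R42) (X Y : ∀ y : M, TangentSpace (𝓡 2) y),
        IsNormalizedFrame f 𝔭 U σ₁ σ₂ X Y) :
    ∃ s : M → R42, ContMDiff (𝓡 2) 𝓘(ℝ, R42) ∞ s ∧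
      ∀ (U : Set M) (σ₁ σ₂ : M → R42) (X Y : ∀ y : M, TangentSpace (𝓡 2) y), IsOpen U →
        IsNormalizedFrame f 𝔭 U σ₁ σ₂ X Y →
        ∀ y ∈ U, s y = potCoeff θ σ₂ X y • (σ₁ y + σ₂ y) := by
  have hex : ∀ x, ∃ v, IsSphereCoefficient f 𝔭 θ x v := fun x => by
    obtain ⟨U, hU, hx, σ₁, σ₂, X, Y, h⟩ := hframe x
    exact ⟨_, h.isSphereCoefficient hf hU hθ hx⟩
  choose s hs using hex
  have key : ∀ (U : Set M) (σ₁ σ₂ : M → R42) (X Y : ∀ y : M, TangentSpace (𝓡 2) y), IsOpen U →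
      IsNormalizedFrame f 𝔭 U σ₁ σ₂ X Y →
      ∀ y ∈ U, s y = potCoeff θ σ₂ X y • (σ₁ y + σ₂ y) := fun U σ₁ σ₂ X Y hU h y hy =>
    h.eq_of_isSphereCoefficient hf hU hθ hy (hs y)
  refine ⟨s, fun x => ?_, key⟩
  obtain ⟨U, hU, hx, σ₁, σ₂, X, Y, h⟩ := hframe x
  have hsm : SmoothOn (fun y => potCoeff θ σ₂ X y • (σ₁ y + σ₂ y)) U :=
    (h.smoothOn_potCoeff hU hθ).smul' h.section_sum.smoothOn
  exact (hsm.contMDiffAt (hU.mem_nhds hx)).congr_of_eventuallyEq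
    (Filter.eventually_of_mem (hU.mem_nhds hx) (key U σ₁ σ₂ X Y hU h))

/-- The bracket vanishes since all values share the factor `S`. In the frame `X`, `Y` the form `q`
is diagonal with entries `-l` and `l`, so it is non-degenerate exactly where `θ ≠ 0`. -/
theorem IsPointForm.isOmegaPotential (hθ : IsPointForm f 𝔭 θ) (hf : IsLegendre f)
    (hframe : ∀ x : M, ∃ U : Set M, IsOpen U ∧ x ∈ U ∧
      ∃ (σ₁ σ₂ : M → R42) (X Y : ∀ y : M, TangentSpace (𝓡 2) y), IsNormalizedFrame f 𝔭 U σ₁ σ₂ X Y)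
    (hne : ∀ x, θ x ≠ 0) : IsOmegaPotential f θ where
  closed := hθ.closed
  values x Z := by
    obtain ⟨U, hU, hx, σ₁, σ₂, X, Y, h⟩ := hframe x
    obtain ⟨ξ, hξ, -, he⟩ := hθ.values x Z _ (h.section_sum.mem x hx) (h.form_sum hx)
      (h.sum_ne_zero hx)
    rw [he]
    exact wedge_mem_wedgeSpan (h.section_sum.mem x hx) hξ
  bracket x Z W := by
    obtain ⟨U, hU, hx, σ₁, σ₂, X, Y, h⟩ := hframe x
    have hS := h.section_sum.mem x hx
    obtain ⟨ξ, hξ, -, he⟩ := hθ.values x Z _ hS (h.form_sum hx) (h.sum_ne_zero hx)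
    obtain ⟨ζ, hζ, -, he'⟩ := hθ.values x W _ hS (h.form_sum hx) (h.sum_ne_zero hx)
    have hcomm : θ x Z * θ x W = θ x W * θ x Z := by
      rw [he, he']
      exact wedge_mul_comm (hf.form_eq_zero hS hS) (hξ _ hS) (hζ _ hS)
    rw [bracketWedge, hcomm, sub_self]
  nondegenerate x Z hZ := by
    obtain ⟨U, hU, hx, σ₁, σ₂, X, Y, h⟩ := hframe x
    obtain ⟨z, w, rfl⟩ := tangent_span (h.frame.tangent_indep hf hU hx) Z
    have hl : potCoeff θ σ₂ X x ≠ 0 := fun h0 => hne x ((h.form_eq_zero_iff hf hU hθ hx).2 h0)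
    have hq := h.frame.quadDiff_eq hf hU hx (hθ.kills x) (h.form_X_e hU hθ hx)
      (h.swap.form_X_e hU hθ.neg hx)
      ((h.form_Y_e₁ hf hU hθ hx).trans (smul_add _ _ _))
      ((h.form_X_e₂ hf hU hθ hx).trans (smul_add _ _ _)) z w
    have h1 := hq 1 0
    have h2 := hq 0 1
    rw [hZ] at h1 h2
    have hz : z = 0 := by
      refine (mul_eq_zero.1 (?_ : z * potCoeff θ σ₂ X x = 0)).resolve_right hl
      linear_combination h1
    have hw : w = 0 := by
      refine (mul_eq_zero.1 (?_ : w * potCoeff θ σ₂ X x = 0)).resolve_right hl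
      linear_combination -h2
    rw [hz, hw, zero_smul, zero_smul, add_zero]

/-- In a normalised frame, subtracting the derivative of `l σ₁ ∧ σ₂` from a point form leaves the
middle potential. -/
theorem IsNormalizedFrame.middle {U : Set M} {σ₁ σ₂ : M → R42}
    {X Y : ∀ y : M, TangentSpace (𝓡 2) y} {y : M} (h : IsNormalizedFrame f 𝔭 U σ₁ σ₂ X Y)
    (hf : IsLegendre f) (hU : IsOpen U) (hθ : IsPointForm f 𝔭 θ) (hy : y ∈ U)
    {τ : M → (R42 →L[ℝ] R42)}
    (hτ : ∀ z ∈ U, τ z = potCoeff θ σ₂ X z • wedge (σ₁ z) (σ₂ z)) (Z : TangentSpace (𝓡 2) y) :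
    ∃ a ∈ wedgeSpan (cyclide σ₁ Y y) (cyclide σ₁ Y y) ⊔
        wedgeSpan (cyclide σ₂ X y) (cyclide σ₂ X y),
      ∃ b ∈ wedgeSpan (cyclide σ₁ Y y) (cyclide σ₂ X y),
        θ y Z - dAt τ y Z = a + b ∧ b ∈ wedgeSpan (f y) (f y) := by
  obtain ⟨z, w, rfl⟩ := tangent_span (h.frame.tangent_indep hf hU hy) Z
  set l := potCoeff θ σ₂ X y with hl
  have s₁ := h.frame.section₁.smoothOn.mdifferentiableAt hU hy
  have s₂ := h.frame.section₂.smoothOn.mdifferentiableAt hU hy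
  have sW : MDifferentiableAt (𝓡 2) 𝓘(ℝ, R42 →L[ℝ] R42) (fun z => wedge (σ₁ z) (σ₂ z)) y :=
    (SmoothOn.wedge h.frame.section₁.smoothOn h.frame.section₂.smoothOn).mdifferentiableAt hU hy
  have sl := (h.smoothOn_potCoeff hU hθ).mdifferentiableAt hU hy
  have d₂ := h.swap.dAt_X_eq hf hU hy
  have hd : ∀ W : TangentSpace (𝓡 2) y, dAt τ y W = dAt (potCoeff θ σ₂ X) y W • wedge (σ₁ y) (σ₂ y) +
      l • (wedge (dAt σ₁ y W) (σ₂ y) + wedge (σ₁ y) (dAt σ₂ y W)) := fun W => by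
    rw [dAt_congr_on hU hy hτ, dAt_smul sl sW, dAt_wedge s₁ s₂]
  -- In `θ(X) = l (σ₁ + σ₂) ∧ e₂` the mixed term `l σ₁ ∧ e₂` is the one produced by `dτ`; what
  -- remains is `l σ₂ ∧ e₂` in `S₂ ∧ S₂` and a multiple of `σ₁ ∧ σ₂`.
  have hX : ∃ k : ℝ, θ y (X y) - dAt τ y (X y) =
      l • wedge (σ₂ y) (dAt σ₂ y (X y)) + k • wedge (σ₁ y) (σ₂ y) := by
    refine ⟨- (dAt (potCoeff θ σ₂ X) y (X y) + l * connCoeff σ₁ σ₂ X y), ?_⟩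
    rw [hd, h.form_X_eq hf hU hθ hy, h.dAt_X_eq hf hU hy, wedge_smul_left, wedge_add_left,
      wedge_add_left, wedge_self]
    module
  have hY : ∃ k : ℝ, θ y (Y y) - dAt τ y (Y y) =
      (-l) • wedge (σ₁ y) (dAt σ₁ y (Y y)) + k • wedge (σ₁ y) (σ₂ y) := by
    refine ⟨- (dAt (potCoeff θ σ₂ X) y (Y y) + l * connCoeff σ₂ σ₁ Y y), ?_⟩
    rw [hd, h.form_Y_eq hf hU hθ hy, (h.potCoeff_relations hf hU hθ hy).1, d₂, wedge_smul_right,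
      wedge_add_right, wedge_add_left, wedge_self, wedge_swap (dAt σ₁ y (Y y)) (σ₂ y)]
    module
  obtain ⟨k, hk⟩ := hX
  obtain ⟨k', hk'⟩ := hY
  have m₁ : σ₁ y ∈ cyclide σ₁ Y y := Submodule.subset_span (by simp)
  have m₁' : dAt σ₁ y (Y y) ∈ cyclide σ₁ Y y := Submodule.subset_span (by simp [dirDeriv])
  have m₂ : σ₂ y ∈ cyclide σ₂ X y := Submodule.subset_span (by simp)
  have m₂' : dAt σ₂ y (X y) ∈ cyclide σ₂ X y := Submodule.subset_span (by simp [dirDeriv])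
  refine ⟨(-(w * l)) • wedge (σ₁ y) (dAt σ₁ y (Y y)) + (z * l) • wedge (σ₂ y) (dAt σ₂ y (X y)),
    Submodule.add_mem_sup (Submodule.smul_mem _ _ (wedge_mem_wedgeSpan m₁ m₁'))
      (Submodule.smul_mem _ _ (wedge_mem_wedgeSpan m₂ m₂')),
    (z * k + w * k') • wedge (σ₁ y) (σ₂ y), Submodule.smul_mem _ _ (wedge_mem_wedgeSpan m₁ m₂), ?_,
    Submodule.smul_mem _ _ (wedge_mem_wedgeSpan (h.frame.section₁.mem y hy)
      (h.frame.section₂.mem y hy))⟩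
  have e : θ y (z • X y + w • Y y) - dAt τ y (z • X y + w • Y y) =
      z • (θ y (X y) - dAt τ y (X y)) + w • (θ y (Y y) - dAt τ y (Y y)) := by
    rw [map_add, map_add, map_smul, map_smul, map_smul, map_smul]
    module
  rw [e, hk, hk']
  module

/-- A Legendre lift of an isothermic surface is a special `Ω`-surface. -/
theorem IsIsothermicSurface.exists_isLinearNormConstant [ConnectedSpace M]
    {Λ : M → Submodule ℝ R42} (hΛ : IsIsothermicSurface 𝔭 Λ) (hl : IsLegendreLift 𝔭 f Λ)
    (hu : IsUmbilicFree f) (hp : form 𝔭 𝔭 ≠ 0) :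
    ∃ (η μ : OneForm M) (p : Fin 2 → M → R42), IsLinearNormConstant f η μ p 𝔭 := by
  obtain ⟨hf, hlift⟩ := hl
  obtain ⟨θ, hc, hv, hne⟩ := hΛ.form_exists
  have hframe := exists_normalizedFrame hf hu hΛ.subbundle hlift hΛ.immersive
  have hθ := isPointForm_of_values hf hlift hframe hc hv
  have hne' := hθ.ne_zero hf hframe hne
  obtain ⟨s, hs, hsv⟩ := hθ.exists_coefficient hf hframe
  have hsf : ∀ x, s x ∈ f x := fun x => by
    obtain ⟨U, hU, hx, σ₁, σ₂, X, Y, h⟩ := hframe x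
    rw [hsv U σ₁ σ₂ X Y hU h x hx]
    exact (f x).smul_mem _ (h.section_sum.mem x hx)
  have hsp : ∀ x, form (s x) 𝔭 = 0 := fun x => by
    obtain ⟨U, hU, hx, σ₁, σ₂, X, Y, h⟩ := hframe x
    rw [hsv U σ₁ σ₂ X Y hU h x hx, map_smul, LinearMap.smul_apply, h.form_sum hx, smul_zero]
  have hs0 : ∀ x, s x ≠ 0 := fun x => by
    obtain ⟨U, hU, hx, σ₁, σ₂, X, Y, h⟩ := hframe x
    rw [hsv U σ₁ σ₂ X Y hU h x hx]
    exact smul_ne_zero (fun h0 => hne' x ((h.form_eq_zero_iff hf hU hθ hx).2 h0)) (h.sum_ne_zero hx)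
  have hspan : ∀ x, ∀ v ∈ f x, form v 𝔭 = 0 → v ∈ Submodule.span ℝ {s x} := fun x v hvf hvp => by
    obtain ⟨U, hU, hx, σ₁, σ₂, X, Y, h⟩ := hframe x
    have hl0 : potCoeff θ σ₂ X x ≠ 0 := fun h0 => hne' x ((h.form_eq_zero_iff hf hU hθ hx).2 h0)
    obtain ⟨c, hc⟩ := h.eq_smul_sum hf hx hvf hvp
    refine Submodule.mem_span_singleton.2 ⟨c / potCoeff θ σ₂ X x, ?_⟩
    rw [hsv U σ₁ σ₂ X Y hU h x hx, smul_smul, div_mul_cancel₀ _ hl0, hc]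
  have hone := exists_form_ne_zero hf hΛ.subbundle hlift
  -- As `τ𝔭 = s` and `θ𝔭 = 0`, the form `μ = θ - dτ` satisfies `μ𝔭 = -ds`; together with `μ s = 0`
  -- this is the conservation of `𝔭 + t s`.
  obtain ⟨τ, hτ, hτf, hτv⟩ := exists_bivector hf.subbundle hs hsf hone hspan
  have hτp : ∀ x, τ x 𝔭 = s x := fun x => by
    obtain ⟨U, hU, hx, σ₁, σ₂, X, Y, h⟩ := hframe x
    rw [hτv x (σ₁ x) (h.frame.section₁.mem x hx) (h.form₁ x hx), wedge_apply, h.form₁ x hx, hsp,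
      one_smul, zero_smul, sub_zero]
  have hdτp : ∀ x Z, dAt τ x Z 𝔭 = dAt s x Z := fun x Z => by
    have hc : MDifferentiableAt (𝓡 2) 𝓘(ℝ, R42) (fun _ : M => 𝔭) x := mdifferentiableAt_const
    have h1 := dAt_clm_apply ((hτ x).mdifferentiableAt (by simp)) hc Z
    rw [dAt_const, funext hτp] at h1
    simpa using h1.symm
  have hθp : ∀ x Z, θ x Z 𝔭 = 0 := fun x Z => by
    obtain ⟨ξ, -, hξp, he⟩ := hθ.values x Z (s x) (hsf x) (hsp x) (hs0 x)
    rw [he, wedge_apply, hsp, hξp, zero_smul, zero_smul, sub_zero]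
  have heval : ∀ t x, evalPoly (d := 1) ![fun _ => 𝔭, s] t x = 𝔭 + t • s x := fun t x => by
    simp [evalPoly, Fin.sum_univ_two]
  refine ⟨θ, fun x => θ x - dAt τ x, ![fun _ => 𝔭, s], hθ.isOmegaPotential hf hframe hne',
    ⟨⟨τ, hτ, hτf, fun x => rfl⟩, fun x => ?_⟩, ⟨fun k => ?_, ?_, fun t x Z => ?_⟩, fun x => ?_,
    form 𝔭 𝔭, hp, fun t x => ?_⟩
  · obtain ⟨U, hU, hx, σ₁, σ₂, X, Y, h⟩ := hframe x
    refine ⟨U, hU, hx, σ₁, σ₂, X, Y, h.frame, fun y hy Z => ?_⟩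
    refine h.middle hf hU hθ hy (fun z hz => ?_) Z
    rw [hτv z (σ₁ z) (h.frame.section₁.mem z hz) (h.form₁ z hz), hsv U σ₁ σ₂ X Y hU h z hz,
      wedge_smul_right, wedge_add_right, wedge_self, zero_add]
  · fin_cases k
    · exact contMDiff_const
    · exact hs
  · obtain ⟨x⟩ := (inferInstance : Nonempty M)
    exact ⟨x, hs0 x⟩
  · have h1 : dAt (evalPoly (d := 1) ![fun _ => 𝔭, s] t) x Z = t • dAt s x Z := by
      have hc : MDifferentiableAt (𝓡 2) 𝓘(ℝ, R42) (fun _ : M => 𝔭) x := mdifferentiableAt_const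
      have hc' : MDifferentiableAt (𝓡 2) 𝓘(ℝ, ℝ) (fun _ : M => t) x := mdifferentiableAt_const
      have hs' : MDifferentiableAt (𝓡 2) 𝓘(ℝ, R42) s x := (hs x).mdifferentiableAt (by simp)
      have hts : MDifferentiableAt (𝓡 2) 𝓘(ℝ, R42) (fun y => t • s y) x := hc'.smul hs'
      rw [funext (heval t), dAt_add hc hts, dAt_smul hc' hs', dAt_const, dAt_const]
      simp
    have h2 : (θ x - dAt τ x) Z (𝔭 + t • s x) = - dAt s x Z := by
      change (θ x Z - dAt τ x Z) (𝔭 + t • s x) = _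
      rw [sub_apply, map_add, map_add, hθp, hdτp, map_smul, map_smul, hθ.kills x Z _ (hsf x),
        (isAdapted_dAt hf hτ hτf x Z).kills _ (hsf x), smul_zero, add_zero, add_zero, zero_sub]
    rw [h1, heval, h2, smul_neg, add_neg_cancel]
  · rw [heval, zero_smul, add_zero]
  · rw [heval]
    simp [hsp, form_comm 𝔭 (s x), hf.form_eq_zero (hsf x) (hsf x)]

end Lifts

end LieSphere

end

/-! ### The main theorem -/

open LieSphere in
theorem mainTheorem1 {M : Type*} [TopologicalSpace M] [ConnectedSpace M]
    [ChartedSpace (EuclideanSpace ℝ (Fin 2)) M] [IsManifold (𝓡 2) ∞ M]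
    (f : M → Submodule ℝ R42) (hf : IsLegendre f) (hu : IsUmbilicFree f) (𝔭 : R42) :
    ((∃ (η μ : OneForm M) (p : Fin 2 → M → R42), IsLinearNormConstant f η μ p 𝔭) ↔
      form 𝔭 𝔭 ≠ 0 ∧
        ∃ Λ : M → Submodule ℝ R42, IsIsothermicSurface 𝔭 Λ ∧ IsLegendreLift 𝔭 f Λ) ∧
    (∀ (η μ : OneForm M) (p : Fin 2 → M → R42), IsLinearNormConstant f η μ p 𝔭 →
      ∃ s : M → Submodule ℝ R42, IsIsothermicSphereCongruence f η s ∧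
        (∀ x, s x ≤ perp (Submodule.span ℝ {𝔭})) ∧
        IsIsothermicSurface 𝔭 s ∧ IsLegendreLift 𝔭 f s) := by
  refine ⟨⟨?_, ?_⟩, fun η μ p h => h.conclusion hf⟩
  · rintro ⟨η, μ, p, h⟩
    obtain ⟨s, -, -, hs, hl⟩ := h.conclusion hf
    exact ⟨(h.isConservedSection hf).norm_ne, s, hs, hl⟩
  · rintro ⟨hp, Λ, hΛ, hl⟩
    exact hΛ.exists_isLinearNormConstant hl hu hp
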